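/- **Setting.** Let $q\in\mathbb R\setminus\{0,\pm1\}$. Let $\mathcal A=\mathrm{Fun}_q(GL(3,\mathbb C))$ be the unital complex algebra generated by $z^i{}_j$ $(i,j=1,2,3)$ and $\mathcal D^{-1}$ with relations $z^i{}_jz^i{}_k=q\,z^i{}_kz^i{}_j$ $(j<k)$, $z^i{}_jz^k{}_j=q\,z^k{}_jz^i{}_j$ $(i<k)$, $z^i{}_jz^k{}_l=z^k{}_lz^i{}_j$ $(i<k,\ j>l)$, $z^i{}_jz^k{}_l=z^k{}_lz^i{}_j+(q-q^{-1})z^k{}_jz^i{}_l$ $(i<k,\ j<l)$, and $\mathcal D\mathcal D^{-1}=\mathcal D^{-1}\mathcal D=1$, where $$\mathcal D=z^1{}_1z^2{}_2z^3{}_3+q^2z^1{}_2z^2{}_3z^3{}_1+q^2z^1{}_3z^2{}_1z^3{}_2-q\,z^1{}_1z^2{}_3z^3{}_2-q^3z^1{}_3z^2{}_2z^3{}_1-q\,z^1{}_2z^2{}_1z^3{}_3 .$$ It is a Hopf algebra with $\Delta z^i{}_j=\sum_kz^i{}_k\otimes z^k{}_j$, $\varepsilon(z^i{}_j)=\delta^i_j$,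 $S(Z)=Z^{-1}$. With the conjugate-linear antimultiplicative involution $(z^i{}_j)^*=S(z^j{}_i)$, $(\mathcal D^{-1})^*=\mathcal D$, it is the quantum group $U_q(3)$; its quotient by $\mathcal D=1$ is $SU_q(3)$. A first order differential calculus over an algebra $\mathcal H$ is an $\mathcal H$-bimodule $\Gamma$ with a linear map $d:\mathcal H\to\Gamma$ such that $d(ab)=(da)b+a\,db$ and $d\mathcal H$ generates $\Gamma$ as a left module. Two calculi are equivalent if a bimodule isomorphism intertwines the differentials. Over a Hopf algebra, $\Gamma$ is bicovariant if there are linear maps $\Delta_L:\Gamma\to\mathcal H\otimes\Gamma$ and $\Delta_R:\Gamma\to\Gamma\otimes\mathcal H$ with $\Delta_L(a\,db)=\Delta(a)(\mathrm{id}\otimes d)\Delta(b)$ and $\Delta_R(a\,db)=\Delta(a)(d\otimes\mathrm{id})\Delta(b)$. It is a $*$-calculus if there is an additive involution $*$ on $\Gamma$ with $(a\rho)^*=\rho^*a^*$, $(\rho a)^*=a^*\rho^*$, $(da)^*=d(a^*)$. Put $\theta^i{}_j=\sum_kS(z^i{}_k)\,dz^k{}_j$ and $\mathrm{Tr}_q\theta=q^4\theta^1{}_1+q^2\theta^2{}_2+\theta^3{}_3$.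 **The families.** For $t\in\mathbb C$, a calculus over $U_q(3)$ or $SU_q(3)$ is called $\Gamma_\nu(t)$, $\nu=1,2$, if the nine $dz^i{}_j$ form a basis of $\Gamma$ as a left module, $t\ne0$, and * for $\nu=1$: $(q^6+q^4+1)t-(q^6+q^4+q^2)\neq0$ and, with $N=q^4(q^2+1)(t-1)-q^2+t$, $\sigma=(q^2-t)(t-1)/N$, $\beta=t(q^2-1)(t-1)/N$, $$\begin{aligned} (dz^i{}_j)z^i{}_j&=(tq^{-2}+t-1)z^i{}_jdz^i{}_j+\sigma z^i{}_jz^i{}_j\mathrm{Tr}_q\theta,\\ (dz^i{}_j)z^i{}_l&=tq^{-1}z^i{}_ldz^i{}_j+(t-1)z^i{}_jdz^i{}_l+\sigma z^i{}_jz^i{}_l\mathrm{Tr}_q\theta&(j<l),\\ (dz^i{}_j)z^k{}_j&=tq^{-1}z^k{}_jdz^i{}_j+(t-1)z^i{}_jdz^k{}_j+\sigma z^i{}_jz^k{}_j\mathrm{Tr}_q\theta&(i<k),\\ (dz^i{}_j)z^k{}_l&=tz^k{}_ldz^i{}_j+(t-1)z^i{}_jdz^k{}_l+\sigma z^i{}_jz^k{}_l\mathrm{Tr}_q\theta-\beta(z^i{}_jz^k{}_l-qz^i{}_lz^k{}_j)\mathrm{Tr}_q\theta&(i<k,\,j<l),\\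 (dz^i{}_j)z^k{}_l&=tz^k{}_ldz^i{}_j+(t-1)z^i{}_jdz^k{}_l+\sigma z^i{}_jz^k{}_l\mathrm{Tr}_q\theta-t(q-q^{-1})z^k{}_jdz^i{}_l\\&\quad+q\beta(z^i{}_lz^k{}_j-qz^i{}_jz^k{}_l)\mathrm{Tr}_q\theta&(i<k,\,j>l); \end{aligned}$$ * for $\nu=2$: $(q^6+q^2+1)t-(q^4+q^2+1)\neq0$ and, with $\hat N=q^4(q^2t-1)+(q^2+1)(t-1)$, $\hat\sigma=-(q^2t-1)(t-1)/\hat N$, $\hat\beta=-t(q^2-1)(t-1)/\hat N$, $$\begin{aligned} (dz^i{}_j)z^i{}_j&=(tq^2+t-1)z^i{}_jdz^i{}_j+\hat\sigma z^i{}_jz^i{}_j\mathrm{Tr}_q\theta,\\ (dz^i{}_j)z^i{}_l&=tq\,z^i{}_ldz^i{}_j+(tq^2-1)z^i{}_jdz^i{}_l+\hat\sigma z^i{}_jz^i{}_l\mathrm{Tr}_q\theta&(j<l),\\ (dz^i{}_j)z^k{}_j&=tq\,z^k{}_jdz^i{}_j+(tq^2-1)z^i{}_jdz^k{}_j+\hat\sigma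 z^i{}_jz^k{}_j\mathrm{Tr}_q\theta&(i<k),\\ (dz^i{}_j)z^k{}_l&=tz^k{}_ldz^i{}_j+(t-1)z^i{}_jdz^k{}_l+\hat\sigma z^i{}_jz^k{}_l\mathrm{Tr}_q\theta+t(q-q^{-1})(z^i{}_ldz^k{}_j+z^k{}_jdz^i{}_l)\\&\quad+t(q-q^{-1})^2z^i{}_jdz^k{}_l-q^{-2}\hat\beta(z^i{}_jz^k{}_l-qz^i{}_lz^k{}_j)\mathrm{Tr}_q\theta&(i<k,\,j<l),\\ (dz^i{}_j)z^k{}_l&=tz^k{}_ldz^i{}_j+(t-1)z^i{}_jdz^k{}_l+\hat\sigma z^i{}_jz^k{}_l\mathrm{Tr}_q\theta+t(q-q^{-1})z^i{}_ldz^k{}_j\\&\quad+q^{-1}\hat\beta(z^i{}_lz^k{}_j-qz^i{}_jz^k{}_l)\mathrm{Tr}_q\theta&(i<k,\,j>l). \end{aligned}$$ A calculus $\Gamma$ over $U_q(3)$ *induces* the calculus $\Gamma'$ over $SU_q(3)$ if $\Gamma'\cong\Gamma/I\Gamma$ with the bimodule structure and the differential inherited from $\Gamma$, where $I$ is the kernel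 of the projection $U_q(3)\to SU_q(3)$ of coordinate algebras. **Proposition.** 1. Let $\Gamma$ be a first order differential calculus over $U_q(3)$ in which the $dz^i{}_j$ form a basis of $\Gamma$ as a left module. Then $\Gamma$ is a bicovariant $*$-calculus if and only if it is a $\Gamma_\nu(t)$ with $\nu\in\{1,2\}$ and $t\in\mathbb R$. For every $\nu$ and every real $t$ satisfying the restrictions above a $\Gamma_\nu(t)$ exists, and for all complex $t,t'$ calculi $\Gamma_\nu(t)$ and $\Gamma_{\nu'}(t')$ over $U_q(3)$ are equivalent if and only if $\nu=\nu'$ and $t=t'$. 2. For real $t$ there is exactly one $*$-structure on $\Gamma_\nu(t)$; every $*$-structure on a first order calculus over $U_q(3)$ satisfies $(\theta^i{}_j)^*=-\theta^j{}_i$. 3. For real $t$, the calculus $\Gamma_\nu(t)$ over $U_q(3)$ induces a calculus over $SU_q(3)$ if and only if $t^3=q^2$ (for $\nu=1$), respectively $t^3=q^{-2}$ (for $\nu=2$). The induced calculus is then a bicovariant $*$-calculus and a $\Gamma_\nu(t)$ over $SU_q(3)$. 4. Hence the bicovariant $*$-calculi of part 1 induce, up to equivalence, exactly two calculi over $SU_q(3)$,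 both of them bicovariant $*$-calculi: $\Gamma_1(t_1)$ and $\Gamma_2(t_2)$ with $t_1,t_2$ the real solutions of $t_1^3=q^2$ and $t_2^3=q^{-2}$; they are not equivalent. -/

import Mathlib

set_option linter.all false

open scoped TensorProduct

section
variable {R : Type*} [Ring R] [Algebra ℂ R]

/-- The defining commutation relations of the quantum matrix algebra, for a `3 × 3` matrix `Z` with
entries in a complex algebra (row index first; indices run over `0, 1, 2`). -/
structure IsQMatrix (q : ℂ) (Z : Fin 3 → Fin 3 → R) : Prop where
  row : ∀ i j k, j < k → Z i j * Z i k = q • (Z i k * Z i j)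
  col : ∀ i j k, i < k → Z i j * Z k j = q • (Z k j * Z i j)
  anti : ∀ i j k l, i < k → l < j → Z i j * Z k l = Z k l * Z i j
  cross : ∀ i j k l, i < k → j < l →
    Z i j * Z k l = Z k l * Z i j + (q - q⁻¹) • (Z k j * Z i l)

/-- The quantum determinant. -/
noncomputable def qdet (q : ℂ) (Z : Fin 3 → Fin 3 → R) : R :=
  Z 0 0 * Z 1 1 * Z 2 2 + q ^ 2 • (Z 0 1 * Z 1 2 * Z 2 0) + q ^ 2 • (Z 0 2 * Z 1 0 * Z 2 1)
    - q • (Z 0 0 * Z 1 2 * Z 2 1) - q ^ 3 • (Z 0 2 * Z 1 1 * Z 2 0)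
    - q • (Z 0 1 * Z 1 0 * Z 2 2)

/-- The matrix `𝒟 · S(Z)` of quantum cofactors. -/
noncomputable def qadj (q : ℂ) (Z : Fin 3 → Fin 3 → R) : Fin 3 → Fin 3 → R :=
  ![![Z 1 1 * Z 2 2 - q • (Z 1 2 * Z 2 1),
      -(q⁻¹ • (Z 0 1 * Z 2 2)) + Z 0 2 * Z 2 1,
      q⁻¹ ^ 2 • (Z 0 1 * Z 1 2) - q⁻¹ • (Z 0 2 * Z 1 1)],
    ![-(q • (Z 1 0 * Z 2 2)) + q ^ 2 • (Z 1 2 * Z 2 0),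
      Z 0 0 * Z 2 2 - q • (Z 0 2 * Z 2 0),
      -(q⁻¹ • (Z 0 0 * Z 1 2)) + Z 0 2 * Z 1 0],
    ![q ^ 2 • (Z 1 0 * Z 2 1) - q ^ 3 • (Z 1 1 * Z 2 0),
      -(q • (Z 0 0 * Z 2 1)) + q ^ 2 • (Z 0 1 * Z 2 0),
      Z 0 0 * Z 1 1 - q • (Z 0 1 * Z 1 0)]]

/-- The `q`-antisymmetric tensor, used in the proofs that the quantum determinant is group-like. -/
noncomputable def qeps (q : ℂ) : Fin 3 → Fin 3 → Fin 3 → ℂ :=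
  ![![![0, 0, 0], ![0, 0, 1], ![0, -q, 0]],
    ![![0, 0, -q], ![0, 0, 0], ![q ^ 2, 0, 0]],
    ![![0, q ^ 2, 0], ![-q ^ 3, 0, 0], ![0, 0, 0]]]

namespace IsQMatrix
variable {q : ℂ} {Z : Fin 3 → Fin 3 → R}

theorem row' (h : IsQMatrix q Z) (hq : q ≠ 0) (i j k) (hjk : j < k) :
    Z i k * Z i j = q⁻¹ • (Z i j * Z i k) := by
  rw [h.row i j k hjk, smul_smul, inv_mul_cancel₀ hq, one_smul]
theorem col' (h : IsQMatrix q Z) (hq : q ≠ 0) (i j k) (hjk : i < k) :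
    Z k j * Z i j = q⁻¹ • (Z i j * Z k j) := by
  rw [h.col i j k hjk, smul_smul, inv_mul_cancel₀ hq, one_smul]
theorem anti' (h : IsQMatrix q Z) (i j k l) (hik : i < k) (hlj : l < j) :
    Z k l * Z i j = (1 : ℂ) • (Z i j * Z k l) := by rw [one_smul, h.anti i j k l hik hlj]
theorem cross' (h : IsQMatrix q Z) (i j k l) (hik : i < k) (hjl : j < l) :
    Z k l * Z i j = Z i j * Z k l - (q - q⁻¹) • (Z i l * Z k j) := by
  rw [h.cross i j k l hik hjl, h.anti i l k j hik hjl, add_sub_cancel_right]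

theorem row'' (h : IsQMatrix q Z) (hq : q ≠ 0) (i j k) (hjk : j < k) (x : R) :
    Z i k * (Z i j * x) = q⁻¹ • (Z i j * (Z i k * x)) := by
  rw [← mul_assoc, h.row' hq i j k hjk, smul_mul_assoc, mul_assoc]
theorem col'' (h : IsQMatrix q Z) (hq : q ≠ 0) (i j k) (hjk : i < k) (x : R) :
    Z k j * (Z i j * x) = q⁻¹ • (Z i j * (Z k j * x)) := by
  rw [← mul_assoc, h.col' hq i j k hjk, smul_mul_assoc, mul_assoc]
theorem anti'' (h : IsQMatrix q Z) (i j k l) (hik : i < k) (hlj : l < j) (x : R) :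
    Z k l * (Z i j * x) = (1 : ℂ) • (Z i j * (Z k l * x)) := by
  rw [← mul_assoc, h.anti' i j k l hik hlj, smul_mul_assoc, mul_assoc]
theorem cross'' (h : IsQMatrix q Z) (i j k l) (hik : i < k) (hjl : j < l) (x : R) :
    Z k l * (Z i j * x) = Z i j * (Z k l * x) - (q - q⁻¹) • (Z i l * (Z k j * x)) := by
  rw [← mul_assoc, h.cross' i j k l hik hjl, sub_mul, smul_mul_assoc, mul_assoc, mul_assoc]


set_option maxHeartbeats 4000000 in
theorem mul_adj (h : IsQMatrix q Z) (hq : q ≠ 0) (i j : Fin 3) :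
    ∑ k, Z i k * qadj q Z k j = if i = j then qdet q Z else 0 := by
  fin_cases i <;> fin_cases j <;>
  simp [Fin.sum_univ_three, qadj, qdet, qeps, mul_add, mul_sub, add_mul, sub_mul, mul_assoc, h.row' hq, h.col' hq,
    h.anti', h.cross', h.row'' hq, h.col'' hq, h.anti'', h.cross'', smul_smul, smul_sub, smul_add] <;> match_scalars <;> field_simp <;> ring

set_option maxHeartbeats 4000000 in
theorem adj_mul (h : IsQMatrix q Z) (hq : q ≠ 0) (i j : Fin 3) :
    ∑ k, qadj q Z i k * Z k j = if i = j then qdet q Z else 0 := by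
  fin_cases i <;> fin_cases j <;>
  simp [Fin.sum_univ_three, qadj, qdet, qeps, mul_add, mul_sub, add_mul, sub_mul, mul_assoc, h.row' hq, h.col' hq,
    h.anti', h.cross', h.row'' hq, h.col'' hq, h.anti'', h.cross'', smul_smul, smul_sub, smul_add] <;> match_scalars <;> field_simp <;> ring

set_option maxHeartbeats 4000000 in
theorem qdet_transpose (h : IsQMatrix q Z) (hq : q ≠ 0) :
    qdet q (fun i j => Z j i) = qdet q Z := by
  simp [Fin.sum_univ_three, qadj, qdet, qeps, mul_add, mul_sub, add_mul, sub_mul, mul_assoc, h.row' hq, h.col' hq,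
    h.anti', h.cross', h.row'' hq, h.col'' hq, h.anti'', h.cross'', smul_smul, smul_sub, smul_add] <;> match_scalars <;> field_simp <;> ring

set_option maxHeartbeats 4000000 in
theorem eps_mul (h : IsQMatrix q Z) (hq : q ≠ 0) (i j k : Fin 3) :
    ∑ a, ∑ b, ∑ c, qeps q a b c • (Z i a * Z j b * Z k c) = qeps q i j k • qdet q Z := by
  fin_cases i <;> fin_cases j <;> fin_cases k <;>
  simp [Fin.sum_univ_three, qadj, qdet, qeps, mul_add, mul_sub, add_mul, sub_mul, mul_assoc, h.row' hq, h.col' hq,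
    h.anti', h.cross', h.row'' hq, h.col'' hq, h.anti'', h.cross'', smul_smul, smul_sub, smul_add] <;> match_scalars <;> field_simp <;> ring

end IsQMatrix
end

section
variable {R : Type*} [Ring R] [Algebra ℂ R]
namespace IsQMatrix
variable {q : ℂ} {Z : Fin 3 → Fin 3 → R}

/-- Coefficients of the `R`-matrix form of the commutation relations. -/
noncomputable def rc (q : ℂ) (i j : Fin 3) : ℂ := if i = j then q else 1
noncomputable def lc (q : ℂ) (i j : Fin 3) : ℂ := if i < j then q - q⁻¹ else 0

theorem rtt (h : IsQMatrix q Z) (hq : q ≠ 0) (i k j l : Fin 3) :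
    rc q i k • (Z i j * Z k l) + lc q k i • (Z k j * Z i l) =
      rc q j l • (Z k l * Z i j) + lc q j l • (Z k j * Z i l) := by
  rcases lt_trichotomy i k with hik | rfl | hik <;> rcases lt_trichotomy j l with hjl | rfl | hjl
  · simp [rc, lc, hik.ne, hjl.ne, hik, hjl, hik.not_gt, h.cross i j k l hik hjl]
  · simp [rc, lc, hik.ne, hik, hik.not_gt, h.col i j k hik]
  · simp [rc, lc, hik.ne, hjl.ne', hik, hjl, hik.not_gt, hjl.not_gt, h.anti i j k l hik hjl]
  · simp [rc, lc, hjl.ne, hjl, h.row i j l hjl, smul_smul, sub_mul, sub_smul, hq]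
  · simp [rc, lc]
  · simp [rc, lc, hjl.ne', hjl.not_gt, h.row i l j hjl]
  · simp [rc, lc, hik.ne', hjl.ne, hik, hjl, hik.not_gt, hjl.not_gt, h.anti k l i j hik hjl]
  · simp [rc, lc, hik.ne', hik, h.col k j i hik, smul_smul, sub_mul, sub_smul, hq]
  · simp [rc, lc, hik.ne', hjl.ne', hik, hjl, hik.not_gt, hjl.not_gt, h.cross k l i j hik hjl,
      h.anti k j i l hik hjl]

theorem of_rtt (hq : q ≠ 0) (h : ∀ i k j l : Fin 3,
    rc q i k • (Z i j * Z k l) + lc q k i • (Z k j * Z i l) =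
      rc q j l • (Z k l * Z i j) + lc q j l • (Z k j * Z i l)) : IsQMatrix q Z where
  row i j k hjk := by
    have := h i i k j
    simpa [rc, lc, hjk.ne', hjk.not_gt] using this.symm
  col i j k hik := by
    have := h i k j j
    simpa [rc, lc, hik.ne, hik.not_gt] using this
  anti i j k l hik hlj := by
    have := h i k j l
    simpa [rc, lc, hik.ne, hik.not_gt, hlj.ne', hlj.not_gt] using this
  cross i j k l hik hjl := by
    have := h i k j l
    simpa [rc, lc, hik.ne, hik.not_gt, hjl.ne, hjl] using this

/-- The product of two quantum matrices with mutually commuting entries is a quantum matrix. -/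
theorem mul {X Y : Fin 3 → Fin 3 → R} (hq : q ≠ 0) (hX : IsQMatrix q X) (hY : IsQMatrix q Y)
    (hXY : ∀ i j k l, X i j * Y k l = Y k l * X i j) :
    IsQMatrix q (fun i j => ∑ k, X i k * Y k j) := by
  have key : ∀ i j k l, (∑ a, X i a * Y a j) * (∑ b, X k b * Y b l) =
      ∑ a, ∑ b, (X i a * X k b) * (Y a j * Y b l) := by
    intro i j k l
    rw [Finset.sum_mul_sum]
    refine Finset.sum_congr rfl fun a _ => Finset.sum_congr rfl fun b _ => ?_
    rw [mul_assoc, ← mul_assoc (Y a j), ← hXY, mul_assoc, mul_assoc]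
  refine of_rtt hq fun i k j l => ?_
  simp only [key]
  calc rc q i k • ∑ a, ∑ b, (X i a * X k b) * (Y a j * Y b l)
        + lc q k i • ∑ a, ∑ b, (X k a * X i b) * (Y a j * Y b l)
      = ∑ a, ∑ b, (rc q i k • (X i a * X k b) + lc q k i • (X k a * X i b)) * (Y a j * Y b l) := by
        simp only [Finset.smul_sum, ← Finset.sum_add_distrib, add_mul, smul_mul_assoc]
    _ = ∑ a, ∑ b, (rc q a b • (X k b * X i a) + lc q a b • (X k a * X i b)) * (Y a j * Y b l) := by
        exact Finset.sum_congr rfl fun a _ => Finset.sum_congr rfl fun b _ => by rw [hX.rtt hq]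
    _ = ∑ a, ∑ b, (X k b * X i a) * (rc q a b • (Y a j * Y b l))
          + ∑ a, ∑ b, (X k a * X i b) * (lc q a b • (Y a j * Y b l)) := by
        simp only [← Finset.sum_add_distrib, add_mul, smul_mul_assoc, mul_smul_comm]
    _ = ∑ a, ∑ b, (X k b * X i a) * (rc q a b • (Y a j * Y b l))
          + ∑ a, ∑ b, (X k b * X i a) * (lc q b a • (Y b j * Y a l)) := by
        congr 1
        exact Finset.sum_comm
    _ = ∑ a, ∑ b, (X k b * X i a) * (rc q a b • (Y a j * Y b l) + lc q b a • (Y b j * Y a l)) := by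
        simp only [← Finset.sum_add_distrib, mul_add]
    _ = ∑ a, ∑ b, (X k b * X i a) * (rc q j l • (Y b l * Y a j) + lc q j l • (Y b j * Y a l)) := by
        exact Finset.sum_congr rfl fun a _ => Finset.sum_congr rfl fun b _ => by rw [hY.rtt hq]
    _ = ∑ b, ∑ a, (X k b * X i a) * (rc q j l • (Y b l * Y a j) + lc q j l • (Y b j * Y a l)) :=
        Finset.sum_comm
    _ = rc q j l • ∑ a, ∑ b, (X k a * X i b) * (Y a l * Y b j)
        + lc q j l • ∑ a, ∑ b, (X k a * X i b) * (Y a j * Y b l) := by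
        simp only [Finset.smul_sum, ← Finset.sum_add_distrib, mul_add, mul_smul_comm]

theorem qdet_eq_sum (q : ℂ) (Z : Fin 3 → Fin 3 → R) :
    ∑ a, ∑ b, ∑ c, qeps q a b c • (Z 0 a * Z 1 b * Z 2 c) = qdet q Z := by
  simp [Fin.sum_univ_three, qeps, qdet, mul_assoc]
  abel

theorem sum_swap₃ {M : Type*} [AddCommMonoid M]
    (f : Fin 3 → Fin 3 → Fin 3 → Fin 3 → Fin 3 → Fin 3 → M) :
    ∑ a, ∑ b, ∑ c, ∑ i, ∑ j, ∑ k, f a b c i j k =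
      ∑ i, ∑ j, ∑ k, ∑ a, ∑ b, ∑ c, f a b c i j k := by
  have := Finset.sum_comm (s := (Finset.univ : Finset (Fin 3 × Fin 3 × Fin 3)))
    (t := (Finset.univ : Finset (Fin 3 × Fin 3 × Fin 3)))
    (f := fun x y => f x.1 x.2.1 x.2.2 y.1 y.2.1 y.2.2)
  simpa only [Fintype.sum_prod_type] using this

theorem qdet_mul {X Y : Fin 3 → Fin 3 → R} (hq : q ≠ 0) (hX : IsQMatrix q X)
    (hY : IsQMatrix q Y) (hXY : ∀ i j k l, X i j * Y k l = Y k l * X i j) :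
    qdet q (fun i j => ∑ k, X i k * Y k j) = qdet q X * qdet q Y := by
  rw [← qdet_eq_sum]
  have key : ∀ a b c, (∑ k, X 0 k * Y k a) * (∑ k, X 1 k * Y k b) * (∑ k, X 2 k * Y k c) =
      ∑ i, ∑ j, ∑ k, (X 0 i * X 1 j * X 2 k) * (Y i a * Y j b * Y k c) := by
    intro a b c
    rw [Finset.sum_mul_sum, Finset.sum_mul]
    refine Finset.sum_congr rfl fun i _ => ?_
    rw [Finset.sum_mul_sum]
    refine Finset.sum_congr rfl fun j _ => Finset.sum_congr rfl fun k _ => ?_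
    calc X 0 i * Y i a * (X 1 j * Y j b) * (X 2 k * Y k c)
        = X 0 i * (Y i a * X 1 j) * (Y j b * X 2 k) * Y k c := by simp only [mul_assoc]
      _ = X 0 i * X 1 j * (Y i a * X 2 k) * Y j b * Y k c := by
        rw [← hXY, ← hXY]; simp only [mul_assoc]
      _ = _ := by rw [← hXY]; simp only [mul_assoc]
  simp only [key]
  calc ∑ a, ∑ b, ∑ c, qeps q a b c • ∑ i, ∑ j, ∑ k, (X 0 i * X 1 j * X 2 k) * (Y i a * Y j b * Y k c)
      = ∑ i, ∑ j, ∑ k, (X 0 i * X 1 j * X 2 k) *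
          ∑ a, ∑ b, ∑ c, qeps q a b c • (Y i a * Y j b * Y k c) := by
        simp only [Finset.smul_sum, Finset.mul_sum, mul_smul_comm]
        exact sum_swap₃ fun a b c i j k =>
          qeps q a b c • ((X 0 i * X 1 j * X 2 k) * (Y i a * Y j b * Y k c))
    _ = _ := by
        simp only [hY.eps_mul hq, mul_smul_comm]
        rw [← qdet_eq_sum q X]
        simp only [Finset.sum_mul, smul_mul_assoc]

theorem transpose (h : IsQMatrix q Z) : IsQMatrix q (fun i j => Z j i) where
  row i j k hjk := h.col j i k hjk
  col i j k hjk := h.row j i k hjk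
  anti i j k l hik hlj := (h.anti l k j i hlj hik).symm
  cross i j k l hik hjl := by rw [h.cross j i l k hjl hik, h.anti j k l i hjl hik]

open MulOpposite in
/-- The inverse of a quantum matrix is a quantum matrix in the opposite algebra. -/
theorem op_inv (hq : q ≠ 0) (h : IsQMatrix q Z) {S : Fin 3 → Fin 3 → R}
    (hZS : ∀ i j, ∑ k, Z i k * S k j = if i = j then 1 else 0)
    (hSZ : ∀ i j, ∑ k, S i k * Z k j = if i = j then 1 else 0) :
    IsQMatrix q (fun i j => op (S i j)) := by
  have e1 : ∀ i j k l, ∑ a, ∑ b, (S i a * S k b) * (Z b j * Z a l) = 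
      (if k = j then 1 else 0) * (if i = l then 1 else 0) := by
    intro i j k l
    calc _ = ∑ a, S i a * (∑ b, S k b * Z b j) * Z a l := by
            simp only [Finset.mul_sum, Finset.sum_mul, mul_assoc]
      _ = _ := by
          simp only [hSZ]; rw [← hSZ i l, Finset.mul_sum]; 
          exact Finset.sum_congr rfl fun a _ => by split_ifs <;> simp
  have e2 : ∀ i j k l, ∑ a, ∑ b, (Z i a * Z k b) * (S b j * S a l) = 
      (if k = j then 1 else 0) * (if i = l then 1 else 0) := by
    intro i j k l
    calc _ = ∑ a, Z i a * (∑ b, Z k b * S b j) * S a l := by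
            simp only [Finset.mul_sum, Finset.sum_mul, mul_assoc]
      _ = _ := by
          simp only [hZS]; rw [← hZS i l, Finset.mul_sum]; 
          exact Finset.sum_congr rfl fun a _ => by split_ifs <;> simp
  refine of_rtt hq fun i k j l => ?_
  apply unop_injective
  simp only [unop_add, unop_smul, unop_mul, unop_op]
  -- conjugate the relation of `Z` by the inverses
  have A : ∑ a, ∑ b, ∑ c, ∑ d, (S i a * S k b) * (rc q a b • (Z a c * Z b d) + lc q b a • (Z b c * Z a d)) * (S d l * S c j) =
    ∑ a, ∑ b, ∑ c, ∑ d, (S i a * S k b) * (rc q c d • (Z b d * Z a c) + lc q c d • (Z b c * Z a d)) * (S d l * S c j) := by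
    exact Finset.sum_congr rfl fun a _ => Finset.sum_congr rfl fun b _ =>
      Finset.sum_congr rfl fun c _ => Finset.sum_congr rfl fun d _ => by rw [h.rtt hq]
  have B : ∑ a, ∑ b, ∑ c, ∑ d, (S i a * S k b) * (rc q a b • (Z a c * Z b d) + lc q b a • (Z b c * Z a d)) * (S d l * S c j) = rc q j l • (S i j * S k l) + lc q j l • (S i l * S k j) := by
    calc _ = ∑ a, ∑ b, ((S i a * S k b) * (rc q a b • ∑ c, ∑ d, (Z a c * Z b d) * (S d l * S c j))
            + (S i a * S k b) * (lc q b a • ∑ c, ∑ d, (Z b c * Z a d) * (S d l * S c j))) := by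
          simp only [Finset.smul_sum, Finset.mul_sum, ← Finset.sum_add_distrib, mul_add, add_mul,
            mul_smul_comm, smul_mul_assoc, mul_assoc]
      _ = _ := by
          simp only [e2]
          simp [Finset.sum_add_distrib, mul_ite, ite_mul]
  have C : ∑ a, ∑ b, ∑ c, ∑ d, (S i a * S k b) * (rc q c d • (Z b d * Z a c) + lc q c d • (Z b c * Z a d)) * (S d l * S c j) = rc q i k • (S k l * S i j) + lc q k i • (S i l * S k j) := by
    rw [show ∀ f : Fin 3 → Fin 3 → Fin 3 → Fin 3 → R, ∑ a, ∑ b, ∑ c, ∑ d, f a b c d =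
        ∑ c, ∑ d, ∑ a, ∑ b, f a b c d from fun f => by
      have := Finset.sum_comm (s := (Finset.univ : Finset (Fin 3 × Fin 3)))
        (t := (Finset.univ : Finset (Fin 3 × Fin 3))) (f := fun x y => f x.1 x.2 y.1 y.2)
      simpa only [Fintype.sum_prod_type] using this]
    calc _ = ∑ c, ∑ d, (rc q c d • ((∑ a, ∑ b, (S i a * S k b) * (Z b d * Z a c)) * (S d l * S c j))
            + lc q c d • ((∑ a, ∑ b, (S i a * S k b) * (Z b c * Z a d)) * (S d l * S c j))) := by
          simp only [Finset.smul_sum, Finset.sum_mul, ← Finset.sum_add_distrib, mul_add, add_mul,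
            mul_smul_comm, smul_mul_assoc, mul_assoc]
      _ = _ := by
          simp only [e1]
          simp [Finset.sum_add_distrib, mul_ite, ite_mul]
  rw [← C, ← A, B]
end IsQMatrix
end

section
open MulOpposite
variable {R : Type*} [Ring R] [Algebra ℂ R]
namespace IsQMatrix
variable {q : ℂ} {Z : Fin 3 → Fin 3 → R}

theorem op_inv_qdet (hq : q ≠ 0) (h : IsQMatrix q Z) {S : Fin 3 → Fin 3 → R} {E : R}
    (hSZ : ∀ i j, ∑ k, S i k * Z k j = if i = j then 1 else 0) (hE : qdet q Z * E = 1) :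
    qdet q (fun i j => op (S i j)) = op E := by
  rw [← qdet_eq_sum]
  apply unop_injective
  have key : (∑ i, ∑ j, ∑ k, qeps q i j k • (S 2 k * (S 1 j * S 0 i))) * qdet q Z = 1 := by
    calc _ = ∑ i, ∑ j, ∑ k, (S 2 k * (S 1 j * S 0 i)) * (qeps q i j k • qdet q Z) := by
          simp only [Finset.sum_mul, mul_smul_comm, smul_mul_assoc]
      _ = ∑ i, ∑ j, ∑ k, ∑ a, ∑ b, ∑ c,
            qeps q a b c • (S 2 k * (S 1 j * (S 0 i * Z i a) * Z j b) * Z k c) := by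
          simp only [← h.eps_mul hq, Finset.mul_sum, mul_smul_comm, mul_assoc]
      _ = ∑ a, ∑ b, ∑ c, ∑ i, ∑ j, ∑ k,
            qeps q a b c • (S 2 k * (S 1 j * (S 0 i * Z i a) * Z j b) * Z k c) :=
          (sum_swap₃ fun a b c i j k =>
            qeps q a b c • (S 2 k * (S 1 j * (S 0 i * Z i a) * Z j b) * Z k c)).symm
      _ = ∑ a, ∑ b, ∑ c, qeps q a b c • ((if (0 : Fin 3) = a then (1 : R) else 0) *
            ((if (1 : Fin 3) = b then (1 : R) else 0) * (if (2 : Fin 3) = c then (1 : R) else 0))) := by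
          refine Finset.sum_congr rfl fun a _ => Finset.sum_congr rfl fun b _ =>
            Finset.sum_congr rfl fun c _ => ?_
          have : ∑ i, ∑ j, ∑ k, S 2 k * (S 1 j * (S 0 i * Z i a) * Z j b) * Z k c =
            ∑ k, S 2 k * (∑ j, S 1 j * (∑ i, S 0 i * Z i a) * Z j b) * Z k c := by
            simp only [Finset.sum_mul, Finset.mul_sum]
            simp only [Fin.sum_univ_three]
            abel
          simp only [← Finset.smul_sum]
          rw [this, hSZ 0 a]
          by_cases ha : (0 : Fin 3) = a
          · simp only [if_pos ha, mul_one, one_mul, hSZ 1 b]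
            by_cases hb : (1 : Fin 3) = b
            · simp only [if_pos hb, mul_one, one_mul, hSZ 2 c]
            · simp [if_neg hb]
          · simp [if_neg ha]
      _ = 1 := by simp [qeps]
  calc _ = ∑ i, ∑ j, ∑ k, qeps q i j k • (S 2 k * (S 1 j * S 0 i)) := by simp
    _ = (∑ i, ∑ j, ∑ k, qeps q i j k • (S 2 k * (S 1 j * S 0 i))) * (qdet q Z * E) := by
        rw [hE, mul_one]
    _ = E := by rw [← mul_assoc, key, one_mul]

theorem qdet_comm (hq : q ≠ 0) (h : IsQMatrix q Z) (i j : Fin 3) :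
    qdet q Z * Z i j = Z i j * qdet q Z := by
  calc qdet q Z * Z i j = ∑ k, (∑ l, Z i l * qadj q Z l k) * Z k j := by simp [h.mul_adj hq]
    _ = ∑ l, Z i l * ∑ k, qadj q Z l k * Z k j := by
        simp only [Finset.sum_mul, Finset.mul_sum, mul_assoc]; exact Finset.sum_comm
    _ = _ := by simp [h.adj_mul hq]

end IsQMatrix

/-- Which of the two quantum groups: `GL` (no further relation) or `SL` (unimodularity imposed). -/
inductive QKind : Type
  | GL
  | SL

/-- The generators: the nine matrix entries and the inverse of the quantum determinant. -/
inductive QGen : Type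
  | z (i j : Fin 3)
  | detInv

/-- `Z`, `E` satisfy the defining relations of the coordinate algebra: `Z` is a quantum matrix, `E` is a
two-sided inverse of the quantum determinant, and the latter is `1` in the `SL` case. -/
structure IsQPoint (K : QKind) (q : ℂ) (Z : Fin 3 → Fin 3 → R) (E : R) : Prop
    extends IsQMatrix q Z where
  qdet_mul : qdet q Z * E = 1
  mul_qdet : E * qdet q Z = 1
  unimod : K = QKind.SL → qdet q Z = 1

namespace IsQPoint
variable {K : QKind} {q : ℂ} {Z : Fin 3 → Fin 3 → R} {E : R}

theorem comm (h : IsQPoint K q Z E) (hq : q ≠ 0) (i j : Fin 3) : E * Z i j = Z i j * E := by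
  calc E * Z i j = E * (Z i j * qdet q Z) * E := by
        rw [mul_assoc, mul_assoc, h.qdet_mul, mul_one]
    _ = _ := by rw [← h.toIsQMatrix.qdet_comm hq, ← mul_assoc, h.mul_qdet, one_mul]

theorem mul_inv (h : IsQPoint K q Z E) (hq : q ≠ 0) (i j : Fin 3) :
    ∑ k, Z i k * (qadj q Z k j * E) = if i = j then 1 else 0 := by
  simp only [← mul_assoc, ← Finset.sum_mul, h.toIsQMatrix.mul_adj hq]
  split_ifs <;> simp [h.qdet_mul]

theorem inv_mul (h : IsQPoint K q Z E) (hq : q ≠ 0) (i j : Fin 3) :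
    ∑ k, (qadj q Z i k * E) * Z k j = if i = j then 1 else 0 := by
  simp only [mul_assoc, h.comm hq]
  simp only [← mul_assoc, ← Finset.sum_mul, h.toIsQMatrix.adj_mul hq]
  split_ifs <;> simp [h.qdet_mul]

theorem antipode (h : IsQPoint K q Z E) (hq : q ≠ 0) :
    IsQPoint K q (fun i j => op (qadj q Z i j * E)) (op (qdet q Z)) where
  toIsQMatrix := h.toIsQMatrix.op_inv hq (h.mul_inv hq) (h.inv_mul hq)
  qdet_mul := by
    rw [h.toIsQMatrix.op_inv_qdet hq (h.inv_mul hq) h.qdet_mul, ← op_mul, h.qdet_mul, op_one]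
  mul_qdet := by
    rw [h.toIsQMatrix.op_inv_qdet hq (h.inv_mul hq) h.qdet_mul, ← op_mul, h.mul_qdet, op_one]
  unimod hK := by
    have := h.qdet_mul
    rw [h.unimod hK, one_mul] at this
    rw [h.toIsQMatrix.op_inv_qdet hq (h.inv_mul hq) h.qdet_mul, this, op_one]

theorem transpose (h : IsQPoint K q Z E) (hq : q ≠ 0) : IsQPoint K q (fun i j => Z j i) E where
  toIsQMatrix := h.toIsQMatrix.transpose
  qdet_mul := by rw [h.toIsQMatrix.qdet_transpose hq, h.qdet_mul]
  mul_qdet := by rw [h.toIsQMatrix.qdet_transpose hq, h.mul_qdet]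
  unimod hK := by rw [h.toIsQMatrix.qdet_transpose hq, h.unimod hK]

theorem mul {X Y : Fin 3 → Fin 3 → R} {E F : R} (hq : q ≠ 0) (hX : IsQPoint K q X E)
    (hY : IsQPoint K q Y F) (hXY : ∀ i j k l, X i j * Y k l = Y k l * X i j)
    (hEY : E * qdet q Y = qdet q Y * E) (hEF : E * F = F * E) :
    IsQPoint K q (fun i j => ∑ k, X i k * Y k j) (E * F) where
  toIsQMatrix := hX.toIsQMatrix.mul hq hY.toIsQMatrix hXY
  qdet_mul := by
    rw [IsQMatrix.qdet_mul hq hX.toIsQMatrix hY.toIsQMatrix hXY, mul_assoc, ← mul_assoc _ E,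
      ← hEY, mul_assoc, hY.qdet_mul, mul_one, hX.qdet_mul]
  mul_qdet := by
    rw [IsQMatrix.qdet_mul hq hX.toIsQMatrix hY.toIsQMatrix hXY, hEF, mul_assoc, ← mul_assoc E,
      hX.mul_qdet, one_mul, hY.mul_qdet]
  unimod hK := by
    rw [IsQMatrix.qdet_mul hq hX.toIsQMatrix hY.toIsQMatrix hXY, hX.unimod hK, hY.unimod hK,
      one_mul]

end IsQPoint

theorem map_qdet {R' : Type*} [Ring R'] [Algebra ℂ R'] (f : R →ₐ[ℂ] R') (q : ℂ)
    (Z : Fin 3 → Fin 3 → R) : f (qdet q Z) = qdet q (fun i j => f (Z i j)) := by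
  simp [qdet]

theorem IsQPoint.map {R' : Type*} [Ring R'] [Algebra ℂ R'] {K : QKind} {q : ℂ}
    {Z : Fin 3 → Fin 3 → R} {E : R} (h : IsQPoint K q Z E) (f : R →ₐ[ℂ] R') :
    IsQPoint K q (fun i j => f (Z i j)) (f E) where
  row i j k hjk := by rw [← map_mul, h.row i j k hjk, map_smul, map_mul]
  col i j k hjk := by rw [← map_mul, h.col i j k hjk, map_smul, map_mul]
  anti i j k l hik hlj := by rw [← map_mul, h.anti i j k l hik hlj, map_mul]
  cross i j k l hik hjl := by
    rw [← map_mul, h.cross i j k l hik hjl, map_add, map_smul, map_mul, map_mul]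
  qdet_mul := by rw [← map_qdet, ← map_mul, h.qdet_mul, map_one]
  mul_qdet := by rw [← map_qdet, ← map_mul, h.mul_qdet, map_one]
  unimod hK := by rw [← map_qdet, h.unimod hK, map_one]

namespace QGen
/-- The matrix entries in the free algebra. -/
noncomputable def Z (i j : Fin 3) : FreeAlgebra ℂ QGen := FreeAlgebra.ι ℂ (QGen.z i j)
/-- The generator standing for the inverse determinant, in the free algebra. -/
noncomputable def E : FreeAlgebra ℂ QGen := FreeAlgebra.ι ℂ QGen.detInv
end QGen

open QGen in
/-- The defining relations of `Fun_q(GL(3, ℂ))` and `Fun_q(SL(3, ℂ))` in the free algebra. -/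
inductive QRel (K : QKind) (q : ℂ) : FreeAlgebra ℂ QGen → FreeAlgebra ℂ QGen → Prop
  | row (i j k : Fin 3) : j < k → QRel K q (Z i j * Z i k) (q • (Z i k * Z i j))
  | col (i j k : Fin 3) : i < k → QRel K q (Z i j * Z k j) (q • (Z k j * Z i j))
  | anti (i j k l : Fin 3) : i < k → l < j → QRel K q (Z i j * Z k l) (Z k l * Z i j)
  | cross (i j k l : Fin 3) : i < k → j < l →
      QRel K q (Z i j * Z k l) (Z k l * Z i j + (q - q⁻¹) • (Z k j * Z i l))
  | qdet_mul : QRel K q (qdet q Z * E) 1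
  | mul_qdet : QRel K q (E * qdet q Z) 1
  | unimod : K = QKind.SL → QRel K q (qdet q Z) 1

/-- For real `q`: `QFun QKind.GL q` is the algebra `Fun_q(GL(3, ℂ))`, and `QFun QKind.SL q` is
`Fun_q(SL(3, ℂ))`. With the `*`-structure below they are the quantum groups `U_q(3)` and `SU_q(3)`. -/
def QFun (K : QKind) (q : ℝ) : Type := RingQuot (QRel K (q : ℂ))

namespace QFun
variable (K : QKind) (q : ℝ)

noncomputable instance : Ring (QFun K q) := inferInstanceAs (Ring (RingQuot (QRel K (q : ℂ))))
noncomputable instance : Algebra ℂ (QFun K q) :=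
  inferInstanceAs (Algebra ℂ (RingQuot (QRel K (q : ℂ))))

noncomputable def mk : FreeAlgebra ℂ QGen →ₐ[ℂ] QFun K q := RingQuot.mkAlgHom ℂ (QRel K (q : ℂ))

/-- The generators `zⁱⱼ`. -/
noncomputable def z (i j : Fin 3) : QFun K q := mk K q (QGen.Z i j)
/-- The generator `𝒟⁻¹`. -/
noncomputable def detInv : QFun K q := mk K q QGen.E

theorem isQPoint : IsQPoint K (q : ℂ) (z K q) (detInv K q) where
  row i j k hjk := by
    have := RingQuot.mkAlgHom_rel ℂ (QRel.row (K := K) (q := (q : ℂ)) i j k hjk)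
    rw [map_smul, map_mul, map_mul] at this
    exact this
  col i j k hjk := by
    have := RingQuot.mkAlgHom_rel ℂ (QRel.col (K := K) (q := (q : ℂ)) i j k hjk)
    rw [map_smul, map_mul, map_mul] at this
    exact this
  anti i j k l hik hlj := by
    have := RingQuot.mkAlgHom_rel ℂ (QRel.anti (K := K) (q := (q : ℂ)) i j k l hik hlj)
    rw [map_mul, map_mul] at this
    exact this
  cross i j k l hik hlj := by
    have := RingQuot.mkAlgHom_rel ℂ (QRel.cross (K := K) (q := (q : ℂ)) i j k l hik hlj)
    rw [map_add, map_smul, map_mul, map_mul, map_mul] at this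
    exact this
  qdet_mul := by
    have := RingQuot.mkAlgHom_rel ℂ (QRel.qdet_mul (K := K) (q := (q : ℂ)))
    rw [map_mul, map_qdet, map_one] at this
    exact this
  mul_qdet := by
    have := RingQuot.mkAlgHom_rel ℂ (QRel.mul_qdet (K := K) (q := (q : ℂ)))
    rw [map_mul, map_qdet, map_one] at this
    exact this
  unimod hK := by
    have := RingQuot.mkAlgHom_rel ℂ (QRel.unimod (K := K) (q := (q : ℂ)) hK)
    rw [map_qdet, map_one] at this
    exact this

variable {K q}

def genMap (Z : Fin 3 → Fin 3 → R) (E : R) : QGen → R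
  | .z i j => Z i j
  | .detInv => E

/-- The universal property of the coordinate algebra. -/
noncomputable def lift {Z : Fin 3 → Fin 3 → R} {E : R} (h : IsQPoint K (q : ℂ) Z E) :
    QFun K q →ₐ[ℂ] R :=
  RingQuot.liftAlgHom ℂ ⟨FreeAlgebra.lift ℂ (genMap Z E), by
    have hZ : ∀ i j, FreeAlgebra.lift ℂ (genMap Z E) (QGen.Z i j) = Z i j := by
      intro i j; simp [QGen.Z, genMap]
    have hE : FreeAlgebra.lift ℂ (genMap Z E) QGen.E = E := by simp [QGen.E, genMap]
    rintro x y hxy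
    cases hxy with
    | row i j k hjk => simpa only [map_mul, map_smul, hZ] using h.row i j k hjk
    | col i j k hjk => simpa only [map_mul, map_smul, hZ] using h.col i j k hjk
    | anti i j k l hik hlj => simpa only [map_mul, hZ] using h.anti i j k l hik hlj
    | cross i j k l hik hlj =>
      simpa only [map_mul, map_add, map_smul, hZ] using h.cross i j k l hik hlj
    | qdet_mul => simpa only [map_mul, map_qdet, hZ, hE, map_one] using h.qdet_mul
    | mul_qdet => simpa only [map_mul, map_qdet, hZ, hE, map_one] using h.mul_qdet
    | unimod hK => simpa only [map_qdet, hZ, map_one] using h.unimod hK⟩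

@[simp] theorem lift_z {Z : Fin 3 → Fin 3 → R} {E : R} (h : IsQPoint K (q : ℂ) Z E)
    (i j : Fin 3) : lift h (z K q i j) = Z i j := by
  simp only [lift, z, mk]
  erw [RingQuot.liftAlgHom_mkAlgHom_apply]
  simp [QGen.Z, genMap]

@[simp] theorem lift_detInv {Z : Fin 3 → Fin 3 → R} {E : R} (h : IsQPoint K (q : ℂ) Z E) :
    lift h (detInv K q) = E := by
  simp only [lift, detInv, mk]
  erw [RingQuot.liftAlgHom_mkAlgHom_apply]
  simp [QGen.E, genMap]

theorem induction {P : QFun K q → Prop} (hc : ∀ c : ℂ, P (algebraMap ℂ _ c))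
    (hz : ∀ i j, P (z K q i j)) (hE : P (detInv K q))
    (hmul : ∀ a b, P a → P b → P (a * b)) (hadd : ∀ a b, P a → P b → P (a + b)) (a) : P a := by
  obtain ⟨a, rfl⟩ := RingQuot.mkAlgHom_surjective ℂ (QRel K (q : ℂ)) a
  change P (mk K q a)
  induction a with
  | grade0 c => rw [AlgHom.commutes]; exact hc c
  | grade1 x =>
    cases x with
    | z i j => exact hz i j
    | detInv => exact hE
  | mul a b ha hb => rw [map_mul]; exact hmul _ _ ha hb
  | add a b ha hb => rw [map_add]; exact hadd _ _ ha hb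

theorem algHom_ext {f g : QFun K q →ₐ[ℂ] R} (hz : ∀ i j, f (z K q i j) = g (z K q i j)) :
    f = g := by
  have h1 := (isQPoint K q).map f
  have h2 := (isQPoint K q).map g
  have hE : f (detInv K q) = g (detInv K q) := by
    have h3 := h1.mul_qdet
    simp only [hz] at h3
    calc _ = f (detInv K q) * (qdet q (fun i j => g (z K q i j)) * g (detInv K q)) := by
            rw [h2.qdet_mul, mul_one]
      _ = _ := by rw [← mul_assoc, h3, one_mul]
  ext a
  induction a using induction with
  | hc c => simp
  | hz i j => exact hz i j
  | hE => exact hE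
  | hmul a b ha hb => rw [map_mul, map_mul, ha, hb]
  | hadd a b ha hb => rw [map_add, map_add, ha, hb]

end QFun
end

section ConjOp
open MulOpposite

/-- The opposite algebra with complex conjugate scalars: a conjugate-linear antihomomorphism into `R` is
an algebra homomorphism into `ConjOp R`. -/
def ConjOp (R : Type*) : Type _ := Rᵐᵒᵖ

variable {R : Type*} [Ring R] [Algebra ℂ R]

instance : Ring (ConjOp R) := inferInstanceAs (Ring Rᵐᵒᵖ)

noncomputable instance : Algebra ℂ (ConjOp R) :=
  RingHom.toAlgebra' (S := Rᵐᵒᵖ) ((algebraMap ℂ Rᵐᵒᵖ).comp (starRingEnd ℂ))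
    fun c x => Algebra.commutes (A := Rᵐᵒᵖ) (starRingEnd ℂ c) x

def ConjOp.of (R : Type*) [Ring R] : Rᵐᵒᵖ ≃+* ConjOp R := RingEquiv.refl Rᵐᵒᵖ

theorem ConjOp.of_smul (c : ℂ) (x : Rᵐᵒᵖ) :
    ConjOp.of R (starRingEnd ℂ c • x) = c • ConjOp.of R x :=
  Algebra.smul_def (A := Rᵐᵒᵖ) (starRingEnd ℂ c) x

theorem ConjOp.algebraMap_eq (c : ℂ) :
    algebraMap ℂ (ConjOp R) c = ConjOp.of R (op (algebraMap ℂ R (starRingEnd ℂ c))) := rfl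

theorem ConjOp.ofReal_smul (r : ℝ) (x : Rᵐᵒᵖ) :
    ConjOp.of R ((r : ℂ) • x) = (r : ℂ) • ConjOp.of R x := by
  rw [← ConjOp.of_smul, Complex.conj_ofReal]

theorem ConjOp.of_qdet (q : ℝ) (Z : Fin 3 → Fin 3 → Rᵐᵒᵖ) :
    ConjOp.of R (qdet (q : ℂ) Z) = qdet (q : ℂ) (fun i j => ConjOp.of R (Z i j)) := by
  unfold qdet
  simp only [← Complex.ofReal_pow, map_add, map_sub, map_mul, ConjOp.ofReal_smul]

theorem IsQPoint.conjOp {K : QKind} {q : ℝ} {Z : Fin 3 → Fin 3 → Rᵐᵒᵖ} {E : Rᵐᵒᵖ}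
    (h : IsQPoint K (q : ℂ) Z E) :
    IsQPoint K (q : ℂ) (fun i j => ConjOp.of R (Z i j)) (ConjOp.of R E) where
  row i j k hjk := by
    rw [← map_mul, h.row i j k hjk, ConjOp.ofReal_smul, map_mul]
  col i j k hik := by
    rw [← map_mul, h.col i j k hik, ConjOp.ofReal_smul, map_mul]
  anti i j k l hik hlj := by rw [← map_mul, h.anti i j k l hik hlj, map_mul]
  cross i j k l hik hjl := by
    have : ((q : ℂ) - (q : ℂ)⁻¹) = ((q - q⁻¹ : ℝ) : ℂ) := by push_cast; rfl
    rw [← map_mul, h.cross i j k l hik hjl, this, map_add, ConjOp.ofReal_smul, map_mul, map_mul]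
  qdet_mul := by rw [← ConjOp.of_qdet, ← map_mul, h.qdet_mul, map_one]
  mul_qdet := by rw [← ConjOp.of_qdet, ← map_mul, h.mul_qdet, map_one]
  unimod hK := by rw [← ConjOp.of_qdet, h.unimod hK, map_one]

end ConjOp

namespace QFun
open MulOpposite
variable (K : QKind) (q : ℝ)

/-- The matrix `S(Z) = 𝒟⁻¹ · (cofactors)`. -/
noncomputable def S (i j : Fin 3) : QFun K q := qadj (q : ℂ) (z K q) i j * detInv K q

theorem q_ne [hq : NeZero q] : (q : ℂ) ≠ 0 := Complex.ofReal_ne_zero.2 hq.out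

variable [NeZero q]

/-- Coproduct: `Δ(zⁱⱼ) = ∑ₖ zⁱₖ ⊗ zᵏⱼ`. -/
noncomputable def comulHom : QFun K q →ₐ[ℂ] QFun K q ⊗[ℂ] QFun K q :=
  lift (IsQPoint.mul (q_ne q)
    ((isQPoint K q).map (Algebra.TensorProduct.includeLeft (S := ℂ) (B := QFun K q)))
    ((isQPoint K q).map (Algebra.TensorProduct.includeRight (A := QFun K q)))
    (by simp) (by rw [← map_qdet]; simp) (by simp))

theorem isQPoint_one : IsQPoint K (q : ℂ) (fun i j : Fin 3 => if i = j then (1 : ℂ) else 0) 1 where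
  row i j k h := by
    have := h.ne
    by_cases h1 : i = j <;> by_cases h2 : i = k <;> simp_all
  col i j k h := by
    have := h.ne
    by_cases h1 : i = j <;> by_cases h2 : k = j <;> simp_all
  anti i j k l h h' := mul_comm _ _
  cross i j k l h h' := by
    by_cases h1 : k = j <;> by_cases h2 : i = l <;> simp_all [mul_comm]
    exact absurd (h.trans h') (lt_irrefl _)
  qdet_mul := by simp [qdet]
  mul_qdet := by simp [qdet]
  unimod _ := by simp [qdet]

/-- Counit: `ε(zⁱⱼ) = δⁱⱼ`. -/
noncomputable def counitHom : QFun K q →ₐ[ℂ] ℂ := lift (isQPoint_one K q)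

/-- Antipode, as an antihomomorphism with `zⁱⱼ ↦ S(Z)ⁱⱼ`. -/
noncomputable def antipodeHom : QFun K q →ₐ[ℂ] (QFun K q)ᵐᵒᵖ :=
  lift ((isQPoint K q).antipode (q_ne q))

/-- The `*`-operation, as a conjugate-linear antihomomorphism with `zⁱⱼ ↦ S(Z)ʲᵢ` and `𝒟⁻¹ ↦ 𝒟`. -/
noncomputable def starHom : QFun K q →ₐ[ℂ] ConjOp (QFun K q) :=
  lift (((isQPoint K q).antipode (q_ne q)).transpose (q_ne q)).conjOp

@[simp] theorem comulHom_z (i j : Fin 3) :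
    comulHom K q (z K q i j) = ∑ k, z K q i k ⊗ₜ[ℂ] z K q k j := by simp [comulHom]
@[simp] theorem comulHom_detInv :
    comulHom K q (detInv K q) = detInv K q ⊗ₜ[ℂ] detInv K q := by simp [comulHom]
@[simp] theorem counitHom_z (i j : Fin 3) : counitHom K q (z K q i j) = if i = j then 1 else 0 := by
  simp [counitHom]
@[simp] theorem counitHom_detInv : counitHom K q (detInv K q) = 1 := by simp [counitHom]
@[simp] theorem antipodeHom_z (i j : Fin 3) : antipodeHom K q (z K q i j) = op (S K q i j) := by
  simp [antipodeHom, S]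
@[simp] theorem antipodeHom_detInv :
    antipodeHom K q (detInv K q) = op (qdet (q : ℂ) (z K q)) := by simp [antipodeHom]
theorem starHom_z (i j : Fin 3) :
    starHom K q (z K q i j) = ConjOp.of _ (op (S K q j i)) := lift_z _ i j
theorem starHom_detInv :
    starHom K q (detInv K q) = ConjOp.of _ (op (qdet (q : ℂ) (z K q))) := lift_detInv _

noncomputable instance : Bialgebra ℂ (QFun K q) :=
  Bialgebra.ofAlgHom (comulHom K q) (counitHom K q)
    (algHom_ext fun i j => by
      simp [TensorProduct.sum_tmul, TensorProduct.tmul_sum]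
      exact Finset.sum_comm)
    (algHom_ext fun i j => by simp [ite_smul, TensorProduct.ite_tmul])
    (algHom_ext fun i j => by simp [ite_smul, TensorProduct.tmul_ite])

theorem comul_eq (a : QFun K q) : Coalgebra.comul (R := ℂ) a = comulHom K q a := rfl
theorem counit_eq (a : QFun K q) : Coalgebra.counit (R := ℂ) a = counitHom K q a := rfl

noncomputable def antipodeLin : QFun K q →ₗ[ℂ] QFun K q :=
  (opLinearEquiv ℂ).symm.toLinearMap ∘ₗ (antipodeHom K q).toLinearMap

theorem antipodeLin_apply (a : QFun K q) : antipodeLin K q a = unop (antipodeHom K q a) := rfl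
theorem antipodeLin_mul (a b : QFun K q) :
    antipodeLin K q (a * b) = antipodeLin K q b * antipodeLin K q a := by
  simp [antipodeLin_apply]

theorem rTensor_mul (s t : QFun K q ⊗[ℂ] QFun K q) (c : ℂ)
    (hs : LinearMap.mul' ℂ _ ((antipodeLin K q).rTensor _ s) = algebraMap ℂ _ c) :
    LinearMap.mul' ℂ _ ((antipodeLin K q).rTensor _ (s * t)) =
      c • LinearMap.mul' ℂ _ ((antipodeLin K q).rTensor _ t) := by
  induction t with
  | zero => simp
  | add x y hx hy => rw [mul_add, map_add, map_add, hx, hy, map_add, map_add, smul_add]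
  | tmul u v =>
    have : ∀ s : QFun K q ⊗[ℂ] QFun K q,
        LinearMap.mul' ℂ _ ((antipodeLin K q).rTensor _ (s * (u ⊗ₜ v))) =
          antipodeLin K q u * LinearMap.mul' ℂ _ ((antipodeLin K q).rTensor _ s) * v := by
      intro s
      induction s with
      | zero => simp
      | add x y hx hy => rw [add_mul, map_add, map_add, hx, hy, map_add, map_add, mul_add, add_mul]
      | tmul x y => simp [antipodeLin_mul, mul_assoc]
    rw [this, hs]
    simp [Algebra.algebraMap_eq_smul_one]

theorem lTensor_mul (s t : QFun K q ⊗[ℂ] QFun K q) (c : ℂ)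
    (ht : LinearMap.mul' ℂ _ ((antipodeLin K q).lTensor _ t) = algebraMap ℂ _ c) :
    LinearMap.mul' ℂ _ ((antipodeLin K q).lTensor _ (s * t)) =
      c • LinearMap.mul' ℂ _ ((antipodeLin K q).lTensor _ s) := by
  induction s with
  | zero => simp
  | add x y hx hy => rw [add_mul, map_add, map_add, hx, hy, map_add, map_add, smul_add]
  | tmul u v =>
    have : ∀ t : QFun K q ⊗[ℂ] QFun K q,
        LinearMap.mul' ℂ _ ((antipodeLin K q).lTensor _ ((u ⊗ₜ v) * t)) =
          u * LinearMap.mul' ℂ _ ((antipodeLin K q).lTensor _ t) * antipodeLin K q v := by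
      intro s
      induction s with
      | zero => simp
      | add x y hx hy => rw [mul_add, map_add, map_add, hx, hy, map_add, map_add, mul_add, add_mul]
      | tmul x y => simp [antipodeLin_mul, mul_assoc]
    rw [this, ht]
    simp [Algebra.algebraMap_eq_smul_one]

noncomputable instance : HopfAlgebra ℂ (QFun K q) where
  antipode := antipodeLin K q
  mul_antipode_rTensor_comul := by
    ext a
    simp only [LinearMap.comp_apply, comul_eq, counit_eq, Algebra.linearMap_apply]
    induction a using induction with
    | hc c => simp [Algebra.algebraMap_eq_smul_one, Algebra.TensorProduct.one_def, antipodeLin_apply]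
    | hz i j =>
      simp only [comulHom_z, map_sum, LinearMap.rTensor_tmul, antipodeLin_apply, antipodeHom_z,
        LinearMap.mul'_apply, unop_op, S, counitHom_z]
      rw [(isQPoint K q).inv_mul (q_ne q)]
      split_ifs <;> simp
    | hE => simp [antipodeLin_apply, (isQPoint K q).qdet_mul]
    | hmul a b ha hb =>
      rw [map_mul, rTensor_mul K q _ _ _ ha, hb, map_mul, map_mul, Algebra.smul_def]
    | hadd a b ha hb => rw [map_add, map_add, map_add, ha, hb, map_add, map_add]
  mul_antipode_lTensor_comul := by
    ext a
    simp only [LinearMap.comp_apply, comul_eq, counit_eq, Algebra.linearMap_apply]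
    induction a using induction with
    | hc c => simp [Algebra.algebraMap_eq_smul_one, Algebra.TensorProduct.one_def, antipodeLin_apply]
    | hz i j =>
      simp only [comulHom_z, map_sum, LinearMap.lTensor_tmul, antipodeLin_apply, antipodeHom_z,
        LinearMap.mul'_apply, unop_op, S, counitHom_z]
      rw [(isQPoint K q).mul_inv (q_ne q)]
      split_ifs <;> simp
    | hE => simp [antipodeLin_apply, (isQPoint K q).mul_qdet]
    | hmul a b ha hb =>
      rw [map_mul, lTensor_mul K q _ _ _ hb, ha, map_mul, map_mul, Algebra.smul_def]
      exact Algebra.commutes _ _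
    | hadd a b ha hb => rw [map_add, map_add, map_add, ha, hb, map_add, map_add]

theorem antipode_z (i j : Fin 3) : HopfAlgebra.antipode ℂ (z K q i j) = S K q i j := by
  change unop (antipodeHom K q (z K q i j)) = _
  rw [antipodeHom_z, unop_op]

noncomputable def starFun (a : QFun K q) : QFun K q :=
  unop ((ConjOp.of _).symm (starHom K q a))

theorem starFun_z (i j : Fin 3) : starFun K q (z K q i j) = S K q j i := by
  simp only [starFun, starHom_z]; rfl
theorem starFun_detInv : starFun K q (detInv K q) = qdet (q : ℂ) (z K q) := by
  simp only [starFun, starHom_detInv]; rfl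
theorem starFun_mul (a b : QFun K q) : starFun K q (a * b) = starFun K q b * starFun K q a := by
  simp only [starFun, map_mul]; rfl
theorem starFun_add (a b : QFun K q) : starFun K q (a + b) = starFun K q a + starFun K q b := by
  simp only [starFun, map_add]; rfl
theorem starFun_algebraMap (c : ℂ) :
    starFun K q (algebraMap ℂ _ c) = algebraMap ℂ _ (starRingEnd ℂ c) := by
  simp only [starFun, AlgHom.commutes]; rfl

theorem starFun_S (i j : Fin 3) : starFun K q (S K q i j) = z K q j i := by
  have hs : starFun K q 0 = 0 := by simpa using starFun_algebraMap K q 0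
  have h1 : starFun K q 1 = 1 := by simpa using starFun_algebraMap K q 1
  have hsum : ∀ f : Fin 3 → QFun K q, starFun K q (∑ k, f k) = ∑ k, starFun K q (f k) := by
    intro f; simp [Fin.sum_univ_three, starFun_add]
  have h : ∀ a b, ∑ k, S K q b k * starFun K q (S K q a k) = if a = b then 1 else 0 := by
    intro a b
    have := congrArg (starFun K q) ((isQPoint K q).inv_mul (q_ne q) a b)
    rw [hsum] at this
    simp only [starFun_mul _ _ (_ * _) (z K q _ _), starFun_z] at this
    rw [apply_ite (starFun K q), h1, hs] at this
    exact this
  calc starFun K q (S K q i j) = ∑ k, (if j = k then 1 else 0) * starFun K q (S K q i k) := by simp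
    _ = ∑ k, (∑ l, z K q j l * S K q l k) * starFun K q (S K q i k) := by
        refine Finset.sum_congr rfl fun k _ => ?_
        rw [← (isQPoint K q).mul_inv (q_ne q) j k]; rfl
    _ = ∑ l, z K q j l * ∑ k, S K q l k * starFun K q (S K q i k) := by
        simp only [Finset.sum_mul, Finset.mul_sum, mul_assoc]; exact Finset.sum_comm
    _ = z K q j i := by simp [h]

theorem starFun_starFun (a : QFun K q) : starFun K q (starFun K q a) = a := by
  have h1 : starFun K q 1 = 1 := by simpa using starFun_algebraMap K q 1
  induction a using induction with
  | hc c => rw [starFun_algebraMap, starFun_algebraMap]; simp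
  | hz i j => rw [starFun_z, starFun_S]
  | hE =>
    have h2 := congrArg (starFun K q) (isQPoint K q).mul_qdet
    rw [starFun_mul, starFun_detInv, h1] at h2
    calc _ = starFun K q (starFun K q (detInv K q)) *
              (qdet (q : ℂ) (z K q) * detInv K q) := by rw [(isQPoint K q).qdet_mul, mul_one]
      _ = detInv K q := by rw [starFun_detInv, ← mul_assoc, h2, one_mul]
  | hmul a b ha hb => rw [starFun_mul, starFun_mul, ha, hb]
  | hadd a b ha hb => rw [starFun_add, starFun_add, ha, hb]

noncomputable instance : StarRing (QFun K q) where
  star := starFun K q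
  star_involutive := starFun_starFun K q
  star_mul := starFun_mul K q
  star_add := starFun_add K q

instance : StarModule ℂ (QFun K q) where
  star_smul c a := by
    rw [Algebra.smul_def, Algebra.smul_def, star_mul]
    change star a * starFun K q (algebraMap ℂ _ c) = _
    rw [starFun_algebraMap]
    exact (Algebra.commutes _ _).symm

end QFun

/-- The projection `Fun_q(GL(3, ℂ)) → Fun_q(SL(3, ℂ))` that imposes `𝒟 = 1`. -/
noncomputable def QFun.proj (q : ℝ) : QFun QKind.GL q →ₐ[ℂ] QFun QKind.SL q :=
  QFun.lift { QFun.isQPoint QKind.SL q with unimod := fun h => nomatch h }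

universe u v w

/-- A first order differential calculus over a complex algebra `H`: an `H`-bimodule `Form`
(the right action `ρ a` is written `MulOpposite.op a • ρ`) with a linear map `d` that satisfies the
Leibniz rule and whose range generates `Form` as a left module. -/
structure FODC (H : Type u) [Ring H] [Algebra ℂ H] where
  Form : Type v
  [addCommGroup : AddCommGroup Form]
  [moduleComplex : Module ℂ Form]
  [moduleLeft : Module H Form]
  [moduleRight : Module Hᵐᵒᵖ Form]
  [smulCommClass : SMulCommClass H Hᵐᵒᵖ Form]
  [towerLeft : IsScalarTower ℂ H Form]
  [towerRight : IsScalarTower ℂ Hᵐᵒᵖ Form]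
  d : H →ₗ[ℂ] Form
  leibniz : ∀ a b : H, d (a * b) = MulOpposite.op b • d a + a • d b
  span_range_d : Submodule.span H (Set.range d) = ⊤

attribute [instance] FODC.addCommGroup FODC.moduleComplex FODC.moduleLeft FODC.moduleRight
  FODC.smulCommClass FODC.towerLeft FODC.towerRight

namespace FODC

section General
variable {H : Type u} [Ring H] [Algebra ℂ H]

/-- Equivalence of calculi: a bimodule isomorphism that intertwines the differentials. -/
def Equivalent (Γ : FODC.{u, v} H) (Γ' : FODC.{u, w} H) : Prop :=
  ∃ ζ : Γ.Form ≃+ Γ'.Form, (∀ (a : H) (ρ : Γ.Form), ζ (a • ρ) = a • ζ ρ) ∧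
    (∀ (a : H) (ρ : Γ.Form), ζ (MulOpposite.op a • ρ) = MulOpposite.op a • ζ ρ) ∧
    ∀ a : H, ζ (Γ.d a) = Γ'.d a

/-- The left action of `H ⊗ H` on `H ⊗ Γ`: `(a ⊗ b) (c ⊗ ρ) = a c ⊗ b ρ`. -/
noncomputable def actL (Γ : FODC.{u, v} H) :
    H ⊗[ℂ] H →ₗ[ℂ] H ⊗[ℂ] Γ.Form →ₗ[ℂ] H ⊗[ℂ] Γ.Form :=
  TensorProduct.map₂ (LinearMap.mul ℂ H) (Algebra.lsmul ℂ ℂ Γ.Form).toLinearMap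

/-- The left action of `H ⊗ H` on `Γ ⊗ H`: `(a ⊗ b) (ρ ⊗ c) = a ρ ⊗ b c`. -/
noncomputable def actR (Γ : FODC.{u, v} H) :
    H ⊗[ℂ] H →ₗ[ℂ] Γ.Form ⊗[ℂ] H →ₗ[ℂ] Γ.Form ⊗[ℂ] H :=
  TensorProduct.map₂ (Algebra.lsmul ℂ ℂ Γ.Form).toLinearMap (LinearMap.mul ℂ H)

/-- `s` is a `*`-structure on the one-forms that extends the involution of `H`. (Conjugate linearity is
the case of a scalar `a` in `left`.) -/
structure IsStar [StarRing H] (Γ : FODC.{u, v} H) (s : Γ.Form → Γ.Form) : Prop where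
  add : ∀ ρ ρ' : Γ.Form, s (ρ + ρ') = s ρ + s ρ'
  involutive : ∀ ρ : Γ.Form, s (s ρ) = ρ
  left : ∀ (a : H) (ρ : Γ.Form), s (a • ρ) = MulOpposite.op (star a) • s ρ
  right : ∀ (a : H) (ρ : Γ.Form), s (MulOpposite.op a • ρ) = star a • s ρ
  d : ∀ a : H, s (Γ.d a) = Γ.d (star a)

end General

/-- Bicovariance: there are linear coactions `Δ_L`, `Δ_R` with
`Δ_L(a db) = Δ(a) (id ⊗ d)Δ(b)` and `Δ_R(a db) = Δ(a) (d ⊗ id)Δ(b)`. -/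
def IsBicovariant {H : Type u} [Ring H] [HopfAlgebra ℂ H] (Γ : FODC.{u, v} H) : Prop :=
  (∃ ΔL : Γ.Form →ₗ[ℂ] H ⊗[ℂ] Γ.Form, ∀ a b : H,
    ΔL (a • Γ.d b) =
      Γ.actL (Coalgebra.comul (R := ℂ) a) (Γ.d.lTensor H (Coalgebra.comul (R := ℂ) b))) ∧
  (∃ ΔR : Γ.Form →ₗ[ℂ] Γ.Form ⊗[ℂ] H, ∀ a b : H,
    ΔR (a • Γ.d b) =
      Γ.actR (Coalgebra.comul (R := ℂ) a) (Γ.d.rTensor H (Coalgebra.comul (R := ℂ) b)))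

/-- A bicovariant `*`-calculus. -/
def IsBicovariantStar {H : Type u} [Ring H] [HopfAlgebra ℂ H] [StarRing H]
    (Γ : FODC.{u, v} H) : Prop :=
  Γ.IsBicovariant ∧ ∃ s : Γ.Form → Γ.Form, Γ.IsStar s

/-- The two families. -/
inductive Family : Type
  | first
  | second

section Quantum
variable {K : QKind} {q : ℝ}

/-- The differentials `dzⁱⱼ` form a basis of the one-forms as a left module. -/
def IsDzBasis (Γ : FODC.{0, v} (QFun K q)) : Prop :=
  LinearIndependent (QFun K q) (fun p : Fin 3 × Fin 3 => Γ.d (QFun.z K q p.1 p.2)) ∧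
    Submodule.span (QFun K q) (Set.range fun p : Fin 3 × Fin 3 => Γ.d (QFun.z K q p.1 p.2)) = ⊤

/-- The Maurer–Cartan forms `θⁱⱼ = ∑ₖ S(zⁱₖ) dzᵏⱼ`. -/
noncomputable def theta [NeZero q] (Γ : FODC.{0, v} (QFun K q)) (i j : Fin 3) : Γ.Form :=
  ∑ k, HopfAlgebra.antipode ℂ (QFun.z K q i k) • Γ.d (QFun.z K q k j)

/-- `Tr_q θ = q⁴ θ¹₁ + q² θ²₂ + θ³₃`. -/
noncomputable def trq [NeZero q] (Γ : FODC.{0, v} (QFun K q)) : Γ.Form :=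
  (q : ℂ) ^ 4 • Γ.theta 0 0 + (q : ℂ) ^ 2 • Γ.theta 1 1 + Γ.theta 2 2

/-- The restrictions on the parameter `t` of the two families. -/
def Admissible (q : ℂ) : Family → ℂ → Prop
  | .first, t => t ≠ 0 ∧ (q ^ 6 + q ^ 4 + 1) * t - (q ^ 6 + q ^ 4 + q ^ 2) ≠ 0
  | .second, t => t ≠ 0 ∧ (q ^ 6 + q ^ 2 + 1) * t - (q ^ 4 + q ^ 2 + 1) ≠ 0

noncomputable def sigma (q t : ℂ) : ℂ :=
  (q ^ 2 - t) * (t - 1) / (q ^ 4 * (q ^ 2 + 1) * (t - 1) - q ^ 2 + t)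

noncomputable def beta (q t : ℂ) : ℂ :=
  t * (q ^ 2 - 1) * (t - 1) / (q ^ 4 * (q ^ 2 + 1) * (t - 1) - q ^ 2 + t)

noncomputable def sigmaHat (q t : ℂ) : ℂ :=
  -((q ^ 2 * t - 1) * (t - 1) / (q ^ 4 * (q ^ 2 * t - 1) + (q ^ 2 + 1) * (t - 1)))

noncomputable def betaHat (q t : ℂ) : ℂ :=
  -(t * (q ^ 2 - 1) * (t - 1) / (q ^ 4 * (q ^ 2 * t - 1) + (q ^ 2 + 1) * (t - 1)))

/-- The commutation relations between differentials and generators in the first family. -/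
structure RelFirst [NeZero q] (Γ : FODC.{0, v} (QFun K q)) (t : ℂ) : Prop where
  same : ∀ i j : Fin 3, let z := QFun.z K q
    MulOpposite.op (z i j) • Γ.d (z i j) =
      (t / (q : ℂ) ^ 2 + t - 1) • (z i j • Γ.d (z i j))
        + sigma q t • ((z i j * z i j) • Γ.trq)
  row : ∀ i j l : Fin 3, j < l → let z := QFun.z K q
    MulOpposite.op (z i l) • Γ.d (z i j) =
      (t / (q : ℂ)) • (z i l • Γ.d (z i j)) + (t - 1) • (z i j • Γ.d (z i l))
        + sigma q t • ((z i j * z i l) • Γ.trq)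
  col : ∀ i j k : Fin 3, i < k → let z := QFun.z K q
    MulOpposite.op (z k j) • Γ.d (z i j) =
      (t / (q : ℂ)) • (z k j • Γ.d (z i j)) + (t - 1) • (z i j • Γ.d (z k j))
        + sigma q t • ((z i j * z k j) • Γ.trq)
  down : ∀ i j k l : Fin 3, i < k → j < l → let z := QFun.z K q
    MulOpposite.op (z k l) • Γ.d (z i j) =
      t • (z k l • Γ.d (z i j)) + (t - 1) • (z i j • Γ.d (z k l))
        + sigma q t • ((z i j * z k l) • Γ.trq)
        - beta q t • ((z i j * z k l - (q : ℂ) • (z i l * z k j)) • Γ.trq)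
  up : ∀ i j k l : Fin 3, i < k → l < j → let z := QFun.z K q
    MulOpposite.op (z k l) • Γ.d (z i j) =
      t • (z k l • Γ.d (z i j)) + (t - 1) • (z i j • Γ.d (z k l))
        + sigma q t • ((z i j * z k l) • Γ.trq)
        - (t * ((q : ℂ) - (q : ℂ)⁻¹)) • (z k j • Γ.d (z i l))
        + ((q : ℂ) * beta q t) • ((z i l * z k j - (q : ℂ) • (z i j * z k l)) • Γ.trq)

/-- The commutation relations between differentials and generators in the second family. -/
structure RelSecond [NeZero q] (Γ : FODC.{0, v} (QFun K q)) (t : ℂ) : Prop where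
  same : ∀ i j : Fin 3, let z := QFun.z K q
    MulOpposite.op (z i j) • Γ.d (z i j) =
      (t * (q : ℂ) ^ 2 + t - 1) • (z i j • Γ.d (z i j))
        + sigmaHat q t • ((z i j * z i j) • Γ.trq)
  row : ∀ i j l : Fin 3, j < l → let z := QFun.z K q
    MulOpposite.op (z i l) • Γ.d (z i j) =
      (t * (q : ℂ)) • (z i l • Γ.d (z i j)) + (t * (q : ℂ) ^ 2 - 1) • (z i j • Γ.d (z i l))
        + sigmaHat q t • ((z i j * z i l) • Γ.trq)
  col : ∀ i j k : Fin 3, i < k → let z := QFun.z K q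
    MulOpposite.op (z k j) • Γ.d (z i j) =
      (t * (q : ℂ)) • (z k j • Γ.d (z i j)) + (t * (q : ℂ) ^ 2 - 1) • (z i j • Γ.d (z k j))
        + sigmaHat q t • ((z i j * z k j) • Γ.trq)
  down : ∀ i j k l : Fin 3, i < k → j < l → let z := QFun.z K q
    MulOpposite.op (z k l) • Γ.d (z i j) =
      t • (z k l • Γ.d (z i j)) + (t - 1) • (z i j • Γ.d (z k l))
        + sigmaHat q t • ((z i j * z k l) • Γ.trq)
        + (t * ((q : ℂ) - (q : ℂ)⁻¹)) • (z i l • Γ.d (z k j) + z k j • Γ.d (z i l))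
        + (t * ((q : ℂ) - (q : ℂ)⁻¹) ^ 2) • (z i j • Γ.d (z k l))
        - (betaHat q t / (q : ℂ) ^ 2) • ((z i j * z k l - (q : ℂ) • (z i l * z k j)) • Γ.trq)
  up : ∀ i j k l : Fin 3, i < k → l < j → let z := QFun.z K q
    MulOpposite.op (z k l) • Γ.d (z i j) =
      t • (z k l • Γ.d (z i j)) + (t - 1) • (z i j • Γ.d (z k l))
        + sigmaHat q t • ((z i j * z k l) • Γ.trq)
        + (t * ((q : ℂ) - (q : ℂ)⁻¹)) • (z i l • Γ.d (z k j))
        + (betaHat q t / (q : ℂ)) • ((z i l * z k j - (q : ℂ) • (z i j * z k l)) • Γ.trq)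

/-- `Γ` is the calculus `Γ_ν(t)`: the parameter is admissible, the `dzⁱⱼ` form a basis of the left
module of one-forms, and the commutation relations of the family `ν` with parameter `t` hold. -/
def IsGamma [NeZero q] (ν : Family) (t : ℂ) (Γ : FODC.{0, v} (QFun K q)) : Prop :=
  Admissible (q : ℂ) ν t ∧ Γ.IsDzBasis ∧
    match ν with
    | .first => Γ.RelFirst t
    | .second => Γ.RelSecond t

/-- The condition `t³ = q²` (first family), `t³ = q⁻²` (second family). -/
def Unimodular (q : ℝ) : Family → ℝ → Prop
  | .first, t => t ^ 3 = q ^ 2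
  | .second, t => t ^ 3 = (q ^ 2)⁻¹

/-- `Γ` induces `Γ'`: the calculus `Γ` is consistent with the relation `𝒟 = 1`, that is, `Γ'` is the
quotient of `Γ` by `I Γ`, where `I` is the kernel of the projection `Fun_q(GL(3)) → Fun_q(SL(3))`,
with the bimodule structure and the differential inherited from `Γ`. -/
def Induces (Γ : FODC.{0, v} (QFun QKind.GL q)) (Γ' : FODC.{0, w} (QFun QKind.SL q)) : Prop :=
  ∃ φ : Γ.Form →+ Γ'.Form, Function.Surjective φ ∧
    (∀ (a : QFun QKind.GL q) (ρ : Γ.Form), φ (a • ρ) = QFun.proj q a • φ ρ) ∧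
    (∀ (a : QFun QKind.GL q) (ρ : Γ.Form),
      φ (MulOpposite.op a • ρ) = MulOpposite.op (QFun.proj q a) • φ ρ) ∧
    (∀ a : QFun QKind.GL q, φ (Γ.d a) = Γ'.d (QFun.proj q a)) ∧
    ∀ ρ : Γ.Form, φ ρ = 0 ↔ ρ ∈ Submodule.span (QFun QKind.GL q)
      {x | ∃ (a : QFun QKind.GL q) (ρ' : Γ.Form), QFun.proj q a = 0 ∧ x = a • ρ'}

end Quantum

end FODC

/-! Let R be the braid matrix behind the defining relations. On quadratic expressions it can act on
the pair of row indices (`swL`) or on the pair of column indices (`swR`), and the defining relations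
say that both actions agree on ZZ. With R_L, R_R for these actions, both lists of commutation
relations become one formula (`gform`, `BraidRel`): dz·z = (t - 1) z dz + t R_L R_R (z dz) + g zz
Tr_q θ + h R_R (zz Tr_q θ), where R is the braid matrix for the second family and its inverse for
the first. `isGamma_iff` makes this the working definition of Γ_ν(t).

Necessity. Left covariance forces dz·z to be ZZ contracted with left-invariant forms that have
complex coefficients (`IsDzBasis.dzMulZ_eq_expand`), and right covariance makes the tensor of
coefficients coinvariant (`IsRightCoaction.coeff_eq`). Testing coinvariance on diagonal points and
on two-dimensional triangular representations shows that a coinvariant tensor is determined by six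
of its entries, so six evident invariants span (`IsCoinv.exists_coinvForm`). The Leibniz rule,
applied to the defining relations, removes two of the six parameters. Associativity of the right
action gives further equations: a quadratic one splits into the two families, and the others express
g and h through t (`exists_eq_gform`). Finally the involution forces t to be real
(`BraidRel.conj_eq`).

Sufficiency. A bimodule map out of a calculus with basis dz only has to be checked against the
commutation relations (`IsDzBasis.exists_extension`). Applied to H ⊗ Γ, to Γ ⊗ H, to Γ with its
actions exchanged by the involution, and to another calculus, this gives the two coactions, the
*-structure, the equivalences and the maps to calculi over SU_q(3).

Existence. On a free left module with basis η, right multiplication by z is defined through t R_L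
R_R. Its structure matrices are a product of two commuting quantum matrices, so the defining
relations are respected. The differential is the inner derivation given by ω = Tr_q η
(`modelFODC_isGamma`).

Passage to SU_q(3). The quantum determinant of the structure matrices is t³q⁻² or t³q², so 𝒟
commutes with one-forms up to this scalar (`IsGamma.op_qdet_smul`). Imposing 𝒟 = 1 forces the scalar
to be 1; if it is 1, the model also exists over SU_q(3) and is the quotient calculus. -/

/-- Families indexed by two row and two column indices. -/
abbrev Quad (M : Type*) := Fin 3 → Fin 3 → Fin 3 → Fin 3 → M

/-! ### The braid matrix on row and column indices -/

section RMatrix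
variable {M N P : Type*} [AddCommGroup M] [Module ℂ M] [AddCommGroup N] [Module ℂ N]
  [AddCommGroup P] [Module ℂ P]

/-- The coefficients of the flipped term of the braid matrix: the inverse braid matrix for the first
family, the braid matrix for the second one. -/
noncomputable def rd (ν : FODC.Family) (q : ℂ) (i k : Fin 3) : ℂ :=
  if i = k then (match ν with | .first => q⁻¹ | .second => q) else 1

/-- The coefficients of the diagonal term of the braid matrix. -/
noncomputable def rl (ν : FODC.Family) (q : ℂ) (i k : Fin 3) : ℂ :=
  match ν with
  | .first => if k < i then -(q - q⁻¹) else 0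
  | .second => if i < k then q - q⁻¹ else 0

/-- The coefficient in the Hecke relation `R² = 1 + μ R`. -/
noncomputable def rmu (ν : FODC.Family) (q : ℂ) : ℂ :=
  match ν with | .first => q⁻¹ - q | .second => q - q⁻¹

theorem rd_symm (ν : FODC.Family) (q : ℂ) (i k : Fin 3) : rd ν q i k = rd ν q k i := by
  simp only [rd, eq_comm]

/-- The braid matrix acting on the row indices. -/
noncomputable def swL (ν : FODC.Family) (q : ℂ) : Quad M →ₗ[ℂ] Quad M where
  toFun y i k j l := rd ν q i k • y k i j l + rl ν q i k • y i k j l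
  map_add' x y := by ext i k j l; simp only [Pi.add_apply, smul_add]; abel
  map_smul' c y := by
    ext i k j l
    simp only [Pi.smul_apply, smul_add, RingHom.id_apply, smul_comm c]

/-- The braid matrix acting on the column indices. -/
noncomputable def swR (ν : FODC.Family) (q : ℂ) : Quad M →ₗ[ℂ] Quad M where
  toFun y i k j l := rd ν q j l • y i k l j + rl ν q j l • y i k j l
  map_add' x y := by ext i k j l; simp only [Pi.add_apply, smul_add]; abel
  map_smul' c y := by
    ext i k j l
    simp only [Pi.smul_apply, smul_add, RingHom.id_apply, smul_comm c]

theorem swL_apply (ν : FODC.Family) (q : ℂ) (y : Quad M) (i k j l : Fin 3) :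
    swL ν q y i k j l = rd ν q i k • y k i j l + rl ν q i k • y i k j l := rfl

theorem swR_apply (ν : FODC.Family) (q : ℂ) (y : Quad M) (i k j l : Fin 3) :
    swR ν q y i k j l = rd ν q j l • y i k l j + rl ν q j l • y i k j l := rfl

theorem swL_swR (ν ν' : FODC.Family) (q : ℂ) (y : Quad M) :
    swL ν q (swR ν' q y) = swR ν' q (swL ν q y) := by
  ext i k j l
  simp only [swL_apply, swR_apply, smul_add, smul_smul, mul_comm]
  abel

theorem rd_of_ne (ν : FODC.Family) (q : ℂ) {i k : Fin 3} (h : i ≠ k) : rd ν q i k = 1 := by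
  simp [rd, h]

theorem rl_self (ν : FODC.Family) (q : ℂ) (i : Fin 3) : rl ν q i i = 0 := by
  cases ν <;> simp [rl]

theorem rd_self_mul (ν : FODC.Family) {q : ℂ} (hq : q ≠ 0) (i : Fin 3) :
    rd ν q i i * rd ν q i i = 1 + rmu ν q * rd ν q i i := by
  cases ν <;> simp only [rd, rmu, if_true] <;> field_simp <;> ring

theorem rl_add_rl (ν : FODC.Family) (q : ℂ) {i k : Fin 3} (h : i ≠ k) :
    rl ν q i k + rl ν q k i = rmu ν q := by
  rcases h.lt_or_gt with h | h <;> cases ν <;> simp [rl, rmu, h, h.not_gt]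

theorem rl_mul_self (ν : FODC.Family) (q : ℂ) (i k : Fin 3) :
    rl ν q i k * rl ν q i k = rmu ν q * rl ν q i k := by
  rcases lt_trichotomy i k with h | h | h <;> cases ν <;> simp [rl, rmu, h, h.not_gt]

/-- The Hecke relation, entry by entry: on equal indices it is the quadratic equation of the
eigenvalue `rd`; on distinct indices each of the two diagonal coefficients is 0 or `rmu`, and they
add up to `rmu`. -/
theorem swR_swR (ν : FODC.Family) {q : ℂ} (hq : q ≠ 0) (y : Quad M) :
    swR ν q (swR ν q y) = y + rmu ν q • swR ν q y := by
  ext i k j l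
  simp only [swR_apply, Pi.add_apply, Pi.smul_apply, smul_add, smul_smul]
  by_cases h : j = l
  · subst h
    rw [rl_self, rd_self_mul ν hq]
    simp only [mul_zero, zero_mul, zero_smul, add_zero, add_smul, one_smul]
  · rw [rd_of_ne ν q h, rd_of_ne ν q (Ne.symm h), rl_mul_self,
      ← rl_add_rl ν q h]
    module

/-- By the Hecke relation R - (q - q⁻¹) is the inverse of R. Hence an identity between row and
column action passes from one family to the other. -/
theorem swL_first_eq (q : ℂ) (y : Quad M) :
    swL .first q y = swL .second q y - (q - q⁻¹) • y := by
  ext i k j l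
  simp only [swL_apply, Pi.sub_apply, Pi.smul_apply]
  rcases lt_trichotomy i k with h | h | h
  · simp [rd, rl, h.ne, h.not_gt, h]
  · subst h; simp [rd, rl]; module
  · simp [rd, rl, h.ne', h.not_gt, h]; module

theorem swR_first_eq (q : ℂ) (y : Quad M) :
    swR .first q y = swR .second q y - (q - q⁻¹) • y := by
  ext i k j l
  simp only [swR_apply, Pi.sub_apply, Pi.smul_apply]
  rcases lt_trichotomy j l with h | h | h
  · simp [rd, rl, h.ne, h.not_gt, h]
  · subst h; simp [rd, rl]; module
  · simp [rd, rl, h.ne', h.not_gt, h]; module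

/-- Contraction of the column indices of one family with the row indices of another one. -/
noncomputable def conv (B : M →ₗ[ℂ] N →ₗ[ℂ] P) (x : Quad M) (y : Quad N) : Quad P :=
  fun i k j l => ∑ a, ∑ b, B (x i k a b) (y a b j l)

/-- Renaming the two summation indices moves the flip from one factor to the other; the diagonal
part is a scalar for each pair of summation indices. -/
theorem conv_swR (ν : FODC.Family) (q : ℂ) (B : M →ₗ[ℂ] N →ₗ[ℂ] P) (x : Quad M) (y : Quad N) :
    conv B (swR ν q x) y = conv B x (swL ν q y) := by
  ext i k j l
  simp only [conv, swR_apply, swL_apply, map_add, map_smul, LinearMap.add_apply,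
    LinearMap.smul_apply, Finset.sum_add_distrib]
  congr 1
  rw [Finset.sum_comm]
  simp only [rd_symm ν q]

theorem swL_conv (ν : FODC.Family) (q : ℂ) (B : M →ₗ[ℂ] N →ₗ[ℂ] P) (x : Quad M) (y : Quad N) :
    swL ν q (conv B x y) = conv B (swL ν q x) y := by
  ext i k j l
  simp only [conv, swL_apply, map_add, map_smul, LinearMap.add_apply,
    LinearMap.smul_apply, Finset.sum_add_distrib, Finset.smul_sum]

theorem swR_conv (ν : FODC.Family) (q : ℂ) (B : M →ₗ[ℂ] N →ₗ[ℂ] P) (x : Quad M) (y : Quad N) :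
    swR ν q (conv B x y) = conv B x (swR ν q y) := by
  ext i k j l
  simp only [conv, swR_apply, map_add, map_smul, Finset.sum_add_distrib, Finset.smul_sum]

theorem conv_add (B : M →ₗ[ℂ] N →ₗ[ℂ] P) (x : Quad M) (y y' : Quad N) :
    conv B x (y + y') = conv B x y + conv B x y' := by
  ext i k j l
  simp only [conv, Pi.add_apply, map_add, Finset.sum_add_distrib]

theorem conv_smul (B : M →ₗ[ℂ] N →ₗ[ℂ] P) (c : ℂ) (x : Quad M) (y : Quad N) :
    conv B x (c • y) = c • conv B x y := by
  ext i k j l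
  simp only [conv, Pi.smul_apply, map_smul, Finset.smul_sum]

theorem conv_add_left (B : M →ₗ[ℂ] N →ₗ[ℂ] P) (x x' : Quad M) (y : Quad N) :
    conv B (x + x') y = conv B x y + conv B x' y := by
  ext i k j l
  simp only [conv, Pi.add_apply, map_add, LinearMap.add_apply, Finset.sum_add_distrib]

theorem conv_smul_left (B : M →ₗ[ℂ] N →ₗ[ℂ] P) (c : ℂ) (x : Quad M) (y : Quad N) :
    conv B (c • x) y = c • conv B x y := by
  ext i k j l
  simp only [conv, Pi.smul_apply, map_smul, LinearMap.smul_apply, Finset.smul_sum]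

/-- The products of two entries of a matrix. -/
def prodQuad {R : Type*} [Mul R] (Z : Fin 3 → Fin 3 → R) : Quad R := fun i k j l => Z i j * Z k l

/-- The RTT form of the quantum matrix relations. Every later exchange of the braid matrix with a
contraction by ZZ rests on it. -/
theorem IsQMatrix.swL_prodQuad {R : Type*} [Ring R] [Algebra ℂ R] {q : ℂ}
    {Z : Fin 3 → Fin 3 → R} (h : IsQMatrix q Z) (hq : q ≠ 0) (ν : FODC.Family) :
    swL ν q (prodQuad Z) = swR ν q (prodQuad Z) := by
  have h2 : swL .second q (prodQuad Z) = swR .second q (prodQuad Z) := by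
    ext i k j l
    have := h.rtt hq k i j l
    simp only [swL_apply, swR_apply, prodQuad, rd, rl]
    simpa only [IsQMatrix.rc, IsQMatrix.lc, @eq_comm _ k i] using this
  cases ν
  · rw [swL_first_eq, swR_first_eq, h2]
  · exact h2

theorem IsQMatrix.of_swL_prodQuad {R : Type*} [Ring R] [Algebra ℂ R] {q : ℂ}
    {Z : Fin 3 → Fin 3 → R} (hq : q ≠ 0)
    (h : swL .second q (prodQuad Z) = swR .second q (prodQuad Z)) : IsQMatrix q Z := by
  refine IsQMatrix.of_rtt hq fun i k j l => ?_
  have := congrFun (congrFun (congrFun (congrFun h k) i) j) l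
  simp only [swL_apply, swR_apply, prodQuad, rd, rl] at this
  simpa only [IsQMatrix.rc, IsQMatrix.lc, @eq_comm _ k i] using this

end RMatrix

/-! ### Expansion in left-invariant forms -/

namespace FODC
section Forms
variable {K : QKind} {q : ℝ} (Γ : FODC.{0, v} (QFun K q))

open MulOpposite

/-- Left multiplication of one-forms as a bilinear map. -/
noncomputable def lmulForm : QFun K q →ₗ[ℂ] Γ.Form →ₗ[ℂ] Γ.Form :=
  (Algebra.lsmul ℂ ℂ Γ.Form).toLinearMap

@[simp] theorem lmulForm_apply (a : QFun K q) (ρ : Γ.Form) : Γ.lmulForm a ρ = a • ρ := rfl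

/-- The forms `(dzⁱⱼ) zᵏₗ`. -/
noncomputable def dzMulZ : Quad Γ.Form := fun i k j l =>
  op (QFun.z K q k l) • Γ.d (QFun.z K q i j)

/-- The forms `zⁱⱼ dzᵏₗ`. -/
noncomputable def zMulDz : Quad Γ.Form := fun i k j l => QFun.z K q i j • Γ.d (QFun.z K q k l)

/-- The forms `zⁱₐ zᵏᵦ Yᵃᵇⱼₗ`. -/
noncomputable def expand (Y : Quad Γ.Form) : Quad Γ.Form :=
  conv Γ.lmulForm (prodQuad (QFun.z K q)) Y

theorem expand_apply (Y : Quad Γ.Form) (i k j l : Fin 3) :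
    Γ.expand Y i k j l =
      ∑ a, ∑ b, (QFun.z K q i a * QFun.z K q k b) • Y a b j l := rfl

theorem swR_expand (ν : Family) (Y : Quad Γ.Form) :
    swR ν (q : ℂ) (Γ.expand Y) = Γ.expand (swR ν (q : ℂ) Y) := swR_conv _ _ _ _ _

theorem expand_add (Y Y' : Quad Γ.Form) : Γ.expand (Y + Y') = Γ.expand Y + Γ.expand Y' :=
  conv_add _ _ _ _

theorem expand_smul (c : ℂ) (Y : Quad Γ.Form) : Γ.expand (c • Y) = c • Γ.expand Y :=
  conv_smul _ _ _ _

variable [NeZero q]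

/-- On ZZ the row action is the column action, which the contraction hands over to the rows of `Y`.
Thus both braid operators act directly on left-invariant coefficients. -/
theorem swL_expand (ν : Family) (Y : Quad Γ.Form) :
    swL ν (q : ℂ) (Γ.expand Y) = Γ.expand (swL ν (q : ℂ) Y) := by
  rw [expand, swL_conv, (QFun.isQPoint K q).toIsQMatrix.swL_prodQuad (QFun.q_ne q), conv_swR]
  rfl

theorem sum_S_mul_z (i j : Fin 3) :
    ∑ k, QFun.S K q i k * QFun.z K q k j = if i = j then 1 else 0 :=
  (QFun.isQPoint K q).inv_mul (QFun.q_ne q) i j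

theorem sum_z_mul_S (i j : Fin 3) :
    ∑ k, QFun.z K q i k * QFun.S K q k j = if i = j then 1 else 0 :=
  (QFun.isQPoint K q).mul_inv (QFun.q_ne q) i j

theorem sum_S_smul_sum_z_smul (f : Fin 3 → Γ.Form) (a : Fin 3) :
    ∑ i, QFun.S K q a i • ∑ b, QFun.z K q i b • f b = f a := by
  simp only [Finset.smul_sum, smul_smul]
  rw [Finset.sum_comm]
  simp only [← Finset.sum_smul, sum_S_mul_z, ite_smul, one_smul, zero_smul,
    Finset.sum_ite_eq, Finset.mem_univ, if_true]

theorem sum_z_smul_sum_S_smul (f : Fin 3 → Γ.Form) (a : Fin 3) :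
    ∑ i, QFun.z K q a i • ∑ b, QFun.S K q i b • f b = f a := by
  simp only [Finset.smul_sum, smul_smul]
  rw [Finset.sum_comm]
  simp only [← Finset.sum_smul, sum_z_mul_S, ite_smul, one_smul, zero_smul,
    Finset.sum_ite_eq, Finset.mem_univ, if_true]

/-- S is the inverse matrix of Z: the inner sum cancels the left factor z, the outer sum the right
one. Identities between quadratic expressions therefore reduce to identities between left-invariant
forms. -/
theorem contract_expand (Y : Quad Γ.Form) (a b j l : Fin 3) :
    ∑ k, QFun.S K q b k • ∑ i, QFun.S K q a i • Γ.expand Y i k j l = Y a b j l := by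
  rw [← Γ.sum_S_smul_sum_z_smul (fun b => Y a b j l) b]
  refine Finset.sum_congr rfl fun k _ => ?_
  congr 1
  rw [← Γ.sum_S_smul_sum_z_smul (fun a => ∑ b, QFun.z K q k b • Y a b j l) a]
  refine Finset.sum_congr rfl fun i _ => ?_
  simp only [expand_apply, Finset.smul_sum, smul_smul]

theorem expand_injective : Function.Injective Γ.expand := fun Y Y' h => by
  ext a b j l
  rw [← Γ.contract_expand Y, h, Γ.contract_expand]

theorem theta_eq (i j : Fin 3) : Γ.theta i j = ∑ k, QFun.S K q i k • Γ.d (QFun.z K q k j) := by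
  simp only [theta, QFun.antipode_z]

theorem d_z (i j : Fin 3) : Γ.d (QFun.z K q i j) = ∑ k, QFun.z K q i k • Γ.theta k j := by
  simp only [theta_eq]
  exact (Γ.sum_z_smul_sum_S_smul (fun k => Γ.d (QFun.z K q k j)) i).symm

/-- The forms `zⁱⱼ zᵏₗ Tr_q θ`. -/
noncomputable def zzTr : Quad Γ.Form := fun i k j l =>
  (QFun.z K q i j * QFun.z K q k l) • Γ.trq

/-- The left-invariant forms in the expansion of `zⁱⱼ dzᵏₗ`. -/
noncomputable def invDz : Quad Γ.Form := fun a b j l => if a = j then Γ.theta b l else 0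

/-- The left-invariant forms in the expansion of `zⁱⱼ zᵏₗ Tr_q θ`. -/
noncomputable def invTr : Quad Γ.Form := fun a b j l =>
  if a = j then if b = l then Γ.trq else 0 else 0

theorem expand_invDz : Γ.expand Γ.invDz = Γ.zMulDz := by
  ext i k j l
  simp [expand_apply, invDz, zMulDz, d_z, Finset.smul_sum, smul_smul, smul_ite]

theorem expand_invTr : Γ.expand Γ.invTr = Γ.zzTr := by
  ext i k j l
  simp [expand_apply, invTr, zzTr, smul_ite]

/-- By the Leibniz rule the sum is d(ZZ), so this is the differential of the RTT relation. It holds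
in every calculus. -/
theorem swL_dzMulZ_add (ν : Family) :
    swL ν (q : ℂ) (Γ.dzMulZ + Γ.zMulDz) = swR ν (q : ℂ) (Γ.dzMulZ + Γ.zMulDz) := by
  have h : Γ.dzMulZ + Γ.zMulDz = fun i k j l => Γ.d (prodQuad (QFun.z K q) i k j l) := by
    ext i k j l
    simp only [Pi.add_apply, dzMulZ, zMulDz, prodQuad, Γ.leibniz]
  rw [h]
  ext i k j l
  have := congrFun (congrFun (congrFun (congrFun
    ((QFun.isQPoint K q).toIsQMatrix.swL_prodQuad (QFun.q_ne q) ν) i) k) j) l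
  have := congrArg Γ.d this
  simpa only [swL_apply, swR_apply, map_add, map_smul] using this

end Forms
end FODC

/-! ### The two families in braid matrix form -/

section GammaForm
variable {M N : Type*} [AddCommGroup M] [Module ℂ M] [AddCommGroup N] [Module ℂ N]

/-- The right-hand side of the commutation relations of both families, in braid matrix form. -/
noncomputable def gform (ν : FODC.Family) (q t g h : ℂ) (V W : Quad M) : Quad M :=
  (t - 1) • V + t • swL ν q (swR ν q V) + g • W + h • swR ν q W

/-- The denominator in the coefficients of the two families. -/
noncomputable def gden (ν : FODC.Family) (q t : ℂ) : ℂ :=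
  t * (match ν with | .first => q⁻¹ ^ 2 - 1 | .second => q ^ 6 - q ^ 4)
    + (t - 1) * (q ^ 4 + q ^ 2 + 1)

/-- Together with `hcoef` these are the coefficients of Tr_q θ that associativity forces in
`gform_coefficients`, and that the model produces in `modelFODC_braidRel`. -/
noncomputable def gcoef (ν : FODC.Family) (q t : ℂ) : ℂ := (t - 1) / gden ν q t * (1 - t)
noncomputable def hcoef (ν : FODC.Family) (q t : ℂ) : ℂ := -((t - 1) / gden ν q t * t * rmu ν q)

theorem swL_swL (ν : FODC.Family) {q : ℂ} (hq : q ≠ 0) (y : Quad M) :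
    swL ν q (swL ν q y) = y + rmu ν q • swL ν q y := by
  ext i k j l
  have := congrFun (congrFun (congrFun (congrFun
    (swR_swR ν hq (fun j l i k => y i k j l)) j) l) i) k
  simpa only [swL_apply, swR_apply, Pi.add_apply, Pi.smul_apply] using this

/-- Adding V to `gform` turns its first two terms into t (V + R_L R_R V). By the Hecke relation R_L
maps this to t (R_L V + R_R V + μ R_L R_R V), which is symmetric in left and right. The terms in W
are covered by `hW`. -/
theorem swL_gform (ν : FODC.Family) (q t g h : ℂ) (hq : q ≠ 0) (V W : Quad M)
    (hW : swL ν q W = swR ν q W) :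
    swL ν q (gform ν q t g h V W + V) = swR ν q (gform ν q t g h V W + V) := by
  simp only [gform, map_add, map_smul, swR_swR ν hq, swL_swL ν hq, swL_swR, hW]
  module

theorem admissible_iff (ν : FODC.Family) {q : ℂ} (hq : q ≠ 0) (t : ℂ) :
    FODC.Admissible q ν t ↔ t ≠ 0 ∧ gden ν q t ≠ 0 := by
  cases ν
  · have h : (q ^ 6 + q ^ 4 + 1) * t - (q ^ 6 + q ^ 4 + q ^ 2) = q ^ 2 * gden .first q t := by
      simp only [gden]; field_simp; ring
    simp only [FODC.Admissible, h]
    simp [hq]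
  · have h : (q ^ 6 + q ^ 2 + 1) * t - (q ^ 4 + q ^ 2 + 1) = gden .second q t := by
      simp only [gden]; ring
    simp only [FODC.Admissible, h]

end GammaForm

section
-- On equal column indices R_R multiplies W by q⁻¹, so the total coefficient of W there is g + h
-- q⁻¹. The two denominators differ by the factor q².
theorem sigma_eq {q t : ℂ} (hq : q ≠ 0) (h : gden .first q t ≠ 0) :
    FODC.sigma q t = gcoef .first q t + hcoef .first q t * q⁻¹ := by
  have e : q ^ 4 * (q ^ 2 + 1) * (t - 1) - q ^ 2 + t = q ^ 2 * gden .first q t := by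
    simp only [gden]; field_simp; ring
  simp only [FODC.sigma, gcoef, hcoef, e, rmu]
  field_simp
  ring

theorem beta_eq {q t : ℂ} (hq : q ≠ 0) (h : gden .first q t ≠ 0) :
    FODC.beta q t = hcoef .first q t * q⁻¹ := by
  have e : q ^ 4 * (q ^ 2 + 1) * (t - 1) - q ^ 2 + t = q ^ 2 * gden .first q t := by
    simp only [gden]; field_simp; ring
  simp only [FODC.beta, hcoef, e, rmu]
  field_simp
  ring

theorem sigmaHat_eq {q t : ℂ} (hq : q ≠ 0) (h : gden .second q t ≠ 0) :
    FODC.sigmaHat q t = gcoef .second q t + hcoef .second q t * q := by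
  have e : q ^ 4 * (q ^ 2 * t - 1) + (q ^ 2 + 1) * (t - 1) = gden .second q t := by
    simp only [gden]; ring
  simp only [FODC.sigmaHat, gcoef, hcoef, e, rmu]
  field_simp
  ring

theorem betaHat_eq {q t : ℂ} (hq : q ≠ 0) (h : gden .second q t ≠ 0) :
    FODC.betaHat q t = hcoef .second q t * q := by
  have e : q ^ 4 * (q ^ 2 * t - 1) + (q ^ 2 + 1) * (t - 1) = gden .second q t := by
    simp only [gden]; ring
  simp only [FODC.betaHat, hcoef, e, rmu]
  field_simp
end

section
variable {M : Type*} [AddCommGroup M] [Module ℂ M] {q t : ℂ} {V W : Quad M}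

/-- The entries of `gform`, case by case, are the relations of the theorem. In a row, the flipped
term of W is brought back to the given order by the q-commutation of the generators. -/
theorem gform_first_same (hq : q ≠ 0) (h : gden .first q t ≠ 0) (i j : Fin 3) :
    gform .first q t (gcoef .first q t) (hcoef .first q t) V W i i j j =
      (t / q ^ 2 + t - 1) • V i i j j + FODC.sigma q t • W i i j j := by
  rw [sigma_eq hq h]
  simp only [gform, Pi.add_apply, Pi.smul_apply, swL_apply, swR_apply, rl_self, rd, if_true]
  match_scalars <;> field_simp <;> ring

theorem gform_first_row (hq : q ≠ 0) (h : gden .first q t ≠ 0) (i : Fin 3) {j l : Fin 3}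
    (hjl : j < l) (hW : W i i l j = q⁻¹ • W i i j l) :
    gform .first q t (gcoef .first q t) (hcoef .first q t) V W i i j l =
      (t / q) • V i i l j + (t - 1) • V i i j l + FODC.sigma q t • W i i j l := by
  rw [sigma_eq hq h]
  simp only [gform, Pi.add_apply, Pi.smul_apply, swL_apply, swR_apply, rl, rd, if_true, hW,
    hjl.ne, hjl.not_gt, if_false, lt_irrefl]
  match_scalars <;> field_simp <;> ring

theorem gform_first_col (hq : q ≠ 0) (h : gden .first q t ≠ 0) (j : Fin 3) {i k : Fin 3}
    (hik : i < k) :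
    gform .first q t (gcoef .first q t) (hcoef .first q t) V W i k j j =
      (t / q) • V k i j j + (t - 1) • V i k j j + FODC.sigma q t • W i k j j := by
  rw [sigma_eq hq h]
  simp only [gform, Pi.add_apply, Pi.smul_apply, swL_apply, swR_apply, rl, rd, if_true,
    hik.ne, hik.not_gt, if_false, lt_irrefl]
  match_scalars <;> field_simp <;> ring

theorem gform_first_down (hq : q ≠ 0) (h : gden .first q t ≠ 0) {i k j l : Fin 3}
    (hik : i < k) (hjl : j < l) :
    gform .first q t (gcoef .first q t) (hcoef .first q t) V W i k j l =
      t • V k i l j + (t - 1) • V i k j l + FODC.sigma q t • W i k j l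
        - FODC.beta q t • (W i k j l - q • W i k l j) := by
  rw [sigma_eq hq h, beta_eq hq h]
  simp only [gform, Pi.add_apply, Pi.smul_apply, swL_apply, swR_apply, rl, rd, if_true,
    hik.ne, hik.not_gt, hjl.ne, hjl.not_gt, if_false]
  match_scalars <;> field_simp <;> ring

theorem gform_first_up (hq : q ≠ 0) (h : gden .first q t ≠ 0) {i k j l : Fin 3}
    (hik : i < k) (hjl : l < j) :
    gform .first q t (gcoef .first q t) (hcoef .first q t) V W i k j l =
      t • V k i l j + (t - 1) • V i k j l + FODC.sigma q t • W i k j l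
        - (t * (q - q⁻¹)) • V k i j l
        + (q * FODC.beta q t) • (W i k l j - q • W i k j l) := by
  rw [sigma_eq hq h, beta_eq hq h]
  simp only [gform, Pi.add_apply, Pi.smul_apply, swL_apply, swR_apply, rl, rd, if_true,
    hik.ne, hik.not_gt, hjl.ne', hjl, if_false]
  match_scalars <;> field_simp <;> ring

theorem gform_second_same (hq : q ≠ 0) (h : gden .second q t ≠ 0) (i j : Fin 3) :
    gform .second q t (gcoef .second q t) (hcoef .second q t) V W i i j j =
      (t * q ^ 2 + t - 1) • V i i j j + FODC.sigmaHat q t • W i i j j := by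
  rw [sigmaHat_eq hq h]
  simp only [gform, Pi.add_apply, Pi.smul_apply, swL_apply, swR_apply, rl_self, rd, if_true]
  match_scalars <;> ring

theorem gform_second_row (hq : q ≠ 0) (h : gden .second q t ≠ 0) (i : Fin 3) {j l : Fin 3}
    (hjl : j < l) (hW : W i i l j = q⁻¹ • W i i j l) :
    gform .second q t (gcoef .second q t) (hcoef .second q t) V W i i j l =
      (t * q) • V i i l j + (t * q ^ 2 - 1) • V i i j l + FODC.sigmaHat q t • W i i j l := by
  rw [sigmaHat_eq hq h]
  simp only [gform, Pi.add_apply, Pi.smul_apply, swL_apply, swR_apply, rl, rd, if_true, hW,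
    hjl.ne, hjl, if_false, lt_irrefl]
  match_scalars <;> field_simp <;> ring

theorem gform_second_col (hq : q ≠ 0) (h : gden .second q t ≠ 0) (j : Fin 3) {i k : Fin 3}
    (hik : i < k) (hW : W k i j j = q⁻¹ • W i k j j) :
    gform .second q t (gcoef .second q t) (hcoef .second q t) V W i k j j =
      (t * q) • V k i j j + (t * q ^ 2 - 1) • V i k j j + FODC.sigmaHat q t • W i k j j := by
  rw [sigmaHat_eq hq h]
  simp only [gform, Pi.add_apply, Pi.smul_apply, swL_apply, swR_apply, rl, rd, if_true,
    hik.ne, hik, if_false, lt_irrefl]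
  match_scalars <;> field_simp <;> ring

theorem gform_second_down (hq : q ≠ 0) (h : gden .second q t ≠ 0) {i k j l : Fin 3}
    (hik : i < k) (hjl : j < l) :
    gform .second q t (gcoef .second q t) (hcoef .second q t) V W i k j l =
      t • V k i l j + (t - 1) • V i k j l + FODC.sigmaHat q t • W i k j l
        + (t * (q - q⁻¹)) • (V i k l j + V k i j l) + (t * (q - q⁻¹) ^ 2) • V i k j l
        - (FODC.betaHat q t / q ^ 2) • (W i k j l - q • W i k l j) := by
  rw [sigmaHat_eq hq h, betaHat_eq hq h]
  simp only [gform, Pi.add_apply, Pi.smul_apply, swL_apply, swR_apply, rl, rd, if_true,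
    hik.ne, hik, hjl.ne, hjl, if_false]
  match_scalars <;> field_simp <;> ring

theorem gform_second_up (hq : q ≠ 0) (h : gden .second q t ≠ 0) {i k j l : Fin 3}
    (hik : i < k) (hjl : l < j) :
    gform .second q t (gcoef .second q t) (hcoef .second q t) V W i k j l =
      t • V k i l j + (t - 1) • V i k j l + FODC.sigmaHat q t • W i k j l
        + (t * (q - q⁻¹)) • V i k l j
        + (FODC.betaHat q t / q) • (W i k l j - q • W i k j l) := by
  rw [sigmaHat_eq hq h, betaHat_eq hq h]
  simp only [gform, Pi.add_apply, Pi.smul_apply, swL_apply, swR_apply, rl, rd, if_true,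
    hik.ne, hik, hjl.ne', hjl.not_gt, if_false]
  match_scalars <;> field_simp <;> ring

end

/-! ### Equivalence of the listed relations with the braid form -/

namespace FODC
section Forms
variable {K : QKind} {q : ℝ} (Γ : FODC.{0, v} (QFun K q)) [NeZero q]

open MulOpposite

/-- The braid matrix form of the commutation relations of the family `ν` with parameter `t`. -/
def BraidRel (ν : Family) (t : ℂ) : Prop :=
  Γ.dzMulZ = gform ν (q : ℂ) t (gcoef ν q t) (hcoef ν q t) Γ.zMulDz Γ.zzTr

theorem swL_zzTr (ν : Family) : swL ν (q : ℂ) Γ.zzTr = swR ν (q : ℂ) Γ.zzTr := by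
  ext i k j l
  have := congrFun (congrFun (congrFun (congrFun
    ((QFun.isQPoint K q).toIsQMatrix.swL_prodQuad (QFun.q_ne q) ν) i) k) j) l
  have := congrArg (fun a : QFun K q => a • Γ.trq) this
  simpa only [swL_apply, swR_apply, add_smul, smul_assoc, prodQuad, zzTr] using this

/-- The theorem lists relations for ordered index pairs only. The others follow because both sides,
increased by z dz, are fixed alike by R_L and R_R: their difference X satisfies R_L X = R_R X, and
at an ordered pair this equation expresses a flipped entry of X through entries already known to
vanish. -/
theorem braidRel_of_ordered (ν : Family) (t : ℂ)
    (h1 : ∀ i j l, j ≤ l → Γ.dzMulZ i i j l =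
      gform ν (q : ℂ) t (gcoef ν q t) (hcoef ν q t) Γ.zMulDz Γ.zzTr i i j l)
    (h2 : ∀ i k j l, i < k → Γ.dzMulZ i k j l =
      gform ν (q : ℂ) t (gcoef ν q t) (hcoef ν q t) Γ.zMulDz Γ.zzTr i k j l) :
    Γ.BraidRel ν t := by
  set G := gform ν (q : ℂ) t (gcoef ν q t) (hcoef ν q t) Γ.zMulDz Γ.zzTr with hG
  have key : swL ν (q : ℂ) (Γ.dzMulZ - G) = swR ν (q : ℂ) (Γ.dzMulZ - G) := by
    have e : Γ.dzMulZ - G = (Γ.dzMulZ + Γ.zMulDz) - (G + Γ.zMulDz) := by abel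
    rw [e, map_sub, map_sub, Γ.swL_dzMulZ_add, hG,
      swL_gform ν _ t _ _ (QFun.q_ne q) _ _ (Γ.swL_zzTr ν)]
  have h3 : ∀ i k j l, i < k → (Γ.dzMulZ - G) i k j l = 0 := fun i k j l h =>
    sub_eq_zero.2 (h2 i k j l h)
  have h4 : ∀ i j l, (Γ.dzMulZ - G) i i j l = 0 := by
    intro i j l
    rcases le_or_gt j l with h | h
    · exact sub_eq_zero.2 (h1 i j l h)
    · have := congrFun (congrFun (congrFun (congrFun key i) i) l) j
      have e : (Γ.dzMulZ - G) i i l j = 0 := sub_eq_zero.2 (h1 i l j h.le)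
      simp only [swL_apply, swR_apply, e, rl_self, rd_of_ne ν (q : ℂ) h.ne, smul_zero, add_zero,
        one_smul] at this
      exact this.symm
  refine sub_eq_zero.1 ?_
  ext i k j l
  rcases lt_trichotomy i k with h | rfl | h
  · exact h3 i k j l h
  · exact h4 i j l
  · have := congrFun (congrFun (congrFun (congrFun key k) i) j) l
    simp only [swL_apply, swR_apply, h3 k i _ _ h, rd_of_ne ν (q : ℂ) h.ne, smul_zero,
      add_zero, one_smul] at this
    exact this

theorem sub_smul_smul (a b : QFun K q) (c : ℂ) (ρ : Γ.Form) :
    (a - c • b) • ρ = a • ρ - c • b • ρ := by rw [sub_smul, smul_assoc]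

theorem zzTr_row (i : Fin 3) {j l : Fin 3} (h : j < l) :
    Γ.zzTr i i l j = (q : ℂ)⁻¹ • Γ.zzTr i i j l := by
  simp only [zzTr, (QFun.isQPoint K q).row' (QFun.q_ne q) i j l h, smul_assoc]

theorem braidRel_first_iff {t : ℂ} (hd : gden .first (q : ℂ) t ≠ 0) :
    Γ.BraidRel .first t ↔ Γ.RelFirst t := by
  have hq := QFun.q_ne q
  constructor
  · intro h
    have h' := fun i k j l => congrFun (congrFun (congrFun (congrFun h i) k) j) l
    refine ⟨fun i j => ?_, fun i j l hjl => ?_, fun i j k hik => ?_, fun i j k l hik hjl => ?_,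
      fun i j k l hik hjl => ?_⟩
    · exact (h' i i j j).trans (gform_first_same (V := Γ.zMulDz) (W := Γ.zzTr) hq hd i j)
    · exact (h' i i j l).trans (gform_first_row (V := Γ.zMulDz) (W := Γ.zzTr) hq hd i hjl (Γ.zzTr_row i hjl))
    · exact (h' i k j j).trans (gform_first_col (V := Γ.zMulDz) (W := Γ.zzTr) hq hd j hik)
    · simp only [Γ.sub_smul_smul]
      exact (h' i k j l).trans (gform_first_down (V := Γ.zMulDz) (W := Γ.zzTr) hq hd hik hjl)
    · simp only [Γ.sub_smul_smul]
      exact (h' i k j l).trans (gform_first_up (V := Γ.zMulDz) (W := Γ.zzTr) hq hd hik hjl)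
  · intro h
    refine Γ.braidRel_of_ordered _ _ (fun i j l hjl => ?_) (fun i k j l hik => ?_)
    · rcases hjl.eq_or_lt with rfl | hjl
      · exact (h.same i j).trans (gform_first_same (V := Γ.zMulDz) (W := Γ.zzTr) hq hd i j).symm
      · exact (h.row i j l hjl).trans (gform_first_row (V := Γ.zMulDz) (W := Γ.zzTr) hq hd i hjl (Γ.zzTr_row i hjl)).symm
    · rcases lt_trichotomy j l with hjl | rfl | hjl
      · have := h.down i j k l hik hjl
        simp only [Γ.sub_smul_smul] at this
        exact this.trans (gform_first_down (V := Γ.zMulDz) (W := Γ.zzTr) hq hd hik hjl).symm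
      · exact (h.col i j k hik).trans (gform_first_col (V := Γ.zMulDz) (W := Γ.zzTr) hq hd j hik).symm
      · have := h.up i j k l hik hjl
        simp only [Γ.sub_smul_smul] at this
        exact this.trans (gform_first_up (V := Γ.zMulDz) (W := Γ.zzTr) hq hd hik hjl).symm

theorem zzTr_col (j : Fin 3) {i k : Fin 3} (h : i < k) :
    Γ.zzTr k i j j = (q : ℂ)⁻¹ • Γ.zzTr i k j j := by
  simp only [zzTr, (QFun.isQPoint K q).col' (QFun.q_ne q) i j k h, smul_assoc]

theorem braidRel_second_iff {t : ℂ} (hd : gden .second (q : ℂ) t ≠ 0) :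
    Γ.BraidRel .second t ↔ Γ.RelSecond t := by
  have hq := QFun.q_ne q
  constructor
  · intro h
    have h' := fun i k j l => congrFun (congrFun (congrFun (congrFun h i) k) j) l
    refine ⟨fun i j => ?_, fun i j l hjl => ?_, fun i j k hik => ?_, fun i j k l hik hjl => ?_,
      fun i j k l hik hjl => ?_⟩
    · exact (h' i i j j).trans (gform_second_same (V := Γ.zMulDz) (W := Γ.zzTr) hq hd i j)
    · exact (h' i i j l).trans (gform_second_row (V := Γ.zMulDz) (W := Γ.zzTr) hq hd i hjl (Γ.zzTr_row i hjl))
    · exact (h' i k j j).trans (gform_second_col (V := Γ.zMulDz) (W := Γ.zzTr) hq hd j hik (Γ.zzTr_col j hik))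
    · simp only [Γ.sub_smul_smul]
      exact (h' i k j l).trans (gform_second_down (V := Γ.zMulDz) (W := Γ.zzTr) hq hd hik hjl)
    · simp only [Γ.sub_smul_smul]
      exact (h' i k j l).trans (gform_second_up (V := Γ.zMulDz) (W := Γ.zzTr) hq hd hik hjl)
  · intro h
    refine Γ.braidRel_of_ordered _ _ (fun i j l hjl => ?_) (fun i k j l hik => ?_)
    · rcases hjl.eq_or_lt with rfl | hjl
      · exact (h.same i j).trans (gform_second_same (V := Γ.zMulDz) (W := Γ.zzTr) hq hd i j).symm
      · exact (h.row i j l hjl).trans (gform_second_row (V := Γ.zMulDz) (W := Γ.zzTr) hq hd i hjl (Γ.zzTr_row i hjl)).symm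
    · rcases lt_trichotomy j l with hjl | rfl | hjl
      · have := h.down i j k l hik hjl
        simp only [Γ.sub_smul_smul] at this
        exact this.trans (gform_second_down (V := Γ.zMulDz) (W := Γ.zzTr) hq hd hik hjl).symm
      · exact (h.col i j k hik).trans (gform_second_col (V := Γ.zMulDz) (W := Γ.zzTr) hq hd j hik (Γ.zzTr_col j hik)).symm
      · have := h.up i j k l hik hjl
        simp only [Γ.sub_smul_smul] at this
        exact this.trans (gform_second_up (V := Γ.zMulDz) (W := Γ.zzTr) hq hd hik hjl).symm

theorem isGamma_iff (ν : Family) (t : ℂ) :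
    Γ.IsGamma ν t ↔ t ≠ 0 ∧ gden ν (q : ℂ) t ≠ 0 ∧ Γ.IsDzBasis ∧ Γ.BraidRel ν t := by
  have ha := admissible_iff ν (QFun.q_ne q) t
  cases ν
  · simp only [IsGamma, ha]
    constructor
    · rintro ⟨⟨h1, h2⟩, h3, h4⟩
      exact ⟨h1, h2, h3, (Γ.braidRel_first_iff h2).2 h4⟩
    · rintro ⟨h1, h2, h3, h4⟩
      exact ⟨⟨h1, h2⟩, h3, (Γ.braidRel_first_iff h2).1 h4⟩
  · simp only [IsGamma, ha]
    constructor
    · rintro ⟨⟨h1, h2⟩, h3, h4⟩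
      exact ⟨h1, h2, h3, (Γ.braidRel_second_iff h2).2 h4⟩
    · rintro ⟨h1, h2, h3, h4⟩
      exact ⟨⟨h1, h2⟩, h3, (Γ.braidRel_second_iff h2).1 h4⟩

end Forms
end FODC

/-! ### Extension of bimodule maps from the generators -/

namespace QFun
variable {K : QKind} {q : ℝ}

theorem mem_of_z_mem (A : Subalgebra ℂ (QFun K q)) (hz : ∀ i j, z K q i j ∈ A)
    (hE : detInv K q ∈ A) (a : QFun K q) : a ∈ A := by
  induction a using induction with
  | hc c => exact A.algebraMap_mem c
  | hz i j => exact hz i j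
  | hE => exact hE
  | hmul a b ha hb => exact A.mul_mem ha hb
  | hadd a b ha hb => exact A.add_mem ha hb

theorem qdet_mem (A : Subalgebra ℂ (QFun K q)) (hz : ∀ i j, z K q i j ∈ A) :
    qdet (q : ℂ) (z K q) ∈ A := by
  have h3 : ∀ i j k l m n, z K q i j * z K q k l * z K q m n ∈ A := fun i j k l m n =>
    A.mul_mem (A.mul_mem (hz _ _) (hz _ _)) (hz _ _)
  unfold qdet
  refine A.sub_mem (A.sub_mem (A.sub_mem (A.add_mem (A.add_mem ?_ ?_) ?_) ?_) ?_) ?_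
  · exact h3 _ _ _ _ _ _
  all_goals exact A.smul_mem (h3 _ _ _ _ _ _) _

end QFun

namespace FODC
open MulOpposite
section Extension
variable {K : QKind} {q : ℝ} {Γ : FODC.{0, v} (QFun K q)}

/-- The basis `dzⁱⱼ`. -/
noncomputable def IsDzBasis.basis (h : Γ.IsDzBasis) :
    Module.Basis (Fin 3 × Fin 3) (QFun K q) Γ.Form := Module.Basis.mk h.1 h.2.ge

theorem IsDzBasis.basis_apply (h : Γ.IsDzBasis) (i j : Fin 3) :
    h.basis (i, j) = Γ.d (QFun.z K q i j) := by simp [basis]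

theorem op_algebraMap_smul {H : Type u} [Ring H] [Algebra ℂ H] (Γ : FODC.{u, v} H) (c : ℂ)
    (ρ : Γ.Form) : op (algebraMap ℂ H c) • ρ = c • ρ := by
  rw [← MulOpposite.algebraMap_apply, algebraMap_smul]

/-- A bimodule map out of a calculus with basis `dzⁱⱼ` that extends a given derivation exists as soon
as it is compatible with the commutation relations between differentials and generators. -/
theorem IsDzBasis.exists_extension (hΓ : Γ.IsDzBasis) {N : Type*} [AddCommGroup N]
    (L R : QFun K q →+ N →+ N) (δ : QFun K q →+ N)
    (hL : ∀ a b n, L (a * b) n = L a (L b n)) (hL1 : ∀ n, L 1 n = n)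
    (hR : ∀ a b n, R (a * b) n = R b (R a n)) (hR1 : ∀ n, R 1 n = n)
    (hLR : ∀ a b n, L a (R b n) = R b (L a n))
    (hc : ∀ (c : ℂ) n, L (algebraMap ℂ _ c) n = R (algebraMap ℂ _ c) n)
    (hδ : ∀ a b, δ (a * b) = R b (δ a) + L a (δ b)) (hδc : ∀ c : ℂ, δ (algebraMap ℂ _ c) = 0)
    (hrel : ∀ φ : Γ.Form →+ N, (∀ a ρ, φ (a • ρ) = L a (φ ρ)) →
      (∀ i j, φ (Γ.d (QFun.z K q i j)) = δ (QFun.z K q i j)) →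
      ∀ i j k l, φ (op (QFun.z K q k l) • Γ.d (QFun.z K q i j)) =
        R (QFun.z K q k l) (δ (QFun.z K q i j))) :
    ∃ φ : Γ.Form →+ N, (∀ a ρ, φ (a • ρ) = L a (φ ρ)) ∧
      (∀ a ρ, φ (op a • ρ) = R a (φ ρ)) ∧ ∀ a, φ (Γ.d a) = δ a := by
  let φ : Γ.Form →+ N :=
    { toFun := fun ρ => ∑ p : Fin 3 × Fin 3, L (hΓ.basis.repr ρ p) (δ (QFun.z K q p.1 p.2))
      map_zero' := by simp
      map_add' := by intro ρ ρ'; simp [Finset.sum_add_distrib] }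
  have hφL : ∀ a ρ, φ (a • ρ) = L a (φ ρ) := by
    intro a ρ
    simp only [φ, AddMonoidHom.coe_mk, ZeroHom.coe_mk, map_smul, Finsupp.smul_apply, smul_eq_mul,
      hL, map_sum]
  have hφz : ∀ i j, φ (Γ.d (QFun.z K q i j)) = δ (QFun.z K q i j) := by
    intro i j
    simp only [φ, AddMonoidHom.coe_mk, ZeroHom.coe_mk, ← hΓ.basis_apply,
      Module.Basis.repr_self]
    rw [Finset.sum_eq_single (i, j)]
    · simp [hL1]
    · intro p _ hp
      rw [Finsupp.single_eq_of_ne hp]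
      simp
    · simp
  have hzz := hrel φ hφL hφz
  -- The left and right actions commute in Γ and in the target, so right multiplication by a
  -- generator need only be compared on the basis dz.
  have hφRz : ∀ i j ρ, φ (op (QFun.z K q i j) • ρ) = R (QFun.z K q i j) (φ ρ) := by
    intro k l ρ
    rw [← hΓ.basis.sum_repr ρ]
    simp only [Finset.smul_sum, map_sum, ← smul_comm _ (op (QFun.z K q k l)), hφL]
    refine Finset.sum_congr rfl fun p _ => ?_
    rw [← Prod.mk.eta (p := p), hΓ.basis_apply, hzz, hφz, hLR]
  let A : Subalgebra ℂ (QFun K q) :=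
    { carrier := {a | ∀ ρ, φ (op a • ρ) = R a (φ ρ)}
      mul_mem' := by
        intro a b ha hb ρ
        rw [op_mul, mul_smul, hb, ha, hR]
      add_mem' := by
        intro a b ha hb ρ
        rw [op_add, add_smul, map_add, ha, hb, map_add, AddMonoidHom.add_apply]
      algebraMap_mem' := by
        intro c ρ
        rw [op_algebraMap_smul, ← algebraMap_smul (QFun K q), hφL, hc] }
  -- For 𝒟⁻¹: `φ` already intertwines right multiplication by 𝒟, which is invertible in source and
  -- target.
  have hA : ∀ a, a ∈ A := by
    refine QFun.mem_of_z_mem A (fun i j => hφRz i j) fun ρ => ?_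
    have hD := QFun.qdet_mem A (fun i j => hφRz i j) (op (QFun.detInv K q) • ρ)
    rw [smul_smul, ← op_mul, (QFun.isQPoint K q).mul_qdet, op_one, one_smul] at hD
    rw [hD, ← hR, (QFun.isQPoint K q).qdet_mul, hR1]
  let B : Subalgebra ℂ (QFun K q) :=
    { carrier := {a | φ (Γ.d a) = δ a}
      mul_mem' := by
        intro a b ha hb
        simp only [Set.mem_setOf_eq] at *
        rw [Γ.leibniz, map_add, hA, hφL, ha, hb, hδ]
      add_mem' := by
        intro a b ha hb
        simp only [Set.mem_setOf_eq] at *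
        rw [map_add, map_add, ha, hb, map_add]
      algebraMap_mem' := by
        intro c
        have h1 : Γ.d 1 = 0 := by
          have := Γ.leibniz 1 1
          simpa using this
        simp only [Set.mem_setOf_eq]
        rw [hδc, Algebra.algebraMap_eq_smul_one, map_smul, h1, smul_zero, map_zero] }
  refine ⟨φ, hφL, hA, fun a => QFun.mem_of_z_mem B (fun i j => hφz i j) ?_ a⟩
  have hD : φ (Γ.d (qdet (q : ℂ) (QFun.z K q))) = _ := QFun.qdet_mem B (fun i j => hφz i j)
  set D := qdet (q : ℂ) (QFun.z K q)
  set E := QFun.detInv K q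
  have h1 : E * D = 1 := (QFun.isQPoint K q).mul_qdet
  have e1 : φ (Γ.d 1) = δ 1 := B.one_mem
  have e0 : δ 1 = 0 := by simpa using hδc 1
  -- The Leibniz rule for 𝒟⁻¹𝒟 = 1 gives φ(d𝒟⁻¹)𝒟 and δ(𝒟⁻¹)𝒟 by the same formula; the factor 𝒟 is
  -- then cancelled.
  have e2 : R D (φ (Γ.d E)) = - L E (δ D) := by
    rw [e0, ← h1, Γ.leibniz, map_add, hA, hφL, hD] at e1
    exact eq_neg_of_add_eq_zero_left e1
  have e3 : R D (δ E) = - L E (δ D) := by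
    rw [← h1, hδ] at e0
    exact eq_neg_of_add_eq_zero_left e0
  have h2 : D * E = 1 := (QFun.isQPoint K q).qdet_mul
  change φ (Γ.d E) = δ E
  rw [← hR1 (φ (Γ.d E)), ← h2, hR, e2, ← e3, ← hR, h2, hR1]

end Extension
end FODC

/-! ### Bicovariance from the commutation relations -/

section TensorActions
variable {H M N : Type*} [Ring H] [Algebra ℂ H] [AddCommGroup M] [Module ℂ M]
  [AddCommGroup N] [Module ℂ N]

theorem map₂_mul_apply {f : H →ₗ[ℂ] M →ₗ[ℂ] M} {g : H →ₗ[ℂ] N →ₗ[ℂ] N}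
    (hf : ∀ a b m, f (a * b) m = f a (f b m)) (hg : ∀ a b n, g (a * b) n = g a (g b n))
    (x y : H ⊗[ℂ] H) (n : M ⊗[ℂ] N) :
    TensorProduct.map₂ f g (x * y) n = TensorProduct.map₂ f g x (TensorProduct.map₂ f g y n) := by
  induction x with
  | zero => simp
  | add x x' hx hx' => rw [add_mul, map_add, map_add, LinearMap.add_apply, hx, hx']; rfl
  | tmul a b =>
    induction y with
    | zero => simp
    | add x x' hx hx' =>
      rw [mul_add, map_add, map_add, LinearMap.add_apply, hx, hx', LinearMap.add_apply, map_add]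
    | tmul c d =>
      induction n with
      | zero => simp
      | add x x' hx hx' => simp only [map_add, hx, hx']
      | tmul m n =>
        simp only [Algebra.TensorProduct.tmul_mul_tmul, TensorProduct.map₂_apply_tmul,
          TensorProduct.map_tmul, hf, hg]

theorem map₂_mul_apply' {f : H →ₗ[ℂ] M →ₗ[ℂ] M} {g : H →ₗ[ℂ] N →ₗ[ℂ] N}
    (hf : ∀ a b m, f (a * b) m = f b (f a m)) (hg : ∀ a b n, g (a * b) n = g b (g a n))
    (x y : H ⊗[ℂ] H) (n : M ⊗[ℂ] N) :
    TensorProduct.map₂ f g (x * y) n = TensorProduct.map₂ f g y (TensorProduct.map₂ f g x n) := by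
  induction x with
  | zero => simp
  | add x x' hx hx' =>
    rw [add_mul, map_add, map_add, LinearMap.add_apply, hx, hx', LinearMap.add_apply, map_add]
  | tmul a b =>
    induction y with
    | zero => simp
    | add x x' hx hx' => rw [mul_add, map_add, map_add, LinearMap.add_apply, hx, hx']; rfl
    | tmul c d =>
      induction n with
      | zero => simp
      | add x x' hx hx' => simp only [map_add, hx, hx']
      | tmul m n =>
        simp only [Algebra.TensorProduct.tmul_mul_tmul, TensorProduct.map₂_apply_tmul,
          TensorProduct.map_tmul, hf, hg]

theorem map₂_comm_apply {f f' : H →ₗ[ℂ] M →ₗ[ℂ] M} {g g' : H →ₗ[ℂ] N →ₗ[ℂ] N}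
    (hf : ∀ a b m, f a (f' b m) = f' b (f a m)) (hg : ∀ a b n, g a (g' b n) = g' b (g a n))
    (x y : H ⊗[ℂ] H) (n : M ⊗[ℂ] N) :
    TensorProduct.map₂ f g x (TensorProduct.map₂ f' g' y n) =
      TensorProduct.map₂ f' g' y (TensorProduct.map₂ f g x n) := by
  induction x with
  | zero => simp
  | add x x' hx hx' => simp only [map_add, LinearMap.add_apply, hx, hx']
  | tmul a b =>
    induction y with
    | zero => simp
    | add x x' hx hx' => simp only [map_add, LinearMap.add_apply, hx, hx']
    | tmul c d =>
      induction n with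
      | zero => simp
      | add x x' hx hx' => simp only [map_add, hx, hx']
      | tmul m n =>
        simp only [TensorProduct.map₂_apply_tmul, TensorProduct.map_tmul, hf, hg]

theorem map₂_one_apply {f : H →ₗ[ℂ] M →ₗ[ℂ] M} {g : H →ₗ[ℂ] N →ₗ[ℂ] N}
    (hf : ∀ m, f 1 m = m) (hg : ∀ n, g 1 n = n) (n : M ⊗[ℂ] N) :
    TensorProduct.map₂ f g 1 n = n := by
  induction n with
  | zero => simp
  | add x x' hx hx' => rw [map_add, hx, hx']
  | tmul m n =>
    rw [Algebra.TensorProduct.one_def, TensorProduct.map₂_apply_tmul, TensorProduct.map_tmul, hf,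
      hg]

/-- A bilinear action as a biadditive one. -/
def LinearMap.toBiadditive (f : H →ₗ[ℂ] N →ₗ[ℂ] N) : H →+ N →+ N where
  toFun a := (f a).toAddMonoidHom
  map_zero' := by ext; simp
  map_add' a b := by ext; simp

@[simp] theorem LinearMap.toBiadditive_apply (f : H →ₗ[ℂ] N →ₗ[ℂ] N) (a : H) (n : N) :
    f.toBiadditive a n = f a n := rfl

theorem map_gform_apply {P : Type*} [AddCommGroup P] [Module ℂ P] (φ : N →ₗ[ℂ] P)
    (ν : FODC.Family) (q t g h : ℂ) (V W : Quad N) (i k j l : Fin 3) :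
    φ (gform ν q t g h V W i k j l) =
      gform ν q t g h (fun i k j l => φ (V i k j l)) (fun i k j l => φ (W i k j l)) i k j l := by
  simp only [gform, Pi.add_apply, Pi.smul_apply, swL_apply, swR_apply, map_add, map_smul]

end TensorActions

-- The contraction runs over the outer indices, opposite to the one in S(Z)Z = 1, and the weights of
-- Tr_q compensate for this. Up to 𝒟⁻¹ it is the reason why Tr_q θ is invariant under the right
-- coaction. The check brings all monomials into normal order.
set_option maxHeartbeats 1000000 in
theorem IsQMatrix.sum_weight_qadj_mul {R : Type*} [Ring R] [Algebra ℂ R] {q : ℂ}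
    {Z : Fin 3 → Fin 3 → R} (h : IsQMatrix q Z) (hq : q ≠ 0) (k l : Fin 3) :
    q ^ 4 • (qadj q Z 0 k * Z l 0) + q ^ 2 • (qadj q Z 1 k * Z l 1) + qadj q Z 2 k * Z l 2 =
      if k = l then (![q ^ 4, q ^ 2, 1] : Fin 3 → ℂ) k • qdet q Z else 0 := by
  fin_cases k <;> fin_cases l <;>
  simp [qadj, qdet, mul_add, mul_sub, add_mul, sub_mul, mul_assoc,
    h.row' hq, h.col' hq, h.anti', h.cross', h.row'' hq, h.col'' hq, h.anti'', h.cross'',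
    smul_smul, smul_sub, smul_add] <;> match_scalars <;> field_simp <;> ring

namespace FODC
open MulOpposite
section Bicovariance
variable {K : QKind} {q : ℝ} (Γ : FODC.{0, v} (QFun K q))

/-- Right multiplication of one-forms as a bilinear map. -/
noncomputable def rmulForm : QFun K q →ₗ[ℂ] Γ.Form →ₗ[ℂ] Γ.Form :=
  (Algebra.lsmul ℂ ℂ Γ.Form).toLinearMap ∘ₗ (opLinearEquiv ℂ).toLinearMap

@[simp] theorem rmulForm_apply (a : QFun K q) (ρ : Γ.Form) : Γ.rmulForm a ρ = op a • ρ := rfl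

/-- The right action of `H ⊗ H` on `H ⊗ Γ`. -/
noncomputable def ractL : QFun K q ⊗[ℂ] QFun K q →ₗ[ℂ]
    QFun K q ⊗[ℂ] Γ.Form →ₗ[ℂ] QFun K q ⊗[ℂ] Γ.Form :=
  TensorProduct.map₂ (LinearMap.mul ℂ (QFun K q)).flip Γ.rmulForm

/-- The right action of `H ⊗ H` on `Γ ⊗ H`. -/
noncomputable def ractR : QFun K q ⊗[ℂ] QFun K q →ₗ[ℂ]
    Γ.Form ⊗[ℂ] QFun K q →ₗ[ℂ] Γ.Form ⊗[ℂ] QFun K q :=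
  TensorProduct.map₂ Γ.rmulForm (LinearMap.mul ℂ (QFun K q)).flip

@[simp] theorem actL_tmul (a b c : QFun K q) (ρ : Γ.Form) :
    Γ.actL (a ⊗ₜ b) (c ⊗ₜ ρ) = (a * c) ⊗ₜ (b • ρ) := rfl
@[simp] theorem actR_tmul (a b c : QFun K q) (ρ : Γ.Form) :
    Γ.actR (a ⊗ₜ b) (ρ ⊗ₜ c) = (a • ρ) ⊗ₜ (b * c) := rfl
@[simp] theorem ractL_tmul (a b c : QFun K q) (ρ : Γ.Form) :
    Γ.ractL (a ⊗ₜ b) (c ⊗ₜ ρ) = (c * a) ⊗ₜ (op b • ρ) := rfl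
@[simp] theorem ractR_tmul (a b c : QFun K q) (ρ : Γ.Form) :
    Γ.ractR (a ⊗ₜ b) (ρ ⊗ₜ c) = (op a • ρ) ⊗ₜ (c * b) := rfl

theorem actL_mul (x y n) : Γ.actL (x * y) n = Γ.actL x (Γ.actL y n) :=
  map₂_mul_apply (fun a b m => by simp [mul_assoc]) (fun a b n => by simp [mul_smul]) x y n
theorem actR_mul (x y n) : Γ.actR (x * y) n = Γ.actR x (Γ.actR y n) :=
  map₂_mul_apply (fun a b n => by simp [mul_smul]) (fun a b m => by simp [mul_assoc]) x y n
theorem actL_one (n) : Γ.actL 1 n = n := map₂_one_apply (by simp) (by simp) n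
theorem actR_one (n) : Γ.actR 1 n = n := map₂_one_apply (by simp) (by simp) n
theorem ractL_mul (x y n) : Γ.ractL (x * y) n = Γ.ractL y (Γ.ractL x n) :=
  map₂_mul_apply' (fun a b m => by simp [mul_assoc]) (fun a b n => by simp [mul_smul]) x y n
theorem ractR_mul (x y n) : Γ.ractR (x * y) n = Γ.ractR y (Γ.ractR x n) :=
  map₂_mul_apply' (fun a b n => by simp [mul_smul]) (fun a b m => by simp [mul_assoc]) x y n
theorem ractL_one (n) : Γ.ractL 1 n = n := map₂_one_apply (by simp) (by simp) n
theorem ractR_one (n) : Γ.ractR 1 n = n := map₂_one_apply (by simp) (by simp) n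
theorem actL_ractL (x y n) : Γ.actL x (Γ.ractL y n) = Γ.ractL y (Γ.actL x n) :=
  map₂_comm_apply (fun a b m => by simp [mul_assoc]) (fun a b n => by simp [smul_comm]) x y n
theorem actR_ractR (x y n) : Γ.actR x (Γ.ractR y n) = Γ.ractR y (Γ.actR x n) :=
  map₂_comm_apply (fun a b n => by simp [smul_comm]) (fun a b m => by simp [mul_assoc]) x y n

theorem lTensor_d_mul (x y : QFun K q ⊗[ℂ] QFun K q) :
    Γ.d.lTensor (QFun K q) (x * y) =
      Γ.ractL y (Γ.d.lTensor (QFun K q) x) + Γ.actL x (Γ.d.lTensor (QFun K q) y) := by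
  induction x with
  | zero => simp
  | add x x' hx hx' => rw [add_mul, map_add, hx, hx']; simp only [map_add, LinearMap.add_apply]; abel
  | tmul a b =>
    induction y with
    | zero => simp
    | add x x' hx hx' =>
      rw [mul_add, map_add, hx, hx']; simp only [map_add, LinearMap.add_apply]; abel
    | tmul c e =>
      simp only [Algebra.TensorProduct.tmul_mul_tmul, LinearMap.lTensor_tmul, Γ.leibniz,
        ractL_tmul, actL_tmul, TensorProduct.tmul_add]

theorem rTensor_d_mul (x y : QFun K q ⊗[ℂ] QFun K q) :
    Γ.d.rTensor (QFun K q) (x * y) =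
      Γ.ractR y (Γ.d.rTensor (QFun K q) x) + Γ.actR x (Γ.d.rTensor (QFun K q) y) := by
  induction x with
  | zero => simp
  | add x x' hx hx' => rw [add_mul, map_add, hx, hx']; simp only [map_add, LinearMap.add_apply]; abel
  | tmul a b =>
    induction y with
    | zero => simp
    | add x x' hx hx' =>
      rw [mul_add, map_add, hx, hx']; simp only [map_add, LinearMap.add_apply]; abel
    | tmul c e =>
      simp only [Algebra.TensorProduct.tmul_mul_tmul, LinearMap.rTensor_tmul, Γ.leibniz,
        ractR_tmul, actR_tmul, TensorProduct.add_tmul]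

theorem d_algebraMap (c : ℂ) : Γ.d (algebraMap ℂ _ c) = 0 := by
  have h1 : Γ.d 1 = 0 := by simpa using Γ.leibniz 1 1
  rw [Algebra.algebraMap_eq_smul_one, map_smul, h1, smul_zero]

variable [NeZero q] {Γ}

/-- `gform` is built from braid operators, and these pass through a contraction with ZZ by the RTT
relation. Both coactions multiply by ZZ, on one side or the other, so the commutation relations
survive in the tensor products. -/
theorem conv_left_gform {M N : Type*} [AddCommGroup M] [Module ℂ M] [AddCommGroup N] [Module ℂ N]
    (B : QFun K q →ₗ[ℂ] M →ₗ[ℂ] N) (ν : Family) (t g h : ℂ) (V W : Quad M) :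
    conv B (prodQuad (QFun.z K q)) (gform ν q t g h V W) =
      gform ν q t g h (conv B (prodQuad (QFun.z K q)) V) (conv B (prodQuad (QFun.z K q)) W) := by
  have e := (QFun.isQPoint K q).toIsQMatrix.swL_prodQuad (QFun.q_ne q) ν
  simp only [gform, conv_add, conv_smul, swR_conv, swL_conv, e, conv_swR]

theorem conv_right_gform {M N : Type*} [AddCommGroup M] [Module ℂ M] [AddCommGroup N] [Module ℂ N]
    (B : M →ₗ[ℂ] QFun K q →ₗ[ℂ] N) (ν : Family) (t g h : ℂ) (V W : Quad M) :
    conv B (gform ν q t g h V W) (prodQuad (QFun.z K q)) =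
      gform ν q t g h (conv B V (prodQuad (QFun.z K q))) (conv B W (prodQuad (QFun.z K q))) := by
  have e := (QFun.isQPoint K q).toIsQMatrix.swL_prodQuad (QFun.q_ne q) ν
  simp only [gform, conv_add_left, conv_smul_left, swR_conv, swL_conv, ← e, ← conv_swR]

/-- Z acts invertibly, with inverse S. This yields the images of the θ from those of the dz for a
map known only to be left linear. -/
theorem tmul_z_cancel {N : Type*} [AddCommGroup N] (L : QFun K q →+ N →+ N)
    (hL : ∀ a b n, L (a * b) n = L a (L b n)) (hL1 : ∀ n, L 1 n = n) {f g : Fin 3 → N}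
    (h : ∀ i, ∑ b, L (QFun.z K q i b) (f b) = ∑ b, L (QFun.z K q i b) (g b)) (a : Fin 3) :
    f a = g a := by
  have key : ∀ f : Fin 3 → N,
      ∑ i, L (QFun.S K q a i) (∑ b, L (QFun.z K q i b) (f b)) = f a := by
    intro f
    simp only [map_sum, ← hL]
    rw [Finset.sum_comm]
    simp only [← AddMonoidHom.finset_sum_apply, ← map_sum, sum_S_mul_z]
    rw [Finset.sum_eq_single a]
    · simp [hL1]
    · intro b _ hb; simp [hb.symm]
    · simp
  rw [← key f, ← key g]
  simp only [h]

theorem comul_z (i j : Fin 3) :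
    Coalgebra.comul (R := ℂ) (QFun.z K q i j) = ∑ k, QFun.z K q i k ⊗ₜ[ℂ] QFun.z K q k j :=
  QFun.comulHom_z K q i j

theorem comul_mul' (a b : QFun K q) : Coalgebra.comul (R := ℂ) (a * b) =
    Coalgebra.comul (R := ℂ) a * Coalgebra.comul (R := ℂ) b := map_mul (QFun.comulHom K q) a b

theorem comul_one' : Coalgebra.comul (R := ℂ) (1 : QFun K q) = 1 := map_one (QFun.comulHom K q)

theorem comul_algebraMap' (c : ℂ) :
    Coalgebra.comul (R := ℂ) (algebraMap ℂ (QFun K q) c) = algebraMap ℂ _ c :=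
  AlgHom.commutes (QFun.comulHom K q) c

/-- `exists_extension` is applied to H ⊗ Γ with both actions pulled back along Δ. In its
compatibility check θ goes to 1 ⊗ θ, so z dz, zz Tr_q θ and dz z all become contractions of ZZ with
themselves, and `conv_left_gform` returns the check to the relations of Γ. -/
theorem BraidRel.exists_left_coaction {ν : Family} {t : ℂ} (h : Γ.BraidRel ν t)
    (hΓ : Γ.IsDzBasis) :
    ∃ ΔL : Γ.Form →ₗ[ℂ] QFun K q ⊗[ℂ] Γ.Form, ∀ a b : QFun K q,
      ΔL (a • Γ.d b) =
        Γ.actL (Coalgebra.comul (R := ℂ) a) (Γ.d.lTensor _ (Coalgebra.comul (R := ℂ) b)) := by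
  let L := (Γ.actL ∘ₗ Coalgebra.comul (R := ℂ)).toBiadditive
  let R := (Γ.ractL ∘ₗ Coalgebra.comul (R := ℂ)).toBiadditive
  let δ : QFun K q →+ QFun K q ⊗[ℂ] Γ.Form :=
    (Γ.d.lTensor (QFun K q) ∘ₗ Coalgebra.comul (R := ℂ)).toAddMonoidHom
  have hLa : ∀ a n, L a n = Γ.actL (Coalgebra.comul (R := ℂ) a) n := fun _ _ => rfl
  have hRa : ∀ a n, R a n = Γ.ractL (Coalgebra.comul (R := ℂ) a) n := fun _ _ => rfl
  have hδa : ∀ a, δ a = Γ.d.lTensor (QFun K q) (Coalgebra.comul (R := ℂ) a) := fun _ => rfl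
  have hL : ∀ a b n, L (a * b) n = L a (L b n) := fun a b n => by
    simp only [hLa, comul_mul', actL_mul]
  have hL1 : ∀ n, L 1 n = n := fun n => by rw [hLa, comul_one', actL_one]
  have hLc : ∀ (c : ℂ) n, L (algebraMap ℂ _ c) n = c • n := fun c n => by
    rw [hLa, comul_algebraMap', Algebra.algebraMap_eq_smul_one, map_smul, LinearMap.smul_apply,
      actL_one]
  have hlin : ∀ φ : Γ.Form →+ QFun K q ⊗[ℂ] Γ.Form, (∀ a ρ, φ (a • ρ) = L a (φ ρ)) →
      ∀ (c : ℂ) ρ, φ (c • ρ) = c • φ ρ := fun φ hφ c ρ => by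
    rw [← algebraMap_smul (QFun K q), hφ, hLc]
  obtain ⟨φ, h1, h2, h3⟩ := hΓ.exists_extension L R δ hL hL1
    (fun a b n => by simp only [hRa, comul_mul', ractL_mul])
    (fun n => by rw [hRa, comul_one', ractL_one])
    (fun a b n => by simp only [hLa, hRa, actL_ractL])
    (fun c n => by
      rw [hLc, hRa, comul_algebraMap', Algebra.algebraMap_eq_smul_one, map_smul,
        LinearMap.smul_apply, ractL_one])
    (fun a b => by simp only [hδa, hLa, hRa, comul_mul', lTensor_d_mul])
    (fun c => by
      rw [hδa, comul_algebraMap', Algebra.algebraMap_eq_smul_one, map_smul,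
        Algebra.TensorProduct.one_def, LinearMap.lTensor_tmul, ← map_one (algebraMap ℂ (QFun K q)),
        d_algebraMap, TensorProduct.tmul_zero, smul_zero])
    (by
      intro φ hφ hz i j k l
      let φ' : Γ.Form →ₗ[ℂ] QFun K q ⊗[ℂ] Γ.Form := { φ with map_smul' := hlin φ hφ }
      have hφ' : ∀ ρ, φ' ρ = φ ρ := fun _ => rfl
      have hθ : ∀ i j, φ (Γ.theta i j) = 1 ⊗ₜ Γ.theta i j := fun i j => by
        refine tmul_z_cancel L hL hL1 (f := fun i => φ (Γ.theta i j))
          (g := fun i => 1 ⊗ₜ Γ.theta i j) (fun i => ?_) i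
        simp only [← hφ, ← map_sum, ← d_z, hz]
        simp only [hδa, hLa, comul_z, map_sum, LinearMap.lTensor_tmul, LinearMap.sum_apply,
          actL_tmul, mul_one, d_z, TensorProduct.tmul_sum]
        exact Finset.sum_comm
      have hτ : φ Γ.trq = 1 ⊗ₜ Γ.trq := by
        simp only [trq, map_add, hlin φ hφ, hθ, TensorProduct.tmul_add, TensorProduct.tmul_smul]
      have hV : (fun i k j l => φ' (Γ.zMulDz i k j l)) =
          conv (TensorProduct.mk ℂ _ _) (prodQuad (QFun.z K q)) Γ.zMulDz := by
        ext i k j l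
        simp only [hφ', zMulDz, hφ, hz]
        simp only [hδa, hLa, comul_z, map_sum, LinearMap.lTensor_tmul, LinearMap.sum_apply,
          actL_tmul, conv, prodQuad, TensorProduct.mk_apply, zMulDz]
        exact Finset.sum_comm
      have hW : (fun i k j l => φ' (Γ.zzTr i k j l)) =
          conv (TensorProduct.mk ℂ _ _) (prodQuad (QFun.z K q)) Γ.zzTr := by
        ext i k j l
        simp only [hφ', zzTr, hφ, hτ]
        simp only [hLa, comul_mul', comul_z, Finset.sum_mul_sum, map_sum, LinearMap.sum_apply,
          Algebra.TensorProduct.tmul_mul_tmul,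
          actL_tmul, conv, prodQuad, TensorProduct.mk_apply, zzTr, mul_one]
      have hU : R (QFun.z K q k l) (δ (QFun.z K q i j)) =
          conv (TensorProduct.mk ℂ _ _) (prodQuad (QFun.z K q)) Γ.dzMulZ i k j l := by
        simp only [hδa, hRa, comul_z, map_sum, LinearMap.lTensor_tmul, LinearMap.sum_apply,
          ractL_tmul, conv, prodQuad, TensorProduct.mk_apply, dzMulZ]
      rw [hU, h, conv_left_gform, ← hV, ← hW, ← map_gform_apply, ← h]
      rfl)
  refine ⟨{ φ with map_smul' := hlin φ h1 }, fun a b => ?_⟩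
  change φ (a • Γ.d b) = _
  rw [h1, h3, hLa, hδa]

theorem sum_weight_S_mul_z (k l : Fin 3) :
    (q : ℂ) ^ 4 • (QFun.S K q 0 k * QFun.z K q l 0) + (q : ℂ) ^ 2 • (QFun.S K q 1 k * QFun.z K q l 1)
      + QFun.S K q 2 k * QFun.z K q l 2 =
      if k = l then (![(q : ℂ) ^ 4, (q : ℂ) ^ 2, 1] : Fin 3 → ℂ) k • 1 else 0 := by
  have hq := QFun.q_ne q
  have hE : ∀ i k l, QFun.S K q i k * QFun.z K q l i =
      (qadj (q : ℂ) (QFun.z K q) i k * QFun.z K q l i) * QFun.detInv K q := by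
    intro i k l
    rw [QFun.S, mul_assoc, (QFun.isQPoint K q).comm hq, mul_assoc]
  have key := (QFun.isQPoint K q).toIsQMatrix.sum_weight_qadj_mul hq k l
  have key' := congrArg (· * QFun.detInv K q) key
  simp only [add_mul, smul_mul_assoc] at key'
  simp only [hE, key']
  split_ifs
  · rw [smul_mul_assoc, (QFun.isQPoint K q).qdet_mul]
  · rw [zero_mul]

/-- As for the left coaction, with ZZ contracted from the right. Here θ undergoes the adjoint
coaction, a sum of terms θ ⊗ S z, and the weights of the trace send Tr_q θ to Tr_q θ ⊗ 1. -/
theorem BraidRel.exists_right_coaction {ν : Family} {t : ℂ} (h : Γ.BraidRel ν t)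
    (hΓ : Γ.IsDzBasis) :
    ∃ ΔR : Γ.Form →ₗ[ℂ] Γ.Form ⊗[ℂ] QFun K q, ∀ a b : QFun K q,
      ΔR (a • Γ.d b) =
        Γ.actR (Coalgebra.comul (R := ℂ) a) (Γ.d.rTensor _ (Coalgebra.comul (R := ℂ) b)) := by
  let L := (Γ.actR ∘ₗ Coalgebra.comul (R := ℂ)).toBiadditive
  let R := (Γ.ractR ∘ₗ Coalgebra.comul (R := ℂ)).toBiadditive
  let δ : QFun K q →+ Γ.Form ⊗[ℂ] QFun K q :=
    (Γ.d.rTensor (QFun K q) ∘ₗ Coalgebra.comul (R := ℂ)).toAddMonoidHom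
  have hLa : ∀ a n, L a n = Γ.actR (Coalgebra.comul (R := ℂ) a) n := fun _ _ => rfl
  have hRa : ∀ a n, R a n = Γ.ractR (Coalgebra.comul (R := ℂ) a) n := fun _ _ => rfl
  have hδa : ∀ a, δ a = Γ.d.rTensor (QFun K q) (Coalgebra.comul (R := ℂ) a) := fun _ => rfl
  have hL : ∀ a b n, L (a * b) n = L a (L b n) := fun a b n => by
    simp only [hLa, comul_mul', actR_mul]
  have hL1 : ∀ n, L 1 n = n := fun n => by rw [hLa, comul_one', actR_one]
  have hLc : ∀ (c : ℂ) n, L (algebraMap ℂ _ c) n = c • n := fun c n => by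
    rw [hLa, comul_algebraMap', Algebra.algebraMap_eq_smul_one, map_smul, LinearMap.smul_apply,
      actR_one]
  have hlin : ∀ φ : Γ.Form →+ Γ.Form ⊗[ℂ] QFun K q, (∀ a ρ, φ (a • ρ) = L a (φ ρ)) →
      ∀ (c : ℂ) ρ, φ (c • ρ) = c • φ ρ := fun φ hφ c ρ => by
    rw [← algebraMap_smul (QFun K q), hφ, hLc]
  obtain ⟨φ, h1, h2, h3⟩ := hΓ.exists_extension L R δ hL hL1
    (fun a b n => by simp only [hRa, comul_mul', ractR_mul])
    (fun n => by rw [hRa, comul_one', ractR_one])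
    (fun a b n => by simp only [hLa, hRa, actR_ractR])
    (fun c n => by
      rw [hLc, hRa, comul_algebraMap', Algebra.algebraMap_eq_smul_one, map_smul,
        LinearMap.smul_apply, ractR_one])
    (fun a b => by simp only [hδa, hLa, hRa, comul_mul', rTensor_d_mul])
    (fun c => by
      rw [hδa, comul_algebraMap', Algebra.algebraMap_eq_smul_one, map_smul,
        Algebra.TensorProduct.one_def, LinearMap.rTensor_tmul, ← map_one (algebraMap ℂ (QFun K q)),
        d_algebraMap, TensorProduct.zero_tmul, smul_zero])
    (by
      intro φ hφ hz i j k l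
      let φ' : Γ.Form →ₗ[ℂ] Γ.Form ⊗[ℂ] QFun K q := { φ with map_smul' := hlin φ hφ }
      have hφ' : ∀ ρ, φ' ρ = φ ρ := fun _ => rfl
      have hθ : ∀ i j, φ (Γ.theta i j) =
          ∑ k, ∑ a, Γ.theta k a ⊗ₜ (QFun.S K q i k * QFun.z K q a j) := fun i j => by
        refine tmul_z_cancel L hL hL1 (f := fun i => φ (Γ.theta i j))
          (g := fun i => ∑ k, ∑ a, Γ.theta k a ⊗ₜ (QFun.S K q i k * QFun.z K q a j))
          (fun i => ?_) i
        simp only [← hφ, ← map_sum, ← d_z, hz]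
        simp only [hδa, hLa, comul_z, map_sum, LinearMap.rTensor_tmul, LinearMap.sum_apply,
          actR_tmul, d_z, TensorProduct.sum_tmul]
        have e : ∀ b k a c, (QFun.z K q i c • Γ.theta k a) ⊗ₜ[ℂ]
              (QFun.z K q c b * (QFun.S K q b k * QFun.z K q a j)) =
            (QFun.z K q i c • Γ.theta k a) ⊗ₜ[ℂ]
              ((QFun.z K q c b * QFun.S K q b k) * QFun.z K q a j) := by
          intros; rw [mul_assoc]
        simp only [e]
        have e2 : ∀ f : Fin 3 → Fin 3 → Fin 3 → Fin 3 → Γ.Form ⊗[ℂ] QFun K q,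
            ∑ b, ∑ k, ∑ a, ∑ c, f b k a c = ∑ a, ∑ c, ∑ k, ∑ b, f b k a c := by
          intro f
          simp only [Fin.sum_univ_three]; abel
        rw [e2]
        simp only [← TensorProduct.tmul_sum, ← Finset.sum_mul, sum_z_mul_S]
        simp only [ite_mul, one_mul, zero_mul, TensorProduct.tmul_ite, TensorProduct.tmul_zero]
        simp [TensorProduct.sum_tmul]
      have hτ : φ Γ.trq = Γ.trq ⊗ₜ 1 := by
        have e3 := fun k l => congrArg (fun x => Γ.theta k l ⊗ₜ[ℂ] x)
          (sum_weight_S_mul_z (K := K) (q := q) k l)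
        simp only [TensorProduct.tmul_add, TensorProduct.tmul_smul] at e3
        simp only [trq, map_add, hlin φ hφ, hθ, TensorProduct.add_tmul, Finset.smul_sum,
          ← Finset.sum_add_distrib]
        simp only [e3]
        simp [Fin.sum_univ_three, TensorProduct.smul_tmul']
      have hV : (fun i k j l => φ' (Γ.zMulDz i k j l)) =
          conv (TensorProduct.mk ℂ _ _) Γ.zMulDz (prodQuad (QFun.z K q)) := by
        ext i k j l
        simp only [hφ', zMulDz, hφ, hz]
        simp only [hδa, hLa, comul_z, map_sum, LinearMap.rTensor_tmul, LinearMap.sum_apply,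
          actR_tmul, conv, prodQuad, TensorProduct.mk_apply, zMulDz]
        exact Finset.sum_comm
      have hW : (fun i k j l => φ' (Γ.zzTr i k j l)) =
          conv (TensorProduct.mk ℂ _ _) Γ.zzTr (prodQuad (QFun.z K q)) := by
        ext i k j l
        simp only [hφ', zzTr, hφ, hτ]
        simp only [hLa, comul_mul', comul_z, Finset.sum_mul_sum, map_sum, LinearMap.sum_apply,
          Algebra.TensorProduct.tmul_mul_tmul,
          actR_tmul, conv, prodQuad, TensorProduct.mk_apply, zzTr, mul_one]
      have hU : R (QFun.z K q k l) (δ (QFun.z K q i j)) =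
          conv (TensorProduct.mk ℂ _ _) Γ.dzMulZ (prodQuad (QFun.z K q)) i k j l := by
        simp only [hδa, hRa, comul_z, map_sum, LinearMap.rTensor_tmul, LinearMap.sum_apply,
          ractR_tmul, conv, prodQuad, TensorProduct.mk_apply, dzMulZ]
      rw [hU, h, conv_right_gform, ← hV, ← hW, ← map_gform_apply, ← h]
      rfl)
  refine ⟨{ φ with map_smul' := hlin φ h1 }, fun a b => ?_⟩
  change φ (a • Γ.d b) = _
  rw [h1, h3, hLa, hδa]

theorem IsGamma.isBicovariant {ν : Family} {t : ℂ} (h : Γ.IsGamma ν t) : Γ.IsBicovariant := by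
  obtain ⟨-, -, hb, hr⟩ := (Γ.isGamma_iff ν t).1 h
  exact ⟨hr.exists_left_coaction hb, hr.exists_right_coaction hb⟩

end Bicovariance
end FODC

/-! ### Maps between calculi -/

namespace FODC
open MulOpposite
section Maps
variable {K K' : QKind} {q : ℝ} {Γ : FODC.{0, v} (QFun K q)} {Γ' : FODC.{0, w} (QFun K' q)}

/-- `φ` is a map of bimodules over the algebra map `π` that intertwines the differentials. -/
structure IsOver (π : QFun K q →ₐ[ℂ] QFun K' q) (φ : Γ.Form →+ Γ'.Form) : Prop where
  smul : ∀ a ρ, φ (a • ρ) = π a • φ ρ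
  op_smul : ∀ a ρ, φ (op a • ρ) = op (π a) • φ ρ
  d : ∀ a, φ (Γ.d a) = Γ'.d (π a)

theorem complex_smul_of_smul {π : QFun K q →ₐ[ℂ] QFun K' q} {φ : Γ.Form →+ Γ'.Form}
    (h : ∀ a ρ, φ (a • ρ) = π a • φ ρ) (c : ℂ) (ρ : Γ.Form) : φ (c • ρ) = c • φ ρ := by
  rw [← algebraMap_smul (QFun K q), h, AlgHom.commutes, algebraMap_smul]

/-- The underlying complex linear map of a left semilinear map. -/
def complexLinear {π : QFun K q →ₐ[ℂ] QFun K' q} (φ : Γ.Form →+ Γ'.Form)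
    (h : ∀ a ρ, φ (a • ρ) = π a • φ ρ) : Γ.Form →ₗ[ℂ] Γ'.Form :=
  { φ with map_smul' := complex_smul_of_smul h }

variable [NeZero q]

section
variable {π : QFun K q →ₐ[ℂ] QFun K' q} {φ : Γ.Form →+ Γ'.Form}
  (hπ : ∀ i j, π (QFun.z K q i j) = QFun.z K' q i j)
  (h : ∀ a ρ, φ (a • ρ) = π a • φ ρ) (hd : ∀ i j, φ (Γ.d (QFun.z K q i j)) = Γ'.d (QFun.z K' q i j))
include hπ h hd

/-- Only left multiplication and dz enter θ. So the images of θ and Tr_q θ are available before `φ`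
is known to respect right multiplication, which is the situation inside `exists_extension`. -/
theorem map_theta (i j : Fin 3) : φ (Γ.theta i j) = Γ'.theta i j := by
  rw [← Γ'.sum_S_smul_sum_z_smul (fun b => φ (Γ.theta b j)) i, theta_eq]
  refine Finset.sum_congr rfl fun k _ => ?_
  congr 1
  rw [← hd, d_z, map_sum]
  simp only [h, hπ]

theorem map_trq : φ Γ.trq = Γ'.trq := by
  simp only [trq, map_add, complex_smul_of_smul h, map_theta hπ h hd]

theorem map_gform_zMulDz (ν : Family) (t g g' : ℂ) (i k j l : Fin 3) :
    φ (gform ν q t g g' Γ.zMulDz Γ.zzTr i k j l) =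
      gform ν q t g g' Γ'.zMulDz Γ'.zzTr i k j l := by
  have := map_gform_apply (complexLinear φ h) ν (q : ℂ) t g g' Γ.zMulDz Γ.zzTr i k j l
  refine this.trans ?_
  congr 1
  congr 1
  · ext i k j l
    change φ _ = _
    simp only [zMulDz, h, hπ, hd]
  · ext i k j l
    change φ _ = _
    simp only [zzTr, h, map_mul, hπ, map_trq hπ h hd]

end

theorem IsOver.braidRel {π : QFun K q →ₐ[ℂ] QFun K' q} {φ : Γ.Form →+ Γ'.Form}
    (hπ : ∀ i j, π (QFun.z K q i j) = QFun.z K' q i j) (h : IsOver π φ) {ν : Family} {t : ℂ}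
    (hb : Γ.BraidRel ν t) : Γ'.BraidRel ν t := by
  have hd : ∀ i j, φ (Γ.d (QFun.z K q i j)) = Γ'.d (QFun.z K' q i j) := fun i j => by
    rw [h.d, hπ]
  ext i k j l
  rw [← map_gform_zMulDz hπ h.smul hd, ← hb]
  simp only [dzMulZ, h.op_smul, hd, hπ]

/-- For π the identity this produces equivalences; for π the projection imposing 𝒟 = 1 it produces
the map onto the induced calculus. -/
theorem BraidRel.exists_isOver {ν : Family} {t : ℂ} (hb : Γ.BraidRel ν t) (hΓ : Γ.IsDzBasis)
    (hb' : Γ'.BraidRel ν t) (π : QFun K q →ₐ[ℂ] QFun K' q)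
    (hπ : ∀ i j, π (QFun.z K q i j) = QFun.z K' q i j) :
    ∃ φ : Γ.Form →+ Γ'.Form, IsOver π φ := by
  obtain ⟨φ, h1, h2, h3⟩ := hΓ.exists_extension
    (N := Γ'.Form)
    { toFun := fun a => (Γ'.lmulForm (π a)).toAddMonoidHom
      map_zero' := by ext; simp
      map_add' := fun a b => by ext; simp }
    { toFun := fun a => (Γ'.rmulForm (π a)).toAddMonoidHom
      map_zero' := by ext; simp
      map_add' := fun a b => by ext; simp [add_smul] }
    { toFun := fun a => Γ'.d (π a)
      map_zero' := by simp
      map_add' := fun a b => by simp }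
    (fun a b n => by simp [mul_smul]) (fun n => by simp)
    (fun a b n => by simp [mul_smul]) (fun n => by simp)
    (fun a b n => by simp [smul_comm])
    (fun c n => by simp [op_algebraMap_smul])
    (fun a b => by simp [Γ'.leibniz])
    (fun c => by simp [d_algebraMap])
    (by
      intro φ hφ hz i j k l
      have hd : ∀ i j, φ (Γ.d (QFun.z K q i j)) = Γ'.d (QFun.z K' q i j) := fun i j => by
        rw [hz]; simp [hπ]
      have e := map_gform_zMulDz (π := π) hπ hφ hd ν t (gcoef ν q t) (hcoef ν q t) i k j l
      rw [← hb, ← hb'] at e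
      refine e.trans ?_
      simp [dzMulZ, hπ])
  exact ⟨φ, h1, h2, h3⟩

theorem IsOver.comp_eq_id {Γ'' : FODC.{0, w} (QFun K q)} {φ : Γ.Form →+ Γ''.Form}
    {ψ : Γ''.Form →+ Γ.Form} (hφ : IsOver (AlgHom.id ℂ _) φ) (hψ : IsOver (AlgHom.id ℂ _) ψ)
    (ρ : Γ.Form) : ψ (φ ρ) = ρ := by
  have hρ : ρ ∈ Submodule.span (QFun K q) (Set.range Γ.d) := by rw [Γ.span_range_d]; trivial
  induction hρ using Submodule.span_induction with
  | mem x hx => obtain ⟨a, rfl⟩ := hx; rw [hφ.d, hψ.d]; rfl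
  | zero => simp
  | add x y _ _ hx hy => rw [map_add, map_add, hx, hy]
  | smul a x _ hx => rw [hφ.smul, hψ.smul, hx]; rfl

theorem BraidRel.equivalent {Γ'' : FODC.{0, w} (QFun K q)} {ν : Family} {t : ℂ}
    (hb : Γ.BraidRel ν t) (hΓ : Γ.IsDzBasis) (hb' : Γ''.BraidRel ν t) (hΓ' : Γ''.IsDzBasis) :
    Γ.Equivalent Γ'' := by
  obtain ⟨φ, hφ⟩ := hb.exists_isOver hΓ hb' (AlgHom.id ℂ _) fun _ _ => rfl
  obtain ⟨ψ, hψ⟩ := hb'.exists_isOver hΓ' hb (AlgHom.id ℂ _) fun _ _ => rfl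
  exact ⟨{ φ with
    invFun := ψ
    left_inv := hφ.comp_eq_id hψ
    right_inv := hψ.comp_eq_id hφ }, hφ.smul, hφ.op_smul, hφ.d⟩

theorem Equivalent.exists_isOver {Γ'' : FODC.{0, w} (QFun K q)} (h : Γ.Equivalent Γ'') :
    ∃ φ : Γ.Form →+ Γ''.Form, IsOver (AlgHom.id ℂ _) φ := by
  obtain ⟨ζ, h1, h2, h3⟩ := h
  exact ⟨ζ.toAddMonoidHom, h1, h2, h3⟩

end Maps

/-! ### Coordinates in the Maurer–Cartan forms, and recovery of ν and t -/

section ThetaBasis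
variable {K : QKind} {q : ℝ} [NeZero q] {Γ : FODC.{0, v} (QFun K q)}

/-- A relation among the θ with coefficients a is a relation among the dz with coefficients aS, and
multiplication by Z recovers a. -/
theorem IsDzBasis.linearIndependent_theta (h : Γ.IsDzBasis) :
    LinearIndependent (QFun K q) (fun p : Fin 3 × Fin 3 => Γ.theta p.1 p.2) := by
  rw [Fintype.linearIndependent_iff]
  intro a ha
  have h1 := Fintype.linearIndependent_iff.1 h.1
    (fun p => ∑ b, a (b, p.2) * QFun.S K q b p.1) (by
      rw [← ha]
      simp only [Fintype.sum_prod_type, theta_eq, Finset.smul_sum, Finset.sum_smul, smul_smul]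
      rw [Finset.sum_comm, Finset.sum_comm (s := Finset.univ (α := Fin 3))]
      simp only [Fin.sum_univ_three]; abel)
  rintro ⟨b, j⟩
  have h2 : ∑ k, (∑ c, a (c, j) * QFun.S K q c k) * QFun.z K q k b = 0 :=
    Finset.sum_eq_zero fun k _ => by rw [h1 (k, j), zero_mul]
  simp only [Finset.sum_mul, mul_assoc] at h2
  rw [Finset.sum_comm] at h2
  simpa only [← Finset.mul_sum, sum_S_mul_z, mul_ite, mul_one, mul_zero, Finset.sum_ite_eq',
    Finset.mem_univ, if_true] using h2

theorem IsDzBasis.span_theta (h : Γ.IsDzBasis) :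
    Submodule.span (QFun K q) (Set.range fun p : Fin 3 × Fin 3 => Γ.theta p.1 p.2) = ⊤ := by
  rw [eq_top_iff, ← h.2, Submodule.span_le]
  rintro _ ⟨p, rfl⟩
  simp only [d_z]
  exact Submodule.sum_mem _ fun k _ => Submodule.smul_mem _ _
    (Submodule.subset_span ⟨(k, p.2), rfl⟩)

/-- The basis `θⁱⱼ`. -/
noncomputable def IsDzBasis.thetaBasis (h : Γ.IsDzBasis) :
    Module.Basis (Fin 3 × Fin 3) (QFun K q) Γ.Form :=
  Module.Basis.mk h.linearIndependent_theta h.span_theta.ge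

theorem IsDzBasis.thetaBasis_apply (h : Γ.IsDzBasis) (i j : Fin 3) :
    h.thetaBasis (i, j) = Γ.theta i j := by simp [thetaBasis]

/-- The value of the counit on the coordinates with respect to the forms `θⁱⱼ`. -/
noncomputable def IsDzBasis.counitCoord (h : Γ.IsDzBasis) (m n : Fin 3) : Γ.Form →ₗ[ℂ] ℂ where
  toFun ρ := QFun.counitHom K q (h.thetaBasis.repr ρ (m, n))
  map_add' := by simp
  map_smul' c ρ := by
    rw [← algebraMap_smul (QFun K q), map_smul]
    simp

theorem IsDzBasis.counitCoord_smul (h : Γ.IsDzBasis) (m n : Fin 3) (a : QFun K q) (ρ : Γ.Form) :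
    h.counitCoord m n (a • ρ) = QFun.counitHom K q a * h.counitCoord m n ρ := by
  simp [counitCoord]

theorem IsDzBasis.counitCoord_theta (h : Γ.IsDzBasis) (m n i j : Fin 3) :
    h.counitCoord m n (Γ.theta i j) = if i = m then if j = n then 1 else 0 else 0 := by
  simp only [counitCoord, LinearMap.coe_mk, AddHom.coe_mk, ← h.thetaBasis_apply,
    Module.Basis.repr_self, Finsupp.single_apply, Prod.mk.injEq]
  split_ifs <;> simp_all

theorem braidRel_iff_expand {ν : Family} {t : ℂ} : Γ.BraidRel ν t ↔
    Γ.dzMulZ = Γ.expand (gform ν q t (gcoef ν q t) (hcoef ν q t) Γ.invDz Γ.invTr) := by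
  rw [BraidRel, gform, gform]
  simp only [expand_add, expand_smul, ← swR_expand, ← swL_expand, expand_invDz, expand_invTr]

theorem sub_inv_ne_zero (hq1 : q ≠ 1) (hq2 : q ≠ -1) : (q : ℂ) - (q : ℂ)⁻¹ ≠ 0 := by
  have hq := NeZero.ne q
  intro h
  have h1 : (q : ℂ) * q = 1 := by
    have := QFun.q_ne q
    field_simp at h
    linear_combination h
  have h2 : q * q = 1 := by exact_mod_cast h1
  rcases mul_self_eq_one_iff.1 h2 with h | h
  · exact hq1 h
  · exact hq2 h

theorem BraidRel.unique (hq1 : q ≠ 1) (hq2 : q ≠ -1) (hΓ : Γ.IsDzBasis) {ν ν' : Family}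
    {t t' : ℂ} (h : Γ.BraidRel ν t) (h' : Γ.BraidRel ν' t') (ht : t ≠ 0) : ν = ν' ∧ t = t' := by
  rw [braidRel_iff_expand] at h h'
  have e := Γ.expand_injective (h.symm.trans h')
  -- Two coefficients separate all cases. The coefficient of θ⁰₂ in the entry (0,1;2,1) is t. That
  -- of θ¹₂ in the entry (0,1;0,2) is t - 1 for the first family, with the additional term t(q -
  -- q⁻¹)² for the second.
  have e1 := congrArg (hΓ.counitCoord 0 2) (congrFun (congrFun (congrFun (congrFun e 0) 1) 2) 1)
  have e2 := congrArg (hΓ.counitCoord 1 2) (congrFun (congrFun (congrFun (congrFun e 0) 1) 0) 2)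
  have hL := sub_inv_ne_zero hq1 hq2
  have hinv : ∀ ν : Family, ∀ t : ℂ, hΓ.counitCoord 0 2 (gform ν (q : ℂ) t (gcoef ν q t)
      (hcoef ν q t) Γ.invDz Γ.invTr 0 1 2 1) = t := by
    intro ν t
    simp [gform, swL_apply, swR_apply, invDz, invTr, hΓ.counitCoord_theta, rd_of_ne]
  have hinv2 : ∀ ν : Family, ∀ t : ℂ, hΓ.counitCoord 1 2 (gform ν (q : ℂ) t (gcoef ν q t)
      (hcoef ν q t) Γ.invDz Γ.invTr 0 1 0 2) = t - 1 + t * (rl ν (q : ℂ) 0 1 * rl ν (q : ℂ) 0 2) := by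
    intro ν t
    simp [gform, swL_apply, swR_apply, invDz, invTr, hΓ.counitCoord_theta, rd_of_ne]
  rw [hinv, hinv] at e1
  subst e1
  rw [hinv2, hinv2] at e2
  refine ⟨?_, rfl⟩
  cases ν <;> cases ν' <;> simp [rl, ht, hL] at e2 ⊢

end ThetaBasis
end FODC

/-! ### The *-structure -/

namespace FODC
open MulOpposite
section Star
variable {K : QKind} {q : ℝ} [NeZero q] {Γ : FODC.{0, v} (QFun K q)}

theorem star_z (i j : Fin 3) : star (QFun.z K q i j) = QFun.S K q j i := QFun.starFun_z K q i j
theorem star_S (i j : Fin 3) : star (QFun.S K q i j) = QFun.z K q j i := QFun.starFun_S K q i j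
theorem star_algebraMap' (c : ℂ) : star (algebraMap ℂ (QFun K q) c) =
    algebraMap ℂ _ (starRingEnd ℂ c) := QFun.starFun_algebraMap K q c

theorem op_smul_comm {H : Type u} [Ring H] [Algebra ℂ H] (Γ : FODC.{u, v} H) (a b : H)
    (ρ : Γ.Form) : op a • b • ρ = b • op a • ρ := (smul_comm b (op a) ρ).symm

/-- The commutation of the Maurer–Cartan forms with the generators. -/
theorem theta_mul_z {Y : Quad Γ.Form} (hY : Γ.dzMulZ = Γ.expand Y) (a j k l : Fin 3) :
    op (QFun.z K q k l) • Γ.theta a j = ∑ b, QFun.z K q k b • Y a b j l := by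
  rw [← Γ.sum_S_smul_sum_z_smul (fun a => ∑ b, QFun.z K q k b • Y a b j l) a, theta_eq,
    Finset.smul_sum]
  refine Finset.sum_congr rfl fun i _ => ?_
  rw [op_smul_comm]
  congr 1
  have := congrFun (congrFun (congrFun (congrFun hY i) k) j) l
  rw [expand_apply] at this
  simp only [Finset.smul_sum, smul_smul]
  exact this

theorem sum_d_S_mul_z (j b : Fin 3) :
    ∑ k, op (QFun.z K q k b) • Γ.d (QFun.S K q j k) = - Γ.theta j b := by
  have := congrArg Γ.d (sum_S_mul_z (K := K) (q := q) j b)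
  simp only [map_sum, Γ.leibniz, Finset.sum_add_distrib] at this
  rw [theta_eq, eq_neg_iff_add_eq_zero, this]
  split_ifs
  · simpa using Γ.d_algebraMap 1
  · simp

theorem d_S (j i : Fin 3) :
    Γ.d (QFun.S K q j i) = -∑ a, op (QFun.S K q a i) • Γ.theta j a := by
  have h2 : ∑ b, op (QFun.S K q b i) • ∑ k, op (QFun.z K q k b) • Γ.d (QFun.S K q j k) =
      Γ.d (QFun.S K q j i) := by
    simp only [Finset.smul_sum, smul_smul, ← op_mul]
    rw [Finset.sum_comm]
    simp only [← Finset.sum_smul, ← Finset.op_sum, sum_z_mul_S]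
    simp [apply_ite op, ite_smul]
  rw [← h2]
  simp only [sum_d_S_mul_z, smul_neg, Finset.sum_neg_distrib]

/-- The involution exchanges S(Z) and Z up to transposition, so S dz becomes (dS) z, and d(S(Z)Z) =
0 turns this into -θ with transposed indices. Right linearity is not needed. -/
theorem theta_map_of_antilinear {φ : Γ.Form →+ Γ.Form}
    (h : ∀ (a : QFun K q) ρ, φ (a • ρ) = op (star a) • φ ρ)
    (hd : ∀ i j, φ (Γ.d (QFun.z K q i j)) = Γ.d (star (QFun.z K q i j))) (i j : Fin 3) :
    φ (Γ.theta i j) = -Γ.theta j i := by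
  rw [theta_eq, map_sum, ← sum_d_S_mul_z]
  simp only [h, hd, star_S, star_z]

theorem IsStar.theta {s : Γ.Form → Γ.Form} (h : Γ.IsStar s) (i j : Fin 3) :
    s (Γ.theta i j) = -Γ.theta j i :=
  theta_map_of_antilinear (φ := AddMonoidHom.mk' s h.add) h.left (fun _ _ => h.d _) i j

theorem IsStar.unique {H : Type u} [Ring H] [Algebra ℂ H] [StarRing H] {Γ : FODC.{u, v} H}
    {s s' : Γ.Form → Γ.Form} (h : Γ.IsStar s) (h' : Γ.IsStar s') : s = s' := by
  funext ρ
  have hρ : ρ ∈ Submodule.span H (Set.range Γ.d) := by rw [Γ.span_range_d]; trivial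
  induction hρ using Submodule.span_induction with
  | mem x hx => obtain ⟨a, rfl⟩ := hx; rw [h.d, h'.d]
  | zero =>
    have e : ∀ s : Γ.Form → Γ.Form, Γ.IsStar s → s 0 = 0 := fun s h => by
      simpa using h.add 0 0
    rw [e s h, e s' h']
  | add x y _ _ hx hy => rw [h.add, h'.add, hx, hy]
  | smul a x _ hx => rw [h.left, h'.left, hx]

theorem conj_rd (ν : Family) (i k : Fin 3) : starRingEnd ℂ (rd ν (q : ℂ) i k) = rd ν q i k := by
  cases ν <;> simp only [rd] <;> split_ifs <;> simp

theorem conj_rl (ν : Family) (i k : Fin 3) : starRingEnd ℂ (rl ν (q : ℂ) i k) = rl ν q i k := by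
  cases ν <;> simp only [rl] <;> split_ifs <;> simp

theorem conj_gcoef (ν : Family) (t : ℝ) :
    starRingEnd ℂ (gcoef ν (q : ℂ) t) = gcoef ν q t := by
  cases ν <;> simp [gcoef, gden]

theorem conj_hcoef (ν : Family) (t : ℝ) :
    starRingEnd ℂ (hcoef ν (q : ℂ) t) = hcoef ν q t := by
  cases ν <;> simp [hcoef, gden, rmu]

theorem complex_smul_of_antilinear {φ : Γ.Form →+ Γ.Form}
    (h : ∀ (a : QFun K q) ρ, φ (a • ρ) = op (star a) • φ ρ) (c : ℂ) (ρ : Γ.Form) :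
    φ (c • ρ) = starRingEnd ℂ c • φ ρ := by
  rw [← algebraMap_smul (QFun K q), h, star_algebraMap', op_algebraMap_smul]

/-- The coefficients are real, and the involution exchanges the pairs (a,b) and (j,l), hence the
operators R_L and R_R. These commute, so R_L R_R is preserved; in the last term R_L and R_R agree on
`invTr`. -/
theorem map_invForm_of_antilinear {φ : Γ.Form →+ Γ.Form}
    (h : ∀ (a : QFun K q) ρ, φ (a • ρ) = op (star a) • φ ρ)
    (hd : ∀ i j, φ (Γ.d (QFun.z K q i j)) = Γ.d (star (QFun.z K q i j)))
    (ν : Family) (t : ℝ) (a b j l : Fin 3) :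
    φ (gform ν q t (gcoef ν q t) (hcoef ν q t) Γ.invDz Γ.invTr a b j l) =
      -gform ν q t (gcoef ν q t) (hcoef ν q t) Γ.invDz Γ.invTr j l a b := by
  have hV : ∀ a b j l, φ (Γ.invDz a b j l) = -Γ.invDz j l a b := by
    intro a b j l
    simp only [invDz, eq_comm (a := j)]
    split_ifs
    · exact theta_map_of_antilinear h hd _ _
    · simp
  have hτ : φ Γ.trq = -Γ.trq := by
    simp only [trq, map_add, complex_smul_of_antilinear h, theta_map_of_antilinear h hd, map_pow,
      Complex.conj_ofReal]
    module
  have hW : ∀ a b j l, φ (Γ.invTr a b j l) = -Γ.invTr j l a b := by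
    intro a b j l
    simp only [invTr, eq_comm (a := j), eq_comm (a := l)]
    split_ifs
    · exact hτ
    · simp
    · simp
  -- The equality of R_L and R_R on `invTr`, separately for the flipped and the diagonal term.
  have e1 : rd ν (q : ℂ) j l • Γ.invTr l j a b = rd ν (q : ℂ) a b • Γ.invTr j l b a := by
    simp only [invTr]
    split_ifs <;> simp_all [rd_symm]
  have e2 : rl ν (q : ℂ) j l • Γ.invTr j l a b = rl ν (q : ℂ) a b • Γ.invTr j l a b := by
    simp only [invTr]
    split_ifs <;> simp_all
  simp only [gform, Pi.add_apply, Pi.smul_apply, swL_apply, swR_apply, map_add,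
    complex_smul_of_antilinear h, map_sub, map_one, Complex.conj_ofReal, conj_rd, conj_rl,
    conj_gcoef, conj_hcoef, hV, hW]
  linear_combination (norm := module) (-hcoef ν (q : ℂ) t) • e1 + (-hcoef ν (q : ℂ) t) • e2

/-- `exists_extension` with target Γ, where a acts on the left as right multiplication by a* and on
the right as left multiplication by a*. The compatibility condition is the adjoint of the
commutation relations, which `map_invForm_of_antilinear` brings back to the same relations with
transposed indices. -/
theorem BraidRel.exists_isStar {ν : Family} {t : ℝ} (hb : Γ.BraidRel ν t) (hΓ : Γ.IsDzBasis) :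
    ∃ s, Γ.IsStar s := by
  have hY := braidRel_iff_expand.1 hb
  obtain ⟨φ, h1, h2, h3⟩ := hΓ.exists_extension
    (N := Γ.Form)
    { toFun := fun a => (Γ.rmulForm (star a)).toAddMonoidHom
      map_zero' := by ext; simp
      map_add' := fun a b => by ext; simp [add_smul] }
    { toFun := fun a => (Γ.lmulForm (star a)).toAddMonoidHom
      map_zero' := by ext; simp
      map_add' := fun a b => by ext; simp }
    { toFun := fun a => Γ.d (star a)
      map_zero' := by simp
      map_add' := fun a b => by simp }
    (fun a b n => by simp [mul_smul]) (fun n => by simp)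
    (fun a b n => by simp [mul_smul]) (fun n => by simp)
    (fun a b n => by simp [smul_comm])
    (fun c n => by simp [op_algebraMap_smul, star_algebraMap'])
    (fun a b => by simp [Γ.leibniz, add_comm])
    (fun c => by simp [d_algebraMap, star_algebraMap'])
    (by
      intro φ hφ hz i j k l
      have hφ' : ∀ a ρ, φ (a • ρ) = op (star a) • φ ρ := hφ
      have hd : ∀ i j, φ (Γ.d (QFun.z K q i j)) = Γ.d (star (QFun.z K q i j)) := hz
      have e := congrArg φ (congrFun (congrFun (congrFun (congrFun hY i) k) j) l)
      rw [expand_apply] at e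
      simp only [map_sum, hφ', map_invForm_of_antilinear hφ' hd, star_mul, star_z, op_mul, mul_smul,
        smul_neg] at e
      refine e.trans ?_
      change _ = star (QFun.z K q k l) • Γ.d (star (QFun.z K q i j))
      rw [star_z, star_z, d_S]
      simp only [smul_neg, Finset.sum_neg_distrib, Finset.smul_sum]
      congr 1
      refine Finset.sum_congr rfl fun a _ => ?_
      rw [← Γ.op_smul_comm, ← Finset.smul_sum]
      congr 1
      -- The rule for θ z is solved for the invariant form. The generator z that appears on the
      -- right then cancels against one factor S.
      have hs : ∀ b, gform ν q t (gcoef ν q t) (hcoef ν q t) Γ.invDz Γ.invTr j l a b =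
          ∑ k, QFun.S K q l k • op (QFun.z K q k b) • Γ.theta j a := by
        intro b
        simp only [theta_mul_z hY]
        exact (Γ.sum_S_smul_sum_z_smul (fun l => gform ν q t (gcoef ν q t) (hcoef ν q t) Γ.invDz
          Γ.invTr j l a b) l).symm
      simp only [hs, Finset.smul_sum]
      rw [Finset.sum_comm]
      simp only [Γ.op_smul_comm, ← Finset.smul_sum, smul_smul (op _) (op _),
        ← op_mul, ← Finset.sum_smul, ← Finset.op_sum, sum_z_mul_S]
      simp [apply_ite op, ite_smul])
  refine ⟨φ, ⟨map_add φ, fun ρ => ?_, h1, h2, h3⟩⟩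
  have hρ : ρ ∈ Submodule.span (QFun K q) (Set.range Γ.d) := by rw [Γ.span_range_d]; trivial
  have h1' : ∀ a ρ, φ (a • ρ) = op (star a) • φ ρ := h1
  have h2' : ∀ a ρ, φ (op a • ρ) = star a • φ ρ := h2
  have h3' : ∀ a, φ (Γ.d a) = Γ.d (star a) := h3
  induction hρ using Submodule.span_induction with
  | mem x hx => obtain ⟨a, rfl⟩ := hx; rw [h3', h3', star_star]
  | zero => simp
  | add x y _ _ hx hy => rw [map_add, map_add, hx, hy]
  | smul a x _ hx => rw [h1', h2', hx, star_star]

theorem IsGamma.isBicovariantStar {ν : Family} {t : ℝ} (h : Γ.IsGamma ν (t : ℂ)) :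
    Γ.IsBicovariantStar := by
  obtain ⟨-, -, hb, hr⟩ := (Γ.isGamma_iff ν t).1 h
  exact ⟨h.isBicovariant, hr.exists_isStar hb⟩

end Star
end FODC

/-! ### The structure matrices of the model -/

section Points
variable {R : Type*} [Ring R] [Algebra ℂ R] {q : ℂ} {Z : Fin 3 → Fin 3 → R}

theorem IsQMatrix.smul (h : IsQMatrix q Z) (c : ℂ) : IsQMatrix q (fun i j => c • Z i j) where
  row i j k hjk := by
    rw [smul_mul_smul_comm, smul_mul_smul_comm, h.row i j k hjk, smul_comm]
  col i j k hjk := by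
    rw [smul_mul_smul_comm, smul_mul_smul_comm, h.col i j k hjk, smul_comm]
  anti i j k l hik hlj := by
    rw [smul_mul_smul_comm, smul_mul_smul_comm, h.anti i j k l hik hlj]
  cross i j k l hik hjl := by
    rw [smul_mul_smul_comm, smul_mul_smul_comm, smul_mul_smul_comm, h.cross i j k l hik hjl,
      smul_add, smul_comm (c * c)]

theorem qdet_smul (c q : ℂ) (Z : Fin 3 → Fin 3 → R) :
    qdet q (fun i j => c • Z i j) = c ^ 3 • qdet q Z := by
  simp only [qdet, smul_mul_smul_comm]
  module

theorem IsQMatrix.isQPoint_of_qdet {K : QKind} (h : IsQMatrix q Z) {c : ℂ} (hc : c ≠ 0)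
    (hZ : qdet q Z = c • 1) (hK : K = QKind.SL → c = 1) : IsQPoint K q Z (c⁻¹ • 1) where
  toIsQMatrix := h
  qdet_mul := by rw [hZ, smul_mul_smul_comm, mul_inv_cancel₀ hc, one_smul, one_mul]
  mul_qdet := by rw [hZ, smul_mul_smul_comm, inv_mul_cancel₀ hc, one_smul, one_mul]
  unimod h := by rw [hZ, hK h, one_smul]

theorem IsQMatrix.map {R' : Type*} [Ring R'] [Algebra ℂ R'] (h : IsQMatrix q Z)
    (f : R →ₐ[ℂ] R') : IsQMatrix q (fun i j => f (Z i j)) where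
  row i j k hjk := by rw [← map_mul, h.row i j k hjk, map_smul, map_mul]
  col i j k hjk := by rw [← map_mul, h.col i j k hjk, map_smul, map_mul]
  anti i j k l hik hlj := by rw [← map_mul, h.anti i j k l hik hlj, map_mul]
  cross i j k l hik hjl := by
    rw [← map_mul, h.cross i j k l hik hjl, map_add, map_smul, map_mul, map_mul]

end Points

section Structure

/-- The representation of the quantum matrix algebra given by the braid matrix. -/
noncomputable def rmat (ν : FODC.Family) (q : ℂ) (b c : Fin 3) : Matrix (Fin 3) (Fin 3) ℂ :=
  fun a m => (if b = c then if a = m then rd ν q c m else 0 else 0) +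
    (if a = c then if b = m then rl ν q c m else 0 else 0)

-- Conceptually this is the Yang–Baxter equation for R; the proof checks it on all entries.
set_option maxHeartbeats 4000000 in
theorem isQMatrix_rmat (ν : FODC.Family) {q : ℂ} (hq : q ≠ 0) : IsQMatrix q (rmat ν q) := by
  constructor
  · intro i j k hjk
    fin_cases i <;> fin_cases j <;> fin_cases k <;> first
    | exact absurd hjk (by decide)
    | cases ν <;> ext a m <;> fin_cases a <;> fin_cases m <;>
        simp [Matrix.mul_apply, Fin.sum_univ_three, rmat, rd, rl, hq] <;>
        first | ring1 | (field_simp; done) | (field_simp; ring1)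
  · intro i j k hjk
    fin_cases i <;> fin_cases j <;> fin_cases k <;> first
    | exact absurd hjk (by decide)
    | cases ν <;> ext a m <;> fin_cases a <;> fin_cases m <;>
        simp [Matrix.mul_apply, Fin.sum_univ_three, rmat, rd, rl, hq] <;>
        first | ring1 | (field_simp; done) | (field_simp; ring1)
  · intro i j k l hik hjl
    fin_cases i <;> fin_cases k <;> first
    | exact absurd hik (by decide)
    | fin_cases j <;> fin_cases l <;> first
      | exact absurd hjl (by decide)
      | cases ν <;> ext a m <;> fin_cases a <;> fin_cases m <;>
          simp [Matrix.mul_apply, Fin.sum_univ_three, rmat, rd, rl, hq] <;>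
          first | ring1 | (field_simp; done) | (field_simp; ring1)
  · intro i j k l hik hjl
    fin_cases i <;> fin_cases k <;> first
    | exact absurd hik (by decide)
    | fin_cases j <;> fin_cases l <;> first
      | exact absurd hjl (by decide)
      | cases ν <;> ext a m <;> fin_cases a <;> fin_cases m <;>
          simp [Matrix.mul_apply, Fin.sum_univ_three, rmat, rd, rl, hq] <;>
          first | ring1 | (field_simp; done) | (field_simp; ring1)

set_option maxHeartbeats 1000000 in
theorem qdet_rmat (ν : FODC.Family) {q : ℂ} (hq : q ≠ 0) :
    qdet q (rmat ν q) = rd ν q 0 0 • 1 := by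
  cases ν <;> ext a m <;> fin_cases a <;> fin_cases m <;>
    simp [qdet, Matrix.mul_apply, Fin.sum_univ_three, rmat, rd, rl] <;> field_simp <;> ring

/-- `A ↦ A ⊗ 1`. -/
def kroneckerLeft : Matrix (Fin 3) (Fin 3) ℂ →ₐ[ℂ] Matrix (Fin 3 × Fin 3) (Fin 3 × Fin 3) ℂ :=
  AlgHom.ofLinearMap
    { toFun := fun A => Matrix.kronecker A 1
      map_add' := fun A B => Matrix.add_kronecker A B 1
      map_smul' := fun c A => Matrix.smul_kronecker c A 1 }
    Matrix.one_kronecker_one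
    (fun A B => by simpa using Matrix.mul_kronecker_mul A B (1 : Matrix (Fin 3) (Fin 3) ℂ) 1)

/-- `A ↦ 1 ⊗ A`. -/
def kroneckerRight : Matrix (Fin 3) (Fin 3) ℂ →ₐ[ℂ] Matrix (Fin 3 × Fin 3) (Fin 3 × Fin 3) ℂ :=
  AlgHom.ofLinearMap
    { toFun := fun A => Matrix.kronecker 1 A
      map_add' := fun A B => Matrix.kronecker_add 1 A B
      map_smul' := fun c A => Matrix.kronecker_smul c 1 A }
    Matrix.one_kronecker_one
    (fun A B => by simpa using Matrix.mul_kronecker_mul (1 : Matrix (Fin 3) (Fin 3) ℂ) 1 A B)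

theorem kroneckerLeft_mul_kroneckerRight (A B : Matrix (Fin 3) (Fin 3) ℂ) :
    kroneckerLeft A * kroneckerRight B = Matrix.kronecker A B := by
  have := (Matrix.mul_kronecker_mul A (1 : Matrix (Fin 3) (Fin 3) ℂ)
    (1 : Matrix (Fin 3) (Fin 3) ℂ) B).symm
  rw [mul_one, one_mul] at this
  exact this

theorem kroneckerRight_mul_kroneckerLeft (A B : Matrix (Fin 3) (Fin 3) ℂ) :
    kroneckerRight B * kroneckerLeft A = Matrix.kronecker A B := by
  have := (Matrix.mul_kronecker_mul (1 : Matrix (Fin 3) (Fin 3) ℂ) A B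
    (1 : Matrix (Fin 3) (Fin 3) ℂ)).symm
  rw [mul_one, one_mul] at this
  exact this

/-- The structure constants of the bimodule of one-forms in a left-invariant basis. -/
noncomputable def structMat (ν : FODC.Family) (q t : ℂ) (b l : Fin 3) :
    Matrix (Fin 3 × Fin 3) (Fin 3 × Fin 3) ℂ :=
  t • ∑ c, kroneckerLeft (rmat ν q b c) * kroneckerRight (rmat ν q l c)

theorem kroneckerLeft_comm (A B : Matrix (Fin 3) (Fin 3) ℂ) :
    kroneckerLeft A * kroneckerRight B = kroneckerRight B * kroneckerLeft A := by
  rw [kroneckerLeft_mul_kroneckerRight, kroneckerRight_mul_kroneckerLeft]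

/-- The two tensor factors are quantum matrices, the second a transposed one, with mutually
commuting entries. Such a product is again a quantum matrix, and so is every scalar multiple. -/
theorem isQMatrix_structMat (ν : FODC.Family) {q : ℂ} (hq : q ≠ 0) (t : ℂ) :
    IsQMatrix q (structMat ν q t) :=
  (((isQMatrix_rmat ν hq).map kroneckerLeft).mul hq
    ((isQMatrix_rmat ν hq).transpose.map kroneckerRight)
    fun _ _ _ _ => kroneckerLeft_comm _ _).smul t

/-- Multiplicativity: each factor contributes `rd ν q 0 0`, and the scalar t contributes its cube.
The conditions t³ = q² and t³ = q⁻² originate here. -/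
theorem qdet_structMat (ν : FODC.Family) {q : ℂ} (hq : q ≠ 0) (t : ℂ) :
    qdet q (structMat ν q t) = (t ^ 3 * rd ν q 0 0 ^ 2) • 1 := by
  have := IsQMatrix.qdet_mul hq ((isQMatrix_rmat ν hq).map kroneckerLeft)
    ((isQMatrix_rmat ν hq).transpose.map kroneckerRight) fun _ _ _ _ => kroneckerLeft_comm _ _
  refine (qdet_smul t q _).trans ?_
  rw [this, ← map_qdet, ← map_qdet,
      (isQMatrix_rmat ν hq).qdet_transpose hq, qdet_rmat ν hq, map_smul, map_smul, map_one, map_one,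
      smul_mul_smul_comm, smul_smul, one_mul, sq]

theorem isQPoint_structMat {K : QKind} (ν : FODC.Family) {q t : ℂ} (hq : q ≠ 0) (ht : t ≠ 0)
    (hK : K = QKind.SL → t ^ 3 * rd ν q 0 0 ^ 2 = 1) :
    IsQPoint K q (structMat ν q t) ((t ^ 3 * rd ν q 0 0 ^ 2)⁻¹ • 1) := by
  refine (isQMatrix_structMat ν hq t).isQPoint_of_qdet ?_ (qdet_structMat ν hq t) hK
  have : rd ν q 0 0 ≠ 0 := by cases ν <;> simp [rd, hq]
  exact mul_ne_zero (pow_ne_zero _ ht) (pow_ne_zero _ this)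

theorem structMat_apply (ν : FODC.Family) (q t : ℂ) (a b j l m n : Fin 3) :
    structMat ν q t b l (a, j) (m, n) = t * ∑ c, rmat ν q b c a m * rmat ν q l c j n := by
  simp only [structMat, kroneckerLeft_mul_kroneckerRight, Matrix.smul_apply, Matrix.sum_apply,
    smul_eq_mul]
  rfl

theorem sum_rmat_smul {M : Type*} [AddCommGroup M] [Module ℂ M] (ν : FODC.Family) (q : ℂ)
    (f : Fin 3 → M) (b c a : Fin 3) :
    ∑ m, rmat ν q b c a m • f m =
      (if b = c then rd ν q a b • f a else 0) + (if a = c then rl ν q a b • f b else 0) := by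
  simp only [rmat, add_smul, Finset.sum_add_distrib]
  split_ifs <;> simp_all [ite_smul, rd_symm ν q a c]

/-- The two tensor factors of `structMat` act as the two braid operators. So the model has t R_L
R_R, the leading part of `gform`, as its commutation rule. -/
theorem sum_structMat_smul {M : Type*} [AddCommGroup M] [Module ℂ M] (ν : FODC.Family) (q t : ℂ)
    (η : Fin 3 → Fin 3 → M) (a b j l : Fin 3) :
    ∑ m, ∑ n, structMat ν q t b l (a, j) (m, n) • η m n =
      t • swL ν q (swR ν q fun a b j l => if a = j then η b l else 0) a b j l := by
  have h1 : ∀ c m, ∑ n, rmat ν q l c j n • η m n =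
      (if l = c then rd ν q j l • η m j else 0) + (if j = c then rl ν q j l • η m l else 0) :=
    fun c m => sum_rmat_smul ν q (η m) l c j
  have h2 : ∑ m, ∑ n, structMat ν q t b l (a, j) (m, n) • η m n =
      t • ∑ c, ∑ m, rmat ν q b c a m • ∑ n, rmat ν q l c j n • η m n := by
    simp only [structMat_apply, Finset.smul_sum, Finset.sum_smul, smul_smul, Finset.mul_sum,
      mul_assoc]
    rw [Finset.sum_comm' (t' := Finset.univ) (s' := fun _ => Finset.univ) (by simp)]
    simp only [Fin.sum_univ_three]; abel
  rw [h2]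
  congr 1
  simp only [h1, sum_rmat_smul, Finset.sum_add_distrib, Finset.sum_ite_eq, Finset.mem_univ, if_true,
    swL_apply, swR_apply, eq_comm (a := l) (b := a), eq_comm (a := l) (b := b),
    eq_comm (a := j) (b := a), eq_comm (a := j) (b := b), smul_ite, smul_zero]

/-- The weights of the quantum trace. -/
def trWeight (q : ℂ) : Fin 3 → ℂ := ![q ^ 4, q ^ 2, 1]

/-- The quantum trace of the braiding. -/
noncomputable def trRho (ν : FODC.Family) (q : ℂ) : ℂ :=
  match ν with | .first => q⁻¹ ^ 2 - 1 | .second => q ^ 6 - q ^ 4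

theorem gden_eq (ν : FODC.Family) (q t : ℂ) :
    gden ν q t = t * trRho ν q + (t - 1) * ∑ a, trWeight q a := by
  cases ν <;> simp [gden, trRho, trWeight, Fin.sum_univ_three]

-- The partial quantum trace of R_L R_R. Its first term lets ω commute with z up to the factor t;
-- the remainder `trRho` times η is what makes the dz independent.
set_option maxHeartbeats 1000000 in
theorem sum_trWeight_swL_swR {M : Type*} [AddCommGroup M] [Module ℂ M] (ν : FODC.Family) {q : ℂ}
    (hq : q ≠ 0) (η : Fin 3 → Fin 3 → M) (b l : Fin 3) :
    ∑ a, trWeight q a • swL ν q (swR ν q fun a b j l => if a = j then η b l else 0) a b a l =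
      (if b = l then ∑ m, trWeight q m • η m m else 0) + trRho ν q • η b l := by
  cases ν <;> fin_cases b <;> fin_cases l <;>
    simp [swL_apply, swR_apply, Fin.sum_univ_three, rd, rl, trWeight, trRho] <;>
    match_scalars <;> field_simp <;> ring

end Structure

/-! ### Twisted free bimodules and inner derivations -/

section Twisted
open MulOpposite
variable {H ι : Type} [Ring H] [Algebra ℂ H] [Fintype ι] [DecidableEq ι]

/-- The free left module with basis `ι`, as a bimodule with the right action of `H` on the basis
given by a matrix representation. -/
def TwistForm (Ψ : H →ₐ[ℂ] Matrix ι ι H) : Type := ι → H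

namespace TwistForm
variable {Ψ : H →ₐ[ℂ] Matrix ι ι H}

instance : AddCommGroup (TwistForm Ψ) := inferInstanceAs (AddCommGroup (ι → H))
instance : Module H (TwistForm Ψ) := inferInstanceAs (Module H (ι → H))
instance : Module ℂ (TwistForm Ψ) := inferInstanceAs (Module ℂ (ι → H))
instance : IsScalarTower ℂ H (TwistForm Ψ) := inferInstanceAs (IsScalarTower ℂ H (ι → H))
instance : SMul Hᵐᵒᵖ (TwistForm Ψ) := ⟨fun a v => Matrix.vecMul (v : ι → H) (Ψ (unop a))⟩

theorem op_smul_def (a : H) (v : TwistForm Ψ) :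
    op a • v = Matrix.vecMul (v : ι → H) (Ψ a) := rfl

instance : Module Hᵐᵒᵖ (TwistForm Ψ) where
  one_smul v := (congrArg (Matrix.vecMul (v : ι → H)) (map_one Ψ)).trans (Matrix.vecMul_one _)
  mul_smul a b v := (congrArg (Matrix.vecMul (v : ι → H)) (map_mul Ψ (unop b) (unop a))).trans
    (Matrix.vecMul_vecMul _ _ _).symm
  smul_zero a := Matrix.zero_vecMul _
  smul_add a v w := Matrix.add_vecMul _ _ _
  add_smul a b v := (congrArg (Matrix.vecMul (v : ι → H)) (map_add Ψ (unop a) (unop b))).trans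
    (Matrix.vecMul_add _ _ _)
  zero_smul v := (congrArg (Matrix.vecMul (v : ι → H)) (map_zero Ψ)).trans (Matrix.vecMul_zero _)

instance : SMulCommClass H Hᵐᵒᵖ (TwistForm Ψ) where
  smul_comm a b v := (Matrix.smul_vecMul a (v : ι → H) (Ψ (unop b))).symm

instance : IsScalarTower ℂ Hᵐᵒᵖ (TwistForm Ψ) where
  smul_assoc c a v := by
    change Matrix.vecMul (v : ι → H) (Ψ (unop (c • a))) = c • Matrix.vecMul (v : ι → H) (Ψ (unop a))
    rw [unop_smul, map_smul]
    exact Matrix.vecMul_smul _ _ _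

/-- The basis of the bimodule. -/
def single (p : ι) : TwistForm Ψ := (Pi.single p 1 : ι → H)

theorem sum_smul_single (v : TwistForm Ψ) : v = ∑ p, (v : ι → H) p • (single p : TwistForm Ψ) := by
  have key : ∀ f : ι → H, f = ∑ p, f p • (Pi.single p 1 : ι → H) := fun f => by
    ext m
    simp [Finset.sum_apply, Pi.single_apply]
  exact key v

theorem sum_smul_single_eq_zero {c : ι → H} (h : ∑ p, c p • (single p : TwistForm Ψ) = 0) (p : ι) :
    c p = 0 := by
  rw [← TwistForm.sum_smul_single (Ψ := Ψ) c] at h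
  exact congrFun h p

theorem op_smul_single (a : H) (p : ι) :
    op a • (single p : TwistForm Ψ) = ∑ m, Ψ a p m • (single m : TwistForm Ψ) := by
  rw [TwistForm.sum_smul_single (op a • (single p : TwistForm Ψ))]
  refine Finset.sum_congr rfl fun m _ => ?_
  congr 1
  rw [op_smul_def]
  simp [single]

/-- The inner derivation given by a one-form. -/
noncomputable def innerD (ω : TwistForm Ψ) : H →ₗ[ℂ] TwistForm Ψ where
  toFun a := op a • ω - a • ω
  map_add' a b := by rw [op_add, add_smul, add_smul]; abel
  map_smul' c a := by
    rw [op_smul, smul_assoc, smul_assoc, ← smul_sub]; rfl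

theorem innerD_apply (ω : TwistForm Ψ) (a : H) : innerD ω a = op a • ω - a • ω := rfl

theorem innerD_mul (ω : TwistForm Ψ) (a b : H) :
    innerD ω (a * b) = op b • innerD ω a + a • innerD ω b := by
  simp only [innerD_apply, op_mul, mul_smul, smul_sub, smul_comm a (op b)]
  abel

end TwistForm

/-- Scalar extension composed with scalar matrices. -/
def scalarHom (H ι : Type) [Ring H] [Algebra ℂ H] [Fintype ι] [DecidableEq ι] :
    H →ₐ[ℂ] Matrix ι ι H :=
  { Matrix.scalar ι with
    commutes' := fun c => by
      ext i j
      simp [Matrix.algebraMap_matrix_apply, Matrix.diagonal_apply] }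

theorem scalarHom_apply (a : H) : scalarHom H ι a = Matrix.diagonal fun _ => a := rfl

end Twisted

/-! ### The model calculi -/

section Model
open MulOpposite
variable (K : QKind) (q : ℝ) [NeZero q] (ν : FODC.Family) (t : ℂ)

theorem scalarHom_comm {K : QKind} {q : ℝ} (a : QFun K q)
    (A : Matrix (Fin 3 × Fin 3) (Fin 3 × Fin 3) ℂ) :
    scalarHom (QFun K q) (Fin 3 × Fin 3) a * (Algebra.ofId ℂ (QFun K q)).mapMatrix A =
      (Algebra.ofId ℂ (QFun K q)).mapMatrix A * scalarHom (QFun K q) (Fin 3 × Fin 3) a := by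
  ext m n
  simp [scalarHom_apply, Algebra.ofId_apply, Algebra.commutes]

/-- Again a product of two quantum matrices with commuting entries: Z as scalar matrices, and the
structure matrices. Over SL the determinant of the second factor has to be 1, which `hK` provides.
-/
theorem isQPoint_right {K : QKind} {q : ℝ} [NeZero q] {ν : FODC.Family} {t : ℂ} (ht : t ≠ 0)
    (hK : K = QKind.SL → t ^ 3 * rd ν (q : ℂ) 0 0 ^ 2 = 1) :
    IsQPoint K (q : ℂ)
      (fun k l => ∑ b, scalarHom (QFun K q) (Fin 3 × Fin 3) (QFun.z K q k b) *
        (Algebra.ofId ℂ (QFun K q)).mapMatrix (structMat ν (q : ℂ) t b l))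
      (scalarHom (QFun K q) (Fin 3 × Fin 3) (QFun.detInv K q) *
        (Algebra.ofId ℂ (QFun K q)).mapMatrix ((t ^ 3 * rd ν (q : ℂ) 0 0 ^ 2)⁻¹ • 1)) := by
  refine IsQPoint.mul (QFun.q_ne q) ((QFun.isQPoint K q).map (scalarHom (QFun K q) (Fin 3 × Fin 3)))
    ((isQPoint_structMat ν (QFun.q_ne q) ht hK).map (Algebra.ofId ℂ (QFun K q)).mapMatrix) (fun i j k l => scalarHom_comm _ _) ?_
    (scalarHom_comm _ _)
  rw [← map_qdet]
  exact scalarHom_comm _ _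

/-- The right action on the basis of left-invariant forms. -/
noncomputable def rightHom {K : QKind} {q : ℝ} [NeZero q] {ν : FODC.Family} {t : ℂ} (ht : t ≠ 0)
    (hK : K = QKind.SL → t ^ 3 * rd ν (q : ℂ) 0 0 ^ 2 = 1) :
    QFun K q →ₐ[ℂ] Matrix (Fin 3 × Fin 3) (Fin 3 × Fin 3) (QFun K q) :=
  QFun.lift (isQPoint_right ht hK)

variable {K q ν t} (ht : t ≠ 0) (hK : K = QKind.SL → t ^ 3 * rd ν (q : ℂ) 0 0 ^ 2 = 1)

theorem rightHom_z (k l : Fin 3) (p m : Fin 3 × Fin 3) :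
    rightHom ht hK (QFun.z K q k l) p m =
      ∑ b, structMat ν (q : ℂ) t b l p m • QFun.z K q k b := by
  rw [rightHom, QFun.lift_z, Matrix.sum_apply]
  refine Finset.sum_congr rfl fun b _ => ?_
  simp [scalarHom_apply, Algebra.ofId_apply, Algebra.smul_def, Algebra.commutes]

theorem rightHom_qdet : rightHom ht hK (qdet (q : ℂ) (QFun.z K q)) =
    (t ^ 3 * rd ν (q : ℂ) 0 0 ^ 2) • scalarHom _ _ (qdet (q : ℂ) (QFun.z K q)) := by
  have hq := QFun.q_ne q
  rw [map_qdet, rightHom]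
  simp only [QFun.lift_z]
  rw [IsQMatrix.qdet_mul hq
    ((QFun.isQPoint K q).toIsQMatrix.map (scalarHom (QFun K q) (Fin 3 × Fin 3)))
    ((isQMatrix_structMat ν hq t).map (Algebra.ofId ℂ (QFun K q)).mapMatrix)
    fun _ _ _ _ => scalarHom_comm _ _, ← map_qdet, ← map_qdet,
    qdet_structMat ν hq, map_smul, map_one, mul_smul_comm, mul_one]

/-- The left-invariant forms `ηⁱⱼ` of the model. -/
noncomputable def modelEta (i j : Fin 3) : TwistForm (rightHom ht hK) := TwistForm.single (i, j)

/-- The biinvariant form of the model. -/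
noncomputable def modelOmega : TwistForm (rightHom ht hK) :=
  ∑ a, trWeight q a • modelEta ht hK a a

theorem op_z_smul_modelEta (a j k l : Fin 3) :
    op (QFun.z K q k l) • modelEta ht hK a j = ∑ b, QFun.z K q k b • t •
      swL ν q (swR ν q fun a b j l => if a = j then modelEta ht hK b l else 0) a b j l := by
  simp only [← sum_structMat_smul]
  rw [modelEta, TwistForm.op_smul_single, Fintype.sum_prod_type]
  simp only [rightHom_z, Finset.sum_smul, Finset.smul_sum]
  rw [Finset.sum_comm' (t' := Finset.univ) (s' := fun _ => Finset.univ) (by simp)]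
  simp only [modelEta, smul_assoc, smul_comm (QFun.z K q _ _)]
  simp only [Fin.sum_univ_three]; abel

theorem op_z_smul_modelOmega (k l : Fin 3) :
    op (QFun.z K q k l) • modelOmega ht hK = t • (QFun.z K q k l • modelOmega ht hK) +
      (t * trRho ν q) • ∑ b, QFun.z K q k b • modelEta ht hK b l := by
  have h := fun b => sum_trWeight_swL_swR ν (QFun.q_ne q) (modelEta ht hK) b l
  have h2 : op (QFun.z K q k l) • modelOmega ht hK = ∑ b, QFun.z K q k b • t • ∑ a, trWeight q a •
      swL ν q (swR ν q fun a b j l => if a = j then modelEta ht hK b l else 0) a b a l := by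
    rw [modelOmega, Finset.smul_sum]
    simp only [smul_comm (op _) (trWeight _ _), op_z_smul_modelEta, Finset.smul_sum]
    rw [Finset.sum_comm]
    refine Finset.sum_congr rfl fun b _ => Finset.sum_congr rfl fun a _ => ?_
    simp only [smul_comm (trWeight _ _)]
  rw [h2]
  simp only [h, smul_add, Finset.sum_add_distrib, smul_ite, smul_zero, Finset.sum_ite_eq',
    Finset.mem_univ, if_true]
  rw [← modelOmega, smul_comm t, Finset.smul_sum]
  congr 1
  refine Finset.sum_congr rfl fun b _ => ?_
  rw [mul_smul, smul_comm t (trRho ν (q : ℂ)), smul_comm (QFun.z K q k b) (trRho ν (q : ℂ)),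
    smul_comm (QFun.z K q k b) t, smul_comm t (trRho ν (q : ℂ))]

end Model

theorem trRho_ne_zero {q : ℝ} [NeZero q] (hq1 : q ≠ 1) (hq2 : q ≠ -1) (ν : FODC.Family) :
    trRho ν (q : ℂ) ≠ 0 := by
  have h := FODC.sub_inv_ne_zero hq1 hq2
  have hq := QFun.q_ne q
  cases ν
  · have : trRho .first (q : ℂ) = -((q : ℂ)⁻¹ * (q - (q : ℂ)⁻¹)) := by
      simp only [trRho]; field_simp; ring
    rw [this]
    exact neg_ne_zero.2 (mul_ne_zero (inv_ne_zero hq) h)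
  · have : trRho .second (q : ℂ) = (q : ℂ) ^ 5 * (q - (q : ℂ)⁻¹) := by
      simp only [trRho]; field_simp
    rw [this]
    exact mul_ne_zero (pow_ne_zero _ hq) h

theorem sum_S_smul_sum_z_smul' {K : QKind} {q : ℝ} [NeZero q] {M : Type*} [AddCommGroup M]
    [Module (QFun K q) M] (f : Fin 3 → M) (a : Fin 3) :
    ∑ i, QFun.S K q a i • ∑ b, QFun.z K q i b • f b = f a := by
  simp only [Finset.smul_sum, smul_smul]
  rw [Finset.sum_comm]
  simp only [← Finset.sum_smul, FODC.sum_S_mul_z, ite_smul, one_smul, zero_smul,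
    Finset.sum_ite_eq, Finset.mem_univ, if_true]

theorem QFun.qdet_comm {K : QKind} {q : ℝ} [NeZero q] (a : QFun K q) :
    qdet (q : ℂ) (QFun.z K q) * a = a * qdet (q : ℂ) (QFun.z K q) := by
  have h := isQPoint K q
  refine (Subalgebra.mem_centralizer_iff ℂ).1 (mem_of_z_mem
    (Subalgebra.centralizer ℂ {qdet (q : ℂ) (QFun.z K q)}) (fun i j => ?_) ?_ a) _ rfl
  · rw [Subalgebra.mem_centralizer_iff]
    rintro _ rfl
    exact h.toIsQMatrix.qdet_comm (q_ne q) i j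
  · rw [Subalgebra.mem_centralizer_iff]
    rintro _ rfl
    rw [h.qdet_mul, h.mul_qdet]

section Model
open MulOpposite
variable {K : QKind} {q : ℝ} [NeZero q] {ν : FODC.Family} {t : ℂ} (ht : t ≠ 0)
  (hK : K = QKind.SL → t ^ 3 * rd ν (q : ℂ) 0 0 ^ 2 = 1)

/-- The Maurer–Cartan forms of the model. -/
noncomputable def modelTheta (b l : Fin 3) : TwistForm (rightHom ht hK) :=
  (if b = l then (t - 1) • modelOmega ht hK else 0) + (t * trRho ν (q : ℂ)) • modelEta ht hK b l

theorem innerD_z (k l : Fin 3) : TwistForm.innerD (modelOmega ht hK) (QFun.z K q k l) =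
    ∑ b, QFun.z K q k b • modelTheta ht hK b l := by
  rw [TwistForm.innerD_apply, op_z_smul_modelOmega]
  simp only [modelTheta, smul_add, Finset.sum_add_distrib, smul_ite, smul_zero, Finset.sum_ite_eq',
    Finset.mem_univ, if_true, Finset.smul_sum, smul_comm (QFun.z K q k _) (t - 1),
    smul_comm (QFun.z K q k _) (t * _)]
  rw [sub_smul, one_smul]
  abel

/-- This explains the denominator of the families: Tr_q θ is `gden` times ω, so ω can be recovered
from the θ when `gden` is nonzero. -/
theorem sum_trWeight_modelTheta : ∑ a, trWeight (q : ℂ) a • modelTheta ht hK a a =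
    gden ν (q : ℂ) t • modelOmega ht hK := by
  simp only [modelTheta, if_true, smul_add, Finset.sum_add_distrib,
    smul_comm _ (t * trRho ν (q : ℂ))]
  rw [← Finset.smul_sum, ← modelOmega, ← Finset.sum_smul, gden_eq]
  module

/-- From the dz one obtains the θ, then ω by dividing Tr_q θ by `gden`, and then η by subtracting
the ω part and dividing by t `trRho`. -/
theorem span_innerD_z (hq1 : q ≠ 1) (hq2 : q ≠ -1) (hd : gden ν (q : ℂ) t ≠ 0)
    (N : Submodule (QFun K q) (TwistForm (rightHom ht hK)))
    (hN : ∀ i j, TwistForm.innerD (modelOmega ht hK) (QFun.z K q i j) ∈ N) : N = ⊤ := by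
  have hθ : ∀ b l, modelTheta ht hK b l ∈ N := fun b l => by
    rw [← sum_S_smul_sum_z_smul' (K := K) (q := q) (fun b => modelTheta ht hK b l) b]
    simp only [← innerD_z]
    exact N.sum_mem fun i _ => N.smul_mem _ (hN i l)
  have hω : modelOmega ht hK ∈ N := by
    have := N.sum_mem (t := Finset.univ) (f := fun a => trWeight (q : ℂ) a • modelTheta ht hK a a)
      fun a _ => N.smul_of_tower_mem _ (hθ a a)
    rw [sum_trWeight_modelTheta] at this
    have := N.smul_of_tower_mem (gden ν (q : ℂ) t)⁻¹ this
    rwa [smul_smul, inv_mul_cancel₀ hd, one_smul] at this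
  have hη : ∀ b l, modelEta ht hK b l ∈ N := fun b l => by
    have h1 : (t * trRho ν (q : ℂ)) • modelEta ht hK b l ∈ N := by
      have h2 := N.sub_mem (hθ b l) (x := modelTheta ht hK b l)
        (y := if b = l then (t - 1) • modelOmega ht hK else 0) (by
          split_ifs
          · exact N.smul_of_tower_mem _ hω
          · exact N.zero_mem)
      rwa [modelTheta, add_sub_cancel_left] at h2
    have h3 := mul_ne_zero ht (trRho_ne_zero hq1 hq2 ν)
    have := N.smul_of_tower_mem (t * trRho ν (q : ℂ))⁻¹ h1
    rwa [smul_smul, inv_mul_cancel₀ h3, one_smul] at this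
  rw [eq_top_iff]
  intro v _
  rw [TwistForm.sum_smul_single v]
  exact N.sum_mem fun p _ => N.smul_mem _ (hη p.1 p.2)

/-- The calculus of the family `ν` with parameter `t`. -/
noncomputable def modelFODC (hq1 : q ≠ 1) (hq2 : q ≠ -1) (hd : gden ν (q : ℂ) t ≠ 0) :
    FODC.{0, 0} (QFun K q) where
  Form := TwistForm (rightHom ht hK)
  d := TwistForm.innerD (modelOmega ht hK)
  leibniz := TwistForm.innerD_mul _
  span_range_d := span_innerD_z ht hK hq1 hq2 hd _ fun i j => Submodule.subset_span ⟨_, rfl⟩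

variable (hq1 : q ≠ 1) (hq2 : q ≠ -1) (hd : gden ν (q : ℂ) t ≠ 0)

theorem modelFODC_d (a : QFun K q) : (modelFODC ht hK hq1 hq2 hd).d a =
    TwistForm.innerD (modelOmega ht hK) a := rfl

theorem modelFODC_isDzBasis : (modelFODC ht hK hq1 hq2 hd).IsDzBasis := by
  refine ⟨?_, span_innerD_z ht hK hq1 hq2 hd (Submodule.span (QFun K q)
    (Set.range fun p : Fin 3 × Fin 3 => TwistForm.innerD (modelOmega ht hK)
      (QFun.z K q p.1 p.2))) fun i j => Submodule.subset_span ⟨(i, j), rfl⟩⟩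
  rw [Fintype.linearIndependent_iff]
  intro g hg
  replace hg : ∑ p, g p • TwistForm.innerD (modelOmega ht hK) (QFun.z K q p.1 p.2) = 0 := hg
  set c : Fin 3 → Fin 3 → QFun K q := fun b j => ∑ i, g (i, j) * QFun.z K q i b with hc
  -- The total coefficient with which ω enters the relation. Tracing the equations for the
  -- coordinates gives `gden` times T = 0; with T = 0 each remaining coordinate is a nonzero
  -- multiple of `c`.
  set T : QFun K q := ∑ j, c j j with hT
  have h1 : ∑ b, ∑ j, c b j • modelTheta ht hK b j = 0 := by
    rw [← hg]
    simp only [innerD_z, Fintype.sum_prod_type, Finset.smul_sum, hc, Finset.sum_smul,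
      smul_smul]
    simp only [Fin.sum_univ_three]
    abel
  set e : Fin 3 × Fin 3 → QFun K q := fun p =>
    (if p.1 = p.2 then ((t - 1) * trWeight (q : ℂ) p.1) • T else 0) +
      (t * trRho ν (q : ℂ)) • c p.1 p.2 with he
  have h2 : ∑ p, e p • (TwistForm.single p : TwistForm (rightHom ht hK)) = 0 := by
    rw [← h1]
    simp only [he, Fintype.sum_prod_type, modelTheta, add_smul, smul_add, Finset.sum_add_distrib,
      ite_smul, smul_ite, smul_zero, zero_smul, Finset.sum_ite_eq, Finset.mem_univ, if_true]
    congr 1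
    · rw [← Finset.sum_smul, ← hT, modelOmega, Finset.smul_sum, Finset.smul_sum]
      refine Finset.sum_congr rfl fun b _ => ?_
      rw [smul_smul, smul_comm T, smul_assoc]
      rfl
    · refine Finset.sum_congr rfl fun b _ => Finset.sum_congr rfl fun j _ => ?_
      rw [smul_comm (c b j), smul_assoc]
      rfl
  have h3 : ∀ b j, e (b, j) = 0 := fun b j => TwistForm.sum_smul_single_eq_zero h2 (b, j)
  have h4 : gden ν (q : ℂ) t • T = 0 := by
    have : ∑ b, e (b, b) = 0 := Finset.sum_eq_zero fun b _ => h3 b b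
    rw [← this]
    simp only [he, if_true, Finset.sum_add_distrib]
    rw [← Finset.smul_sum, ← hT, ← Finset.sum_smul, ← Finset.mul_sum, gden_eq]
    module
  have hT0 : T = 0 := (smul_eq_zero.1 h4).resolve_left hd
  have hc0 : ∀ b j, c b j = 0 := fun b j => by
    have := h3 b j
    simp only [he, hT0, smul_zero, ite_self, zero_add] at this
    exact (smul_eq_zero.1 this).resolve_left (mul_ne_zero ht (trRho_ne_zero hq1 hq2 ν))
  rintro ⟨i, j⟩
  have h5 : ∑ b, c b j * QFun.S K q b i = 0 :=
    Finset.sum_eq_zero fun b _ => by rw [hc0, zero_mul]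
  simp only [hc, Finset.sum_mul, mul_assoc] at h5
  rw [Finset.sum_comm] at h5
  simpa only [← Finset.mul_sum, FODC.sum_z_mul_S, mul_ite, mul_one, mul_zero, Finset.sum_ite_eq',
    Finset.mem_univ, if_true] using h5

theorem modelFODC_theta (b l : Fin 3) :
    (modelFODC ht hK hq1 hq2 hd).theta b l = modelTheta ht hK b l := by
  rw [FODC.theta_eq]
  simp only [modelFODC_d, innerD_z]
  exact sum_S_smul_sum_z_smul' (fun b => modelTheta ht hK b l) b

theorem modelFODC_trq : (modelFODC ht hK hq1 hq2 hd).trq =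
    gden ν (q : ℂ) t • modelOmega ht hK := by
  have h := sum_trWeight_modelTheta ht hK
  simp only [Fin.sum_univ_three, trWeight, Matrix.cons_val_zero, Matrix.cons_val_one,
    Matrix.cons_val, one_smul] at h
  simp only [FODC.trq, modelFODC_theta]
  exact h

/-- Write Ω = zz ω. Then z dz = (t - 1) Ω + t trRho zη, and eliminating zη from dz·z leaves (t -
1)(z dz + Ω) + t R_L R_R (z dz - (t - 1) Ω). Since R_L and R_R agree on Ω, the Hecke relation gives
R_L R_R Ω = Ω + μ R_R Ω. Replacing Ω through zz Tr_q θ = gden Ω yields exactly `gcoef` and `hcoef`.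
-/
theorem modelFODC_braidRel : (modelFODC ht hK hq1 hq2 hd).BraidRel ν t := by
  set Γ := modelFODC ht hK hq1 hq2 hd with hΓ
  set η : Fin 3 → Fin 3 → Γ.Form := modelEta ht hK with hη
  set ω : Γ.Form := modelOmega ht hK with hω
  set Q : Quad Γ.Form := fun a b j l => if a = j then η b l else 0 with hQ
  set Ω : Quad Γ.Form := fun i k j l => (QFun.z K q i j * QFun.z K q k l) • ω with hΩ
  have hq := QFun.q_ne q
  have hΩs : swL ν (q : ℂ) Ω = swR ν (q : ℂ) Ω := by
    have := (QFun.isQPoint K q).toIsQMatrix.swL_prodQuad (QFun.q_ne q) ν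
    ext i k j l
    have := congrArg (· • ω) (congrFun (congrFun (congrFun (congrFun this i) k) j) l)
    simpa only [swL_apply, swR_apply, prodQuad, add_smul, smul_assoc] using this
  have hW : Γ.zzTr = gden ν (q : ℂ) t • Ω := by
    ext i k j l
    change (QFun.z K q i j * QFun.z K q k l) • Γ.trq =
      gden ν (q : ℂ) t • ((QFun.z K q i j * QFun.z K q k l) • ω)
    have htr : Γ.trq = gden ν (q : ℂ) t • ω := modelFODC_trq ht hK hq1 hq2 hd
    rw [htr, smul_comm]
  have hz : ∀ i j, Γ.d (QFun.z K q i j) = (t - 1) • QFun.z K q i j • ω +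
      (t * trRho ν (q : ℂ)) • ∑ b, QFun.z K q i b • η b j := fun i j => by
    refine (innerD_z ht hK i j).trans ?_
    simp only [modelTheta, smul_add, Finset.sum_add_distrib, smul_ite, smul_zero,
      Finset.sum_ite_eq', Finset.mem_univ, if_true, Finset.smul_sum]
    congr 1
    · exact smul_comm _ _ _
    · exact Finset.sum_congr rfl fun b _ => smul_comm _ _ _
  have hV : Γ.zMulDz = (t - 1) • Ω + (t * trRho ν (q : ℂ)) • Γ.expand Q := by
    ext i k j l
    simp only [FODC.zMulDz, hz, Pi.add_apply, Pi.smul_apply, FODC.expand_apply, hQ, hΩ, smul_add,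
      smul_ite, smul_zero, Finset.smul_sum, mul_smul, smul_comm (QFun.z K q i j) (t - 1),
      smul_comm (QFun.z K q i j) t, smul_comm (QFun.z K q i j) (trRho ν (q : ℂ))]
    congr 1
    rw [Finset.sum_comm]
    simp
  have hU1 : ∀ i k j l, op (QFun.z K q k l) • ∑ b, QFun.z K q i b • η b j =
      t • Γ.expand (swL ν (q : ℂ) (swR ν (q : ℂ) Q)) i k j l := fun i k j l => by
    simp only [Finset.smul_sum, FODC.expand_apply]
    refine Finset.sum_congr rfl fun a _ => ?_
    have h : op (QFun.z K q k l) • η a j = ∑ b, QFun.z K q k b • t •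
      swL ν (q : ℂ) (swR ν (q : ℂ) Q) a b j l := op_z_smul_modelEta ht hK a j k l
    rw [Γ.op_smul_comm, h, Finset.smul_sum]
    refine Finset.sum_congr rfl fun b _ => ?_
    rw [← mul_smul, smul_comm]
  have hω2 : ∀ k l, op (QFun.z K q k l) • ω = Γ.d (QFun.z K q k l) + QFun.z K q k l • ω :=
    fun k l => by
      change _ = TwistForm.innerD (modelOmega ht hK) (QFun.z K q k l) + _
      rw [TwistForm.innerD_apply]
      exact (sub_add_cancel _ _).symm
  have hU : Γ.dzMulZ = (t - 1) • (Γ.zMulDz + Ω) +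
      (t * trRho ν (q : ℂ) * t) • swL ν (q : ℂ) (swR ν (q : ℂ) (Γ.expand Q)) := by
    ext i k j l
    rw [FODC.swR_expand, FODC.swL_expand]
    simp only [FODC.dzMulZ, hz i j, smul_add, Pi.add_apply, Pi.smul_apply]
    rw [smul_comm (op _) (t - 1), smul_comm (op _) (t * _), hU1, Γ.op_smul_comm, hω2, smul_add,
      ← mul_smul (QFun.z K q i j), smul_smul (t * _) t, smul_add]
    rfl
  have hE : (t * trRho ν (q : ℂ)) • Γ.expand Q = Γ.zMulDz - (t - 1) • Ω := by rw [hV]; abel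
  have hU' : Γ.dzMulZ = (t - 1) • (Γ.zMulDz + Ω) +
      t • swL ν (q : ℂ) (swR ν (q : ℂ) ((t * trRho ν (q : ℂ)) • Γ.expand Q)) := by
    rw [hU, show t * trRho ν (q : ℂ) * t = t * (t * trRho ν (q : ℂ)) by ring]
    simp only [map_smul, mul_smul]
  rw [FODC.BraidRel, hU', hE]
  simp only [gform, hW, map_smul, map_sub, swL_swR ν ν _ Ω, hΩs, swR_swR ν hq]
  have h1 : gcoef ν (q : ℂ) t * gden ν (q : ℂ) t = (t - 1) * (1 - t) := by
    rw [gcoef]; field_simp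
  have h2 : hcoef ν (q : ℂ) t * gden ν (q : ℂ) t = -((t - 1) * t * rmu ν (q : ℂ)) := by
    rw [hcoef]; field_simp
  simp only [smul_smul, h1, h2]
  module

theorem modelFODC_isGamma : (modelFODC ht hK hq1 hq2 hd).IsGamma ν t :=
  (FODC.isGamma_iff _ ν t).2
    ⟨ht, hd, modelFODC_isDzBasis ht hK hq1 hq2 hd, modelFODC_braidRel ht hK hq1 hq2 hd⟩

theorem modelFODC_op_qdet_smul (ρ : (modelFODC ht hK hq1 hq2 hd).Form) :
    op (qdet (q : ℂ) (QFun.z K q)) • ρ =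
      (t ^ 3 * rd ν (q : ℂ) 0 0 ^ 2) • (qdet (q : ℂ) (QFun.z K q) • ρ) := by
  have h1 : op (qdet (q : ℂ) (QFun.z K q)) • ρ = (Matrix.vecMul ρ
    (rightHom ht hK (qdet (q : ℂ) (QFun.z K q))) : Fin 3 × Fin 3 → QFun K q) := rfl
  have h2 : ∀ f : Fin 3 × Fin 3 → QFun K q, Matrix.vecMul f
      (rightHom ht hK (qdet (q : ℂ) (QFun.z K q))) =
      (t ^ 3 * rd ν (q : ℂ) 0 0 ^ 2) • (qdet (q : ℂ) (QFun.z K q) • f) := by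
    intro f
    rw [rightHom_qdet, Matrix.vecMul_smul]
    congr 1
    ext m
    rw [scalarHom_apply, Matrix.vecMul_diagonal, Pi.smul_apply, smul_eq_mul, QFun.qdet_comm]
  exact h1.trans (h2 ρ)

end Model

/-! ### Passage to SU_q(3) -/

section Projection
variable (q : ℝ)

theorem QFun.proj_z (i j : Fin 3) : QFun.proj q (QFun.z QKind.GL q i j) = QFun.z QKind.SL q i j := by
  rw [QFun.proj, QFun.lift_z]

theorem QFun.proj_surjective : Function.Surjective (QFun.proj q) := by
  intro a
  have : a ∈ (QFun.proj q).range := by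
    refine QFun.mem_of_z_mem (QFun.proj q).range
      (fun i j => (QFun.proj q).mem_range.2 ⟨_, QFun.proj_z q i j⟩)
      ((QFun.proj q).mem_range.2 ⟨QFun.detInv QKind.GL q, QFun.lift_detInv _⟩) a
  exact this

variable [NeZero q]

theorem QFun.proj_qdet : QFun.proj q (qdet (q : ℂ) (QFun.z QKind.GL q)) = 1 := by
  rw [map_qdet]
  simp only [QFun.proj_z]
  exact (QFun.isQPoint QKind.SL q).unimod rfl

variable {q}

/-- In a free left module, IΓ consists of the forms whose coordinates lie in the two-sided ideal I.
This makes the quotient by IΓ explicit. -/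
theorem mem_span_ker_smul_iff {H H' M ι : Type*} [Ring H] [Ring H'] [Algebra ℂ H] [Algebra ℂ H']
    [AddCommGroup M] [Module H M] [Fintype ι] (π : H →ₐ[ℂ] H') (b : Module.Basis ι H M) (ρ : M) :
    ρ ∈ Submodule.span H {x | ∃ (a : H) (ρ' : M), π a = 0 ∧ x = a • ρ'} ↔
      ∀ p, π (b.repr ρ p) = 0 := by
  constructor
  · intro h p
    induction h using Submodule.span_induction with
    | mem x hx => obtain ⟨a, ρ', ha, rfl⟩ := hx; simp [ha]
    | zero => simp
    | add x y _ _ hx hy => simp [hx, hy]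
    | smul a x _ hx => simp [hx]
  · intro h
    rw [← b.sum_repr ρ]
    exact Submodule.sum_mem _ fun p _ => Submodule.subset_span ⟨_, _, h p, rfl⟩

end Projection

namespace FODC
open MulOpposite
section Induce
variable {q : ℝ} [NeZero q] {Γ : FODC.{0, v} (QFun QKind.GL q)}
  {Γ' : FODC.{0, w} (QFun QKind.SL q)} {ν : Family}

theorem unimodular_iff (ν : Family) (t : ℝ) :
    (t : ℂ) ^ 3 * rd ν (q : ℂ) 0 0 ^ 2 = 1 ↔ Unimodular q ν t := by
  have hq := NeZero.ne q
  cases ν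
  · simp only [rd, if_true, Unimodular]
    norm_cast
    rw [inv_pow, mul_inv_eq_one₀ (pow_ne_zero _ hq)]
  · simp only [rd, if_true, Unimodular]
    norm_cast
    rw [mul_eq_one_iff_eq_inv₀ (pow_ne_zero _ hq)]

/-- In the model this is visible from the determinant of the structure matrices; the equivalence
with the model carries it over to every Γ_ν(t). -/
theorem IsGamma.op_qdet_smul (hq1 : q ≠ 1) (hq2 : q ≠ -1) {t : ℂ} (h : Γ.IsGamma ν t)
    (ρ : Γ.Form) :
    op (qdet (q : ℂ) (QFun.z QKind.GL q)) • ρ =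
      (t ^ 3 * rd ν (q : ℂ) 0 0 ^ 2) • (qdet (q : ℂ) (QFun.z QKind.GL q) • ρ) := by
  obtain ⟨ht, hd, hb, hr⟩ := (Γ.isGamma_iff ν t).1 h
  have hK : QKind.GL = QKind.SL → t ^ 3 * rd ν (q : ℂ) 0 0 ^ 2 = 1 := fun h => nomatch h
  obtain ⟨ζ, h1, h2, h3⟩ := (modelFODC_braidRel ht hK hq1 hq2 hd).equivalent
    (modelFODC_isDzBasis ht hK hq1 hq2 hd) hr hb
  obtain ⟨ρ, rfl⟩ := ζ.surjective ρ
  rw [← h2, modelFODC_op_qdet_smul ht hK hq1 hq2 hd, ← algebraMap_smul (QFun QKind.GL q), h1, h1,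
    algebraMap_smul]

theorem Induces.isDzBasis (h : Γ.Induces Γ') (hΓ : Γ.IsDzBasis) : Γ'.IsDzBasis := by
  obtain ⟨φ, hs, h1, h2, h3, h4⟩ := h
  have hz : ∀ i j, φ (Γ.d (QFun.z QKind.GL q i j)) = Γ'.d (QFun.z QKind.SL q i j) := fun i j => by
    rw [h3, QFun.proj_z]
  constructor
  · rw [Fintype.linearIndependent_iff]
    intro g hg p
    choose a ha using fun p => QFun.proj_surjective q (g p)
    have h5 : φ (∑ p : Fin 3 × Fin 3, a p • Γ.d (QFun.z QKind.GL q p.1 p.2)) = 0 := by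
      rw [← hg, map_sum]
      exact Finset.sum_congr rfl fun p _ => by rw [h1, ha, hz]
    rw [h4] at h5
    have h6 := (mem_span_ker_smul_iff (QFun.proj q) hΓ.basis _).1 h5 p
    have h7 : ∑ p : Fin 3 × Fin 3, a p • Γ.d (QFun.z QKind.GL q p.1 p.2) =
        ∑ p, a p • hΓ.basis p := Finset.sum_congr rfl fun p _ => by
      rw [← Prod.mk.eta (p := p), hΓ.basis_apply]
    rw [h7, Module.Basis.repr_sum_self] at h6
    rw [← ha]
    exact h6
  · rw [eq_top_iff]
    intro ρ _
    obtain ⟨ρ, rfl⟩ := hs ρ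
    rw [← hΓ.basis.sum_repr ρ, map_sum]
    refine Submodule.sum_mem _ fun p _ => ?_
    rw [h1, ← Prod.mk.eta (p := p), hΓ.basis_apply, hz]
    exact Submodule.smul_mem _ _ (Submodule.subset_span ⟨p, rfl⟩)

/-- In the quotient 𝒟 acts as 1 from both sides, so the image of θ⁰₀ is annihilated by t³ `rd`² - 1.
That image is nonzero: otherwise the coordinate 1 of θ⁰₀ would lie in I, against the counit of the
quotient. -/
theorem Induces.unimodular (hq1 : q ≠ 1) (hq2 : q ≠ -1) (h : Γ.Induces Γ') {t : ℝ}
    (hΓ : Γ.IsGamma ν (t : ℂ)) : Unimodular q ν t := by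
  have hb := ((Γ.isGamma_iff ν t).1 hΓ).2.2.1
  obtain ⟨φ, hs, h1, h2, h3, h4⟩ := h
  rw [← unimodular_iff]
  by_contra hne
  have h5 : φ (Γ.theta 0 0) = 0 := by
    have h6 := congrArg φ (hΓ.op_qdet_smul hq1 hq2 (Γ.theta 0 0))
    rw [h2, complex_smul_of_smul h1, h1, QFun.proj_qdet, op_one, one_smul, one_smul] at h6
    have h7 := sub_eq_zero.2 h6.symm
    nth_rewrite 2 [← one_smul ℂ (φ (Γ.theta 0 0))] at h7
    rw [← sub_smul] at h7
    exact (smul_eq_zero.1 h7).resolve_left (sub_ne_zero.2 hne)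
  rw [h4, ← hb.thetaBasis_apply] at h5
  have h8 := (mem_span_ker_smul_iff (QFun.proj q) hb.thetaBasis _).1 h5 (0, 0)
  rw [Module.Basis.repr_self, Finsupp.single_eq_same, map_one] at h8
  have h9 := congrArg (QFun.counitHom QKind.SL q) h8
  rw [map_one, map_zero] at h9
  exact one_ne_zero h9

theorem Induces.isGamma (h : Γ.Induces Γ') {t : ℂ} (hΓ : Γ.IsGamma ν t) : Γ'.IsGamma ν t := by
  obtain ⟨ht, hd, hb, hr⟩ := (Γ.isGamma_iff ν t).1 hΓ
  have hb' := h.isDzBasis hb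
  obtain ⟨φ, hs, h1, h2, h3, h4⟩ := h
  exact (Γ'.isGamma_iff ν t).2
    ⟨ht, hd, hb', IsOver.braidRel (QFun.proj_z q) ⟨h1, h2, h3⟩ hr⟩

/-- The map over the projection sends the basis dz to the basis dz. Hence it is onto, and its kernel
consists of the forms with coordinates in I. -/
theorem IsGamma.induces {t : ℂ} (h : Γ.IsGamma ν t) (h' : Γ'.IsGamma ν t) : Γ.Induces Γ' := by
  obtain ⟨ht, hd, hb, hr⟩ := (Γ.isGamma_iff ν t).1 h
  obtain ⟨-, -, hb', hr'⟩ := (Γ'.isGamma_iff ν t).1 h'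
  obtain ⟨φ, hφ⟩ := hr.exists_isOver hb hr' (QFun.proj q) (QFun.proj_z q)
  have hz : ∀ p, φ (hb.basis p) = hb'.basis p := fun p => by
    rw [← Prod.mk.eta (p := p), hb.basis_apply, hb'.basis_apply, hφ.d, QFun.proj_z]
  have hρ : ∀ ρ, φ ρ = ∑ p, QFun.proj q (hb.basis.repr ρ p) • hb'.basis p := fun ρ => by
    conv_lhs => rw [← hb.basis.sum_repr ρ, map_sum]
    exact Finset.sum_congr rfl fun p _ => by rw [hφ.smul, hz]
  refine ⟨φ, fun ρ' => ?_, hφ.smul, hφ.op_smul, hφ.d, fun ρ => ?_⟩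
  · choose a ha using fun p => QFun.proj_surjective q (hb'.basis.repr ρ' p)
    refine ⟨∑ p, a p • hb.basis p, ?_⟩
    rw [map_sum, ← hb'.basis.sum_repr ρ']
    exact Finset.sum_congr rfl fun p _ => by rw [hφ.smul, hz, ha]
  · refine Iff.trans ?_ (mem_span_ker_smul_iff (QFun.proj q) hb.basis ρ).symm
    rw [hρ]
    constructor
    · intro h p
      exact Fintype.linearIndependent_iff.1 hb'.basis.linearIndependent _ h p
    · intro h
      refine Finset.sum_eq_zero fun p _ => ?_
      have : QFun.proj q (hb.basis.repr ρ p) = 0 := h p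
      rw [this, zero_smul]

theorem exists_isGamma_GL (hq1 : q ≠ 1) (hq2 : q ≠ -1) {t : ℂ} (h : Admissible (q : ℂ) ν t) :
    ∃ Γ : FODC.{0, 0} (QFun QKind.GL q), Γ.IsGamma ν t := by
  obtain ⟨ht, hd⟩ := (admissible_iff ν (QFun.q_ne q) t).1 h
  have hK : QKind.GL = QKind.SL → t ^ 3 * rd ν (q : ℂ) 0 0 ^ 2 = 1 := fun h => nomatch h
  exact ⟨_, modelFODC_isGamma ht hK hq1 hq2 hd⟩

theorem exists_isGamma_SL (hq1 : q ≠ 1) (hq2 : q ≠ -1) {t : ℝ}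
    (h : Admissible (q : ℂ) ν (t : ℂ)) (hu : Unimodular q ν t) :
    ∃ Γ : FODC.{0, 0} (QFun QKind.SL q), Γ.IsGamma ν (t : ℂ) := by
  obtain ⟨ht, hd⟩ := (admissible_iff ν (QFun.q_ne q) t).1 h
  exact ⟨_, modelFODC_isGamma ht (fun _ => (unimodular_iff ν t).2 hu) hq1 hq2 hd⟩

theorem exists_unimodular (hq1 : q ≠ 1) (hq2 : q ≠ -1) (ν : Family) :
    ∃ t : ℝ, Unimodular q ν t ∧ Admissible (q : ℂ) ν (t : ℂ) := by
  have hq := NeZero.ne q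
  have hq3 : 0 < q ^ 2 := by positivity
  -- With y the real cube root of q², all even powers of q become powers of y, and admissibility is
  -- a question about a polynomial in y.
  obtain ⟨y, hy0, hy⟩ : ∃ y : ℝ, 0 < y ∧ y ^ 3 = q ^ 2 :=
    ⟨(q ^ 2) ^ ((1 : ℝ) / 3), Real.rpow_pos_of_pos hq3 _, by
      rw [← Real.rpow_natCast, ← Real.rpow_mul hq3.le]; norm_num⟩
  have hy1 : y ≠ 1 := by
    rintro rfl
    rw [one_pow] at hy
    rcases mul_self_eq_one_iff.1 ((sq q).symm.trans hy.symm) with h | h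
    · exact hq1 h
    · exact hq2 h
  have hy2 : y - 1 ≠ 0 := sub_ne_zero.2 hy1
  have h4 : q ^ 4 = y ^ 6 := by rw [show q ^ 4 = (q ^ 2) ^ 2 by ring, ← hy]; ring
  have h6 : q ^ 6 = y ^ 9 := by rw [show q ^ 6 = (q ^ 2) ^ 3 by ring, ← hy]; ring
  cases ν
  · refine ⟨y, hy, ?_, ?_⟩
    · exact_mod_cast hy0.ne'
    · have : (q ^ 6 + q ^ 4 + 1) * y - (q ^ 6 + q ^ 4 + q ^ 2) ≠ 0 := by
        rw [h6, h4, ← hy]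
        -- The polynomial vanishes to second order at y = 1, which is excluded by q ≠ ±1; the
        -- cofactor has positive coefficients.
        have h7 : 0 < y * (y ^ 6 + y ^ 5 + y ^ 4 + y ^ 3 + y ^ 2 + y + 1) +
          (y ^ 4 + y ^ 3 + y ^ 2 + y + 1) := by positivity
        have := mul_ne_zero (mul_ne_zero hy0.ne' (mul_ne_zero hy2 hy2)) h7.ne'
        convert this using 1
        ring
      exact_mod_cast this
  · refine ⟨y⁻¹, by simp only [Unimodular, inv_pow, hy], ?_, ?_⟩
    · exact_mod_cast (inv_pos.2 hy0).ne'
    · have : (q ^ 6 + q ^ 2 + 1) * y⁻¹ - (q ^ 4 + q ^ 2 + 1) ≠ 0 := by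
        rw [h6, h4, ← hy]
        have h7 : 0 < y ^ 3 * (y ^ 4 + y ^ 3 + y ^ 2 + y + 1) +
          (y ^ 6 + y ^ 5 + y ^ 4 + y ^ 3 + y ^ 2 + y + 1) := by positivity
        have := mul_ne_zero (mul_ne_zero (inv_pos.2 hy0).ne' (mul_ne_zero hy2 hy2)) h7.ne'
        convert this using 1
        field_simp
        ring
      exact_mod_cast this

end Induce
end FODC

theorem sum_swap₂ {M : Type*} [AddCommMonoid M] (f : Fin 3 → Fin 3 → Fin 3 → Fin 3 → M) :
    ∑ m, ∑ n, ∑ a, ∑ b, f m n a b = ∑ a, ∑ b, ∑ m, ∑ n, f m n a b := by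
  have := Finset.sum_comm (s := (Finset.univ : Finset (Fin 3 × Fin 3)))
    (t := (Finset.univ : Finset (Fin 3 × Fin 3))) (f := fun x y => f x.1 x.2 y.1 y.2)
  simpa only [Fintype.sum_prod_type] using this

/-! ### Complex coefficients of the right action, from the coactions -/

namespace FODC
open MulOpposite
section Coactions
variable {K : QKind} {q : ℝ} {Γ : FODC.{0, v} (QFun K q)}

/-- Compatibility of a linear map with the left coaction formula. -/
def IsLeftCoaction [NeZero q] (Γ : FODC.{0, v} (QFun K q))
    (ΔL : Γ.Form →ₗ[ℂ] QFun K q ⊗[ℂ] Γ.Form) : Prop := ∀ a b : QFun K q,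
  ΔL (a • Γ.d b) =
    Γ.actL (Coalgebra.comul (R := ℂ) a) (Γ.d.lTensor _ (Coalgebra.comul (R := ℂ) b))

/-- Compatibility of a linear map with the right coaction formula. -/
def IsRightCoaction [NeZero q] (Γ : FODC.{0, v} (QFun K q))
    (ΔR : Γ.Form →ₗ[ℂ] Γ.Form ⊗[ℂ] QFun K q) : Prop := ∀ a b : QFun K q,
  ΔR (a • Γ.d b) =
    Γ.actR (Coalgebra.comul (R := ℂ) a) (Γ.d.rTensor _ (Coalgebra.comul (R := ℂ) b))

variable [NeZero q]

namespace IsLeftCoaction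
variable {ΔL : Γ.Form →ₗ[ℂ] QFun K q ⊗[ℂ] Γ.Form} (h : Γ.IsLeftCoaction ΔL)
include h

theorem map_d (b : QFun K q) : ΔL (Γ.d b) = Γ.d.lTensor _ (Coalgebra.comul (R := ℂ) b) := by
  have := h 1 b
  rwa [one_smul, comul_one', actL_one] at this

theorem map_smul (a : QFun K q) (ρ : Γ.Form) :
    ΔL (a • ρ) = Γ.actL (Coalgebra.comul (R := ℂ) a) (ΔL ρ) := by
  have hρ : ρ ∈ Submodule.span (QFun K q) (Set.range Γ.d) := by rw [Γ.span_range_d]; trivial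
  induction hρ using Submodule.span_induction generalizing a with
  | mem x hx => obtain ⟨b, rfl⟩ := hx; rw [h, h.map_d]
  | zero => simp
  | add x y _ _ hx hy => rw [smul_add, map_add, hx, hy, map_add, map_add]
  | smul b x _ hx => rw [smul_smul, hx, hx, comul_mul', actL_mul]

/-- The definition of the coaction mentions left multiples only; the Leibniz rule rewrites a right
multiple of a differential in terms of these. -/
theorem map_op_smul_d (a b : QFun K q) : ΔL (op b • Γ.d a) =
    Γ.ractL (Coalgebra.comul (R := ℂ) b) (Γ.d.lTensor _ (Coalgebra.comul (R := ℂ) a)) := by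
  have h1 : op b • Γ.d a = Γ.d (a * b) - a • Γ.d b := by rw [Γ.leibniz]; abel
  rw [h1, map_sub, h, h.map_d, comul_mul', lTensor_d_mul]
  abel

end IsLeftCoaction

namespace IsRightCoaction
variable {ΔR : Γ.Form →ₗ[ℂ] Γ.Form ⊗[ℂ] QFun K q} (h : Γ.IsRightCoaction ΔR)
include h

theorem map_d (b : QFun K q) : ΔR (Γ.d b) = Γ.d.rTensor _ (Coalgebra.comul (R := ℂ) b) := by
  have := h 1 b
  rwa [one_smul, comul_one', actR_one] at this

theorem map_smul (a : QFun K q) (ρ : Γ.Form) :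
    ΔR (a • ρ) = Γ.actR (Coalgebra.comul (R := ℂ) a) (ΔR ρ) := by
  have hρ : ρ ∈ Submodule.span (QFun K q) (Set.range Γ.d) := by rw [Γ.span_range_d]; trivial
  induction hρ using Submodule.span_induction generalizing a with
  | mem x hx => obtain ⟨b, rfl⟩ := hx; rw [h, h.map_d]
  | zero => simp
  | add x y _ _ hx hy => rw [smul_add, map_add, hx, hy, map_add, map_add]
  | smul b x _ hx => rw [smul_smul, hx, hx, comul_mul', actR_mul]

theorem map_op_smul_d (a b : QFun K q) : ΔR (op b • Γ.d a) =
    Γ.ractR (Coalgebra.comul (R := ℂ) b) (Γ.d.rTensor _ (Coalgebra.comul (R := ℂ) a)) := by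
  have h1 : op b • Γ.d a = Γ.d (a * b) - a • Γ.d b := by rw [Γ.leibniz]; abel
  rw [h1, map_sub, h, h.map_d, comul_mul', rTensor_d_mul]
  abel

end IsRightCoaction

variable (hΓ : Γ.IsDzBasis)
include hΓ

theorem IsDzBasis.counitCoord_d_z (m n k j : Fin 3) :
    hΓ.counitCoord m n (Γ.d (QFun.z K q k j)) = if k = m then if j = n then 1 else 0 else 0 := by
  rw [d_z, map_sum]
  simp only [hΓ.counitCoord_smul, QFun.counitHom_z, hΓ.counitCoord_theta]
  simp
  split_ifs <;> rfl

theorem counitCoord_actL (m n : Fin 3) (x : QFun K q ⊗[ℂ] QFun K q) (y : QFun K q ⊗[ℂ] Γ.Form) :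
    TensorProduct.rid ℂ _ ((hΓ.counitCoord m n).lTensor _ (Γ.actL x y)) =
      TensorProduct.rid ℂ _ ((Coalgebra.counit (R := ℂ) (A := QFun K q)).lTensor _ x) *
        TensorProduct.rid ℂ _ ((hΓ.counitCoord m n).lTensor _ y) := by
  induction x with
  | zero => simp
  | add x x' hx hx' => simp only [map_add, LinearMap.add_apply, hx, hx', add_mul]
  | tmul a b =>
    induction y with
    | zero => simp
    | add x x' hx hx' => simp only [map_add, hx, hx', mul_add]
    | tmul c ρ =>
      simp only [actL_tmul, LinearMap.lTensor_tmul, TensorProduct.rid_tmul, hΓ.counitCoord_smul,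
        smul_mul_smul_comm, QFun.counit_eq]

theorem counitCoord_actR (m n : Fin 3) (x : QFun K q ⊗[ℂ] QFun K q) (y : Γ.Form ⊗[ℂ] QFun K q) :
    TensorProduct.lid ℂ _ ((hΓ.counitCoord m n).rTensor _ (Γ.actR x y)) =
      TensorProduct.lid ℂ _ ((Coalgebra.counit (R := ℂ) (A := QFun K q)).rTensor _ x) *
        TensorProduct.lid ℂ _ ((hΓ.counitCoord m n).rTensor _ y) := by
  induction x with
  | zero => simp
  | add x x' hx hx' => simp only [map_add, LinearMap.add_apply, hx, hx', add_mul]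
  | tmul a b =>
    induction y with
    | zero => simp
    | add x x' hx hx' => simp only [map_add, hx, hx', mul_add]
    | tmul ρ c =>
      simp only [actR_tmul, LinearMap.rTensor_tmul, TensorProduct.lid_tmul, hΓ.counitCoord_smul,
        smul_mul_smul_comm, QFun.counit_eq]

/-- For the dz this is a direct computation. It extends to Γ because applying the counit to the
second leg of Δ(b) returns b, so that both sides are left linear. -/
theorem IsLeftCoaction.repr_eq {ΔL : Γ.Form →ₗ[ℂ] QFun K q ⊗[ℂ] Γ.Form}
    (h : Γ.IsLeftCoaction ΔL) (m n : Fin 3) (ρ : Γ.Form) :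
    hΓ.thetaBasis.repr ρ (m, n) =
      TensorProduct.rid ℂ _ ((hΓ.counitCoord m n).lTensor _ (ΔL ρ)) := by
  have key : ∀ i j, hΓ.thetaBasis.repr (Γ.d (QFun.z K q i j)) (m, n) =
      TensorProduct.rid ℂ _ ((hΓ.counitCoord m n).lTensor _ (ΔL (Γ.d (QFun.z K q i j)))) := by
    intro i j
    rw [h.map_d, comul_z, d_z]
    simp only [← hΓ.thetaBasis_apply, map_sum, _root_.map_smul, Module.Basis.repr_self,
      LinearMap.lTensor_tmul, TensorProduct.rid_tmul, hΓ.counitCoord_d_z]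
    simp [Finsupp.single_apply, Prod.mk.injEq, ite_and]
  have hρ : ρ ∈ Submodule.span (QFun K q)
      (Set.range fun p : Fin 3 × Fin 3 => Γ.d (QFun.z K q p.1 p.2)) := by rw [hΓ.2]; trivial
  induction hρ using Submodule.span_induction with
  | mem x hx =>
    obtain ⟨⟨i, j⟩, rfl⟩ := hx
    exact key i j
  | zero => simp
  | add x y _ _ hx hy => simp only [map_add, Finsupp.add_apply, hx, hy]
  | smul b x _ hx =>
    rw [h.map_smul, counitCoord_actL, ← hx, Coalgebra.lTensor_counit_comul, TensorProduct.rid_tmul,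
      one_smul]
    simp

/-- The coefficients of the right action on the left-invariant forms. -/
noncomputable def IsDzBasis.coeff : Quad (Fin 3 → Fin 3 → ℂ) := fun a b j l m n =>
  hΓ.counitCoord m n (Γ.dzMulZ a b j l)

/-- The left-invariant forms with given coefficients. -/
noncomputable def toForms (Γ : FODC.{0, v} (QFun K q)) :
    (Fin 3 → Fin 3 → ℂ) →ₗ[ℂ] Γ.Form where
  toFun f := ∑ m, ∑ n, f m n • Γ.theta m n
  map_add' f g := by simp [add_smul, Finset.sum_add_distrib]
  map_smul' c f := by simp [Finset.smul_sum, smul_smul]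

/-- The left coaction of dz z has the products zz in its first leg. Applying the complex-valued
`counitCoord` to the second leg turns the coordinates into complex combinations of zz; this is where
left covariance makes the coefficients constant. -/
theorem IsDzBasis.dzMulZ_eq_expand {ΔL : Γ.Form →ₗ[ℂ] QFun K q ⊗[ℂ] Γ.Form}
    (h : Γ.IsLeftCoaction ΔL) :
    Γ.dzMulZ = Γ.expand fun a b j l => Γ.toForms (hΓ.coeff a b j l) := by
  ext i k j l
  rw [← hΓ.thetaBasis.sum_repr (Γ.dzMulZ i k j l), Fintype.sum_prod_type]
  simp only [h.repr_eq hΓ, hΓ.thetaBasis_apply]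
  have h1 : ∀ m n, TensorProduct.rid ℂ _ ((hΓ.counitCoord m n).lTensor _ (ΔL (Γ.dzMulZ i k j l))) =
      ∑ a, ∑ b, hΓ.coeff a b j l m n • (QFun.z K q i a * QFun.z K q k b) := fun m n => by
    rw [dzMulZ, h.map_op_smul_d]
    simp only [comul_z, map_sum, LinearMap.lTensor_tmul, LinearMap.sum_apply, ractL_tmul,
      TensorProduct.rid_tmul, IsDzBasis.coeff, dzMulZ]
  simp only [h1, expand_apply, toForms, LinearMap.coe_mk, AddHom.coe_mk, Finset.sum_smul,
    Finset.smul_sum]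
  rw [sum_swap₂]
  refine Finset.sum_congr rfl fun a _ => Finset.sum_congr rfl fun b _ =>
    Finset.sum_congr rfl fun m _ => Finset.sum_congr rfl fun n _ => ?_
  rw [smul_assoc, smul_comm]

theorem IsRightCoaction.coord_smul {ΔR : Γ.Form →ₗ[ℂ] Γ.Form ⊗[ℂ] QFun K q}
    (h : Γ.IsRightCoaction ΔR) (m n : Fin 3) (a : QFun K q) (ρ : Γ.Form) :
    TensorProduct.lid ℂ _ ((hΓ.counitCoord m n).rTensor _ (ΔR (a • ρ))) =
      a * TensorProduct.lid ℂ _ ((hΓ.counitCoord m n).rTensor _ (ΔR ρ)) := by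
  rw [h.map_smul, counitCoord_actR, Coalgebra.rTensor_counit_comul, TensorProduct.lid_tmul, one_smul]

theorem IsRightCoaction.coord_d_z {ΔR : Γ.Form →ₗ[ℂ] Γ.Form ⊗[ℂ] QFun K q}
    (h : Γ.IsRightCoaction ΔR) (m n i j : Fin 3) :
    TensorProduct.lid ℂ _ ((hΓ.counitCoord m n).rTensor _ (ΔR (Γ.d (QFun.z K q i j)))) =
      if i = m then QFun.z K q n j else 0 := by
  rw [h.map_d, comul_z]
  simp only [map_sum, LinearMap.rTensor_tmul, TensorProduct.lid_tmul, hΓ.counitCoord_d_z]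
  split_ifs <;> simp

theorem IsRightCoaction.coord_theta {ΔR : Γ.Form →ₗ[ℂ] Γ.Form ⊗[ℂ] QFun K q}
    (h : Γ.IsRightCoaction ΔR) (m n i j : Fin 3) :
    TensorProduct.lid ℂ _ ((hΓ.counitCoord m n).rTensor _ (ΔR (Γ.theta i j))) =
      QFun.S K q i m * QFun.z K q n j := by
  rw [theta_eq]
  simp only [map_sum, h.coord_smul hΓ, h.coord_d_z hΓ]
  simp

/-- The right coaction of dz z, with `counitCoord` applied to its first leg, is computed twice: from
the product of the coactions, and from the expansion in θ, on which the coaction is the adjoint one.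
-/
theorem IsRightCoaction.coeff_eq {ΔL : Γ.Form →ₗ[ℂ] QFun K q ⊗[ℂ] Γ.Form}
    (hL : Γ.IsLeftCoaction ΔL) {ΔR : Γ.Form →ₗ[ℂ] Γ.Form ⊗[ℂ] QFun K q}
    (h : Γ.IsRightCoaction ΔR) (i k j l m n : Fin 3) :
    ∑ a, ∑ b, QFun.z K q i a * QFun.z K q k b *
        ∑ m', ∑ n', hΓ.coeff a b j l m' n' • (QFun.S K q m' m * QFun.z K q n n') =
      ∑ p, ∑ r, hΓ.coeff i k p r m n • (QFun.z K q p j * QFun.z K q r l) := by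
  have e1 : TensorProduct.lid ℂ _ ((hΓ.counitCoord m n).rTensor _ (ΔR (Γ.dzMulZ i k j l))) =
      ∑ p, ∑ r, hΓ.coeff i k p r m n • (QFun.z K q p j * QFun.z K q r l) := by
    rw [dzMulZ, h.map_op_smul_d]
    simp only [comul_z, map_sum, LinearMap.rTensor_tmul, LinearMap.sum_apply, ractR_tmul,
      TensorProduct.lid_tmul, IsDzBasis.coeff, dzMulZ]
  rw [← e1, hΓ.dzMulZ_eq_expand hL, expand_apply]
  simp only [map_sum, h.coord_smul hΓ, toForms, LinearMap.coe_mk, AddHom.coe_mk, _root_.map_smul,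
    h.coord_theta hΓ]

end Coactions
end FODC

/-! ### Coinvariant tensors -/

section Tensors
variable {M N : Type*} [AddCommGroup M] [Module ℂ M] [AddCommGroup N] [Module ℂ N]

theorem map_swL_apply (T : M →ₗ[ℂ] N) (ν : FODC.Family) (q : ℂ) (y : Quad M) (a b j l : Fin 3) :
    T (swL ν q y a b j l) = swL ν q (fun a b j l => T (y a b j l)) a b j l := by
  simp only [swL_apply, map_add, map_smul]

theorem map_swR_apply (T : M →ₗ[ℂ] N) (ν : FODC.Family) (q : ℂ) (y : Quad M) (a b j l : Fin 3) :
    T (swR ν q y a b j l) = swR ν q (fun a b j l => T (y a b j l)) a b j l := by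
  simp only [swR_apply, map_add, map_smul]

end Tensors

section Coinvariants
variable {K : QKind} {q : ℝ}

/-- The linear extension of `θᵃᵦ ↦ S(zᵃₘ) zⁿᵦ`. -/
noncomputable def adCoaction (K : QKind) (q : ℝ) (m n : Fin 3) :
    (Fin 3 → Fin 3 → ℂ) →ₗ[ℂ] QFun K q where
  toFun f := ∑ m', ∑ n', f m' n' • (QFun.S K q m' m * QFun.z K q n n')
  map_add' f g := by simp [add_smul, Finset.sum_add_distrib]
  map_smul' c f := by simp [Finset.smul_sum, smul_smul]

/-- Evaluation of the last two indices. -/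
def evalTwo (m n : Fin 3) : (Fin 3 → Fin 3 → ℂ) →ₗ[ℂ] ℂ where
  toFun f := f m n
  map_add' _ _ := rfl
  map_smul' _ _ := rfl

/-- The coefficient tensors that are compatible with the right coaction. -/
def IsCoinv (K : QKind) (q : ℝ) (c : Quad (Fin 3 → Fin 3 → ℂ)) : Prop := ∀ m n,
  conv (LinearMap.mul ℂ (QFun K q)) (prodQuad (QFun.z K q))
      (fun a b j l => adCoaction K q m n (c a b j l)) =
    conv (LinearMap.lsmul ℂ (QFun K q)) (fun a b j l => evalTwo m n (c a b j l))
      (prodQuad (QFun.z K q))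

namespace IsCoinv
variable {c c' : Quad (Fin 3 → Fin 3 → ℂ)}

theorem add (h : IsCoinv K q c) (h' : IsCoinv K q c') : IsCoinv K q (c + c') := fun m n => by
  have e := congrArg₂ (· + ·) (h m n) (h' m n)
  simp only [← conv_add, ← conv_add_left] at e
  simp only [Pi.add_apply, map_add]
  exact e

theorem smul (h : IsCoinv K q c) (r : ℂ) : IsCoinv K q (r • c) := fun m n => by
  have e := congrArg (r • ·) (h m n)
  simp only [Pi.smul_apply, map_smul]
  exact (conv_smul _ _ _ _).trans (e.trans (conv_smul_left _ _ _ _).symm)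

variable [NeZero q]

/-- Coinvariance intertwines two contractions with ZZ. The braid operator passes through both, by
the RTT relation on one side and trivially on the other. -/
theorem swL (h : IsCoinv K q c) (ν : FODC.Family) : IsCoinv K q (swL ν (q : ℂ) c) := fun m n => by
  have hx := (QFun.isQPoint K q).toIsQMatrix.swL_prodQuad (QFun.q_ne q) ν
  have e := congrArg (_root_.swL ν (q : ℂ)) (h m n)
  rw [swL_conv, swL_conv, hx, conv_swR] at e
  simp only [map_swL_apply]
  exact e

theorem swR (h : IsCoinv K q c) (ν : FODC.Family) : IsCoinv K q (swR ν (q : ℂ) c) := fun m n => by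
  have hx := (QFun.isQPoint K q).toIsQMatrix.swL_prodQuad (QFun.q_ne q) ν
  have e := congrArg (_root_.swR ν (q : ℂ)) (h m n)
  rw [swR_conv, swR_conv, ← hx, ← conv_swR] at e
  simp only [map_swR_apply]
  exact e

end IsCoinv

theorem isCoinv_iff (c : Quad (Fin 3 → Fin 3 → ℂ)) : IsCoinv K q c ↔ ∀ i k j l m n,
    ∑ a, ∑ b, QFun.z K q i a * QFun.z K q k b *
        ∑ m', ∑ n', c a b j l m' n' • (QFun.S K q m' m * QFun.z K q n n') =
      ∑ p, ∑ r, c i k p r m n • (QFun.z K q p j * QFun.z K q r l) :=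
  ⟨fun h i k j l m n => congrFun (congrFun (congrFun (congrFun (h m n) i) k) j) l,
    fun h m n => by ext i k j l; exact h i k j l m n⟩

/-- The coefficients of `zⁱⱼ dzᵏₗ`. -/
def tensorDz : Quad (Fin 3 → Fin 3 → ℂ) := fun a b j l m n =>
  if a = j then if b = m then if l = n then 1 else 0 else 0 else 0

/-- The coefficients of `zⁱⱼ zᵏₗ Tr_q θ`. -/
def tensorTr (q : ℂ) : Quad (Fin 3 → Fin 3 → ℂ) := fun a b j l m n =>
  if a = j then if b = l then if m = n then trWeight q m else 0 else 0 else 0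

variable [NeZero q]

theorem isCoinv_tensorDz : IsCoinv K q tensorDz := by
  rw [isCoinv_iff]
  intro i k j l m n
  have h1 : ∀ a b, ∑ m', ∑ n', tensorDz a b j l m' n' • (QFun.S K q m' m * QFun.z K q n n') =
      if a = j then QFun.S K q b m * QFun.z K q n l else 0 := fun a b => by
    by_cases h : a = j <;> simp [tensorDz, h, ite_smul]
  have h2 : ∑ p, ∑ r, tensorDz i k p r m n • (QFun.z K q p j * QFun.z K q r l) =
      if k = m then QFun.z K q i j * QFun.z K q n l else 0 := by
    by_cases h : k = m <;> simp [tensorDz, h, ite_smul]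
  have h3 : ∑ b, QFun.z K q i j * QFun.z K q k b * (QFun.S K q b m * QFun.z K q n l) =
      QFun.z K q i j * (∑ b, QFun.z K q k b * QFun.S K q b m) * QFun.z K q n l := by
    simp only [Finset.mul_sum, Finset.sum_mul, mul_assoc]
  rw [FODC.sum_z_mul_S] at h3
  simp only [h1, h2]
  rw [Finset.sum_comm]
  simp only [mul_ite, mul_zero, Finset.sum_ite_eq', Finset.mem_univ, if_true, h3]
  split_ifs <;> simp

/-- The adjoint coaction fixes the quantum trace by `sum_weight_S_mul_z`; what remains is zz on both
sides. -/
theorem isCoinv_tensorTr : IsCoinv K q (tensorTr q) := by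
  rw [isCoinv_iff]
  intro i k j l m n
  have h := FODC.sum_weight_S_mul_z (K := K) (q := q) m n
  have h1 : ∀ a b, ∑ m', ∑ n', tensorTr q a b j l m' n' • (QFun.S K q m' m * QFun.z K q n n') =
      if a = j then if b = l then if m = n then trWeight (q : ℂ) m • 1 else 0 else 0 else 0 :=
    fun a b => by
      rw [trWeight, ← h]
      by_cases ha : a = j <;> by_cases hb : b = l <;>
        simp [tensorTr, ha, hb, trWeight, Fin.sum_univ_three]
  have h2 : ∑ p, ∑ r, tensorTr q i k p r m n • (QFun.z K q p j * QFun.z K q r l) =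
      if m = n then trWeight (q : ℂ) m • (QFun.z K q i j * QFun.z K q k l) else 0 := by
    by_cases hm : m = n <;> simp [tensorTr, hm, ite_smul]
  simp only [h1, h2]
  by_cases hm : m = n <;> simp [hm]

end Coinvariants

/-! ### Two-dimensional triangular representations -/

section Representations
variable {q : ℂ}

/-- Two-dimensional upper triangular matrices with one off-diagonal generator. -/
def triMat (s s' : Fin 3) (d d' : Fin 3 → ℂ) (κ : ℂ) (i j : Fin 3) : Matrix (Fin 2) (Fin 2) ℂ :=
  !![if i = j then d i else 0, if i = s then if j = s' then κ else 0 else 0;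
    0, if i = j then d' i else 0]

section Entries
variable (s s' : Fin 3) (d d' : Fin 3 → ℂ) (κ : ℂ) (i j : Fin 3)
theorem triMat_zero_zero : triMat s s' d d' κ i j 0 0 = if i = j then d i else 0 := rfl
theorem triMat_zero_one :
    triMat s s' d d' κ i j 0 1 = if i = s then if j = s' then κ else 0 else 0 := rfl
theorem triMat_one_zero : triMat s s' d d' κ i j 1 0 = 0 := rfl
theorem triMat_one_one : triMat s s' d d' κ i j 1 1 = if i = j then d' i else 0 := rfl
end Entries

theorem triMat_transpose (s s' : Fin 3) (d d' : Fin 3 → ℂ) (κ : ℂ) :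
    triMat s' s d d' κ = fun i j => triMat s s' d d' κ j i := by
  ext i j : 2
  simp only [triMat]
  by_cases h : i = j
  · subst h; by_cases h1 : i = s <;> by_cases h2 : i = s' <;> simp [h1, h2]
  · have h' : ¬ j = i := fun e => h e.symm
    simp only [if_neg h, if_neg h']
    by_cases h1 : j = s <;> by_cases h2 : i = s' <;> simp [h1, h2]

-- The diagonal generators act by powers of q on two weight vectors and z⁰₁ maps one vector to the
-- other. Its off-diagonal matrix coefficient plays the role of a simple root vector; transposition
-- gives the opposite root.
set_option maxHeartbeats 1000000 in
theorem isQMatrix_triMat_zero_one (hq : q ≠ 0) :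
    IsQMatrix q (triMat 0 1 ![q, 1, 1] ![1, q, 1] 1) := by
  constructor
  · intro i j k h
    fin_cases j <;> fin_cases k <;> first
    | exact absurd h (by decide)
    | fin_cases i <;> simp [triMat] <;> (ext a; fin_cases a <;> rfl)
  · intro i j k h
    fin_cases i <;> fin_cases k <;> first
    | exact absurd h (by decide)
    | fin_cases j <;> simp [triMat] <;> (ext a; fin_cases a <;> rfl)
  · intro i j k l h h'
    fin_cases i <;> fin_cases k <;> first
    | exact absurd h (by decide)
    | fin_cases j <;> fin_cases l <;> first
      | exact absurd h' (by decide)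
      | simp [triMat] <;> (ext a; fin_cases a <;> rfl)
  · intro i j k l h h'
    fin_cases i <;> fin_cases k <;> first
    | exact absurd h (by decide)
    | fin_cases j <;> fin_cases l <;> first
      | exact absurd h' (by decide)
      | simp [triMat] <;> (ext a; fin_cases a <;> rfl)

set_option maxHeartbeats 1000000 in
theorem isQMatrix_triMat_one_two (hq : q ≠ 0) :
    IsQMatrix q (triMat 1 2 ![1, q, 1] ![1, 1, q] 1) := by
  constructor
  · intro i j k h
    fin_cases j <;> fin_cases k <;> first
    | exact absurd h (by decide)
    | fin_cases i <;> simp [triMat] <;> (ext a; fin_cases a <;> rfl)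
  · intro i j k h
    fin_cases i <;> fin_cases k <;> first
    | exact absurd h (by decide)
    | fin_cases j <;> simp [triMat] <;> (ext a; fin_cases a <;> rfl)
  · intro i j k l h h'
    fin_cases i <;> fin_cases k <;> first
    | exact absurd h (by decide)
    | fin_cases j <;> fin_cases l <;> first
      | exact absurd h' (by decide)
      | simp [triMat] <;> (ext a; fin_cases a <;> rfl)
  · intro i j k l h h'
    fin_cases i <;> fin_cases k <;> first
    | exact absurd h (by decide)
    | fin_cases j <;> fin_cases l <;> first
      | exact absurd h' (by decide)
      | simp [triMat] <;> (ext a; fin_cases a <;> rfl)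

theorem qdet_triMat_zero_one :
    qdet q (triMat 0 1 ![q, 1, 1] ![1, q, 1] 1) = q • 1 := by
  ext a b; fin_cases a <;> fin_cases b <;> simp [qdet, triMat]

theorem qdet_triMat_one_two :
    qdet q (triMat 1 2 ![1, q, 1] ![1, 1, q] 1) = q • 1 := by
  ext a b; fin_cases a <;> fin_cases b <;> simp [qdet, triMat]

/-- The data of a two-dimensional representation of the quantum matrices of determinant `q`. -/
structure IsTriRep (q : ℂ) (s s' : Fin 3) (d d' : Fin 3 → ℂ) : Prop where
  isQMatrix : IsQMatrix q (triMat s s' d d' 1)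
  qdet : qdet q (triMat s s' d d' 1) = q • 1
  left_ne : ∀ i, d i ≠ 0
  right_ne : ∀ i, d' i ≠ 0
  ne : s ≠ s'

theorem IsTriRep.transpose {s s' : Fin 3} {d d' : Fin 3 → ℂ} (hq : q ≠ 0)
    (h : IsTriRep q s s' d d') : IsTriRep q s' s d d' where
  isQMatrix := by rw [triMat_transpose]; exact h.isQMatrix.transpose
  qdet := by rw [triMat_transpose, h.isQMatrix.qdet_transpose hq, h.qdet]
  left_ne := h.left_ne
  right_ne := h.right_ne
  ne := h.ne.symm

theorem isTriRep_zero_one (hq : q ≠ 0) : IsTriRep q 0 1 ![q, 1, 1] ![1, q, 1] where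
  isQMatrix := isQMatrix_triMat_zero_one hq
  qdet := qdet_triMat_zero_one
  left_ne i := by fin_cases i <;> simp [hq]
  right_ne i := by fin_cases i <;> simp [hq]
  ne := by decide

theorem isTriRep_one_two (hq : q ≠ 0) : IsTriRep q 1 2 ![1, q, 1] ![1, 1, q] where
  isQMatrix := isQMatrix_triMat_one_two hq
  qdet := qdet_triMat_one_two
  left_ne i := by fin_cases i <;> simp [hq]
  right_ne i := by fin_cases i <;> simp [hq]
  ne := by decide

end Representations

theorem QFun.map_S {K : QKind} {q : ℝ} [NeZero q] {R : Type*} [Ring R] [Algebra ℂ R]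
    (f : QFun K q →ₐ[ℂ] R) {Y : Fin 3 → Fin 3 → R}
    (h : ∀ i j, ∑ k, f (QFun.z K q i k) * Y k j = if i = j then 1 else 0) (i j : Fin 3) :
    f (QFun.S K q i j) = Y i j := by
  have h1 : ∑ k, f (QFun.S K q i k) * (∑ l, f (QFun.z K q k l) * Y l j) = Y i j := by
    simp only [Finset.mul_sum, ← mul_assoc]
    rw [Finset.sum_comm]
    simp only [← Finset.sum_mul, ← map_mul, ← map_sum, FODC.sum_S_mul_z]
    simp [apply_ite f]
  rw [← h1]
  simp [h]

/-! ### Testing coinvariance on representations -/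

section Vanishing
variable {q : ℝ} [NeZero q] {c : Quad (Fin 3 → Fin 3 → ℂ)}

theorem IsCoinv.apply_algHom {K : QKind} (hc : IsCoinv K q c) {R : Type*} [Ring R] [Algebra ℂ R]
    (f : QFun K q →ₐ[ℂ] R) (i k j l m n : Fin 3) :
    ∑ a, ∑ b, ∑ m', ∑ n', c a b j l m' n' • (f (QFun.z K q i a) * f (QFun.z K q k b) *
        (f (QFun.S K q m' m) * f (QFun.z K q n n'))) =
      ∑ p, ∑ r, c i k p r m n • (f (QFun.z K q p j) * f (QFun.z K q r l)) := by
  have := congrArg f ((isCoinv_iff c).1 hc i k j l m n)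
  simpa only [map_sum, map_mul, map_smul, Finset.mul_sum, mul_smul_comm] using this

theorem isQPoint_diag (x : Fin 3 → ℂ) (hx : ∀ i, x i ≠ 0) :
    IsQPoint QKind.GL (q : ℂ) (fun i j => if i = j then x i else 0) (x 0 * x 1 * x 2)⁻¹ := by
  have hm : IsQMatrix (q : ℂ) (fun i j => if i = j then x i else 0) := by
    constructor
    · intro i j k h
      by_cases h1 : i = j
      · subst h1; simp [h.ne]
      · simp [h1]
    · intro i j k h
      by_cases h1 : i = j
      · subst h1; simp [h.ne']
      · simp [h1]
    · intro i j k l _ _; ring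
    · intro i j k l h h'
      by_cases h1 : k = j
      · subst h1; simp [h.ne, h'.ne, (h.trans h').ne]
      · simp [h1, mul_comm]
  have := hm.isQPoint_of_qdet (K := QKind.GL) (c := x 0 * x 1 * x 2)
    (mul_ne_zero (mul_ne_zero (hx 0) (hx 1)) (hx 2)) (by simp [qdet]) (by simp)
  simpa using this

/-- A coinvariant coefficient is homogeneous for the torus. -/
theorem IsCoinv.weight (hc : IsCoinv QKind.GL q c) (x : Fin 3 → ℂ) (hx : ∀ i, x i ≠ 0)
    (i k j l m n : Fin 3) :
    (x i * x k * x n - x j * x l * x m) * c i k j l m n = 0 := by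
  have hS : ∀ i j, QFun.lift (isQPoint_diag x hx) (QFun.S QKind.GL q i j) =
      if i = j then (x i)⁻¹ else 0 := by
    refine QFun.map_S _ fun i j => ?_
    simp only [QFun.lift_z]
    by_cases h : i = j <;> simp [h, hx]
  have e := hc.apply_algHom (QFun.lift (isQPoint_diag x hx)) i k j l m n
  simp only [QFun.lift_z, hS] at e
  simp at e
  have hm := hx m
  rcases e with e | e
  · rw [← e, show x i * x k * x n - x i * x k * ((x m)⁻¹ * x n) * x m =
      x i * x k * x n * (1 - (x m)⁻¹ * x m) by ring, inv_mul_cancel₀ hm]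
    ring
  · rw [e, mul_zero]

/-- The off-diagonal entry of the coinvariance identity in a triangular representation is a twisted
Leibniz rule: one index s' among j, l, m is replaced by s at a time. The terms in which no lower
index j, l, m changes contain the column (j,l,m), which vanishes by assumption. -/
theorem IsCoinv.column (hc : IsCoinv QKind.GL q c) {s s' : Fin 3} {d d' : Fin 3 → ℂ}
    (hr : IsTriRep (q : ℂ) s s' d d') {j l m : Fin 3} (h0 : ∀ a b n, c a b j l m n = 0)
    (i k n : Fin 3) :
    (if m = s' then -(d i * d k * (d s)⁻¹ * (d' s')⁻¹ * d' n) * c i k j l s n else 0) =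
      (if j = s' then d' l * c i k s l m n else 0) + if l = s' then d j * c i k j s m n else 0 := by
  have hp := hr.isQMatrix.isQPoint_of_qdet (K := QKind.GL) (QFun.q_ne q) hr.qdet (by simp)
  have hS : ∀ i j, QFun.lift hp (QFun.S QKind.GL q i j) =
      triMat s s' (fun i => (d i)⁻¹) (fun i => (d' i)⁻¹) (-((d s)⁻¹ * (d' s')⁻¹)) i j := by
    refine QFun.map_S _ fun i j => ?_
    simp only [QFun.lift_z]
    ext a b
    have h1 := hr.left_ne
    have h2 := hr.right_ne
    have h3 := hr.ne
    rw [show ((if i = j then 1 else 0 : Matrix (Fin 2) (Fin 2) ℂ)) a b =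
      if i = j then if a = b then 1 else 0 else 0 by split_ifs <;> simp_all [Matrix.one_apply]]
    revert a b
    have h4 : ∀ x y, (if x = y then d x * (d y)⁻¹ else 0) = if x = y then 1 else 0 := fun x y => by
      split_ifs with e <;> simp [e, h1]
    have h5 : ∀ x y, (if x = y then d' x * (d' y)⁻¹ else 0) = if x = y then 1 else 0 :=
      fun x y => by split_ifs with e <;> simp [e, h2]
    simp only [Fin.forall_fin_two, Fin.isValue, Matrix.sum_apply, Matrix.mul_apply,
      Fin.sum_univ_two, triMat_zero_zero, triMat_zero_one, triMat_one_zero, triMat_one_one]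
    by_cases hi : i = s <;> by_cases hj : j = s' <;>
      simp [hi, hj, h1, h2, h3, h3.symm, h4, h5, Finset.sum_add_distrib]
  have e := congrFun (congrFun (hc.apply_algHom (QFun.lift hp) i k j l m n) 0) 1
  simp only [QFun.lift_z, hS] at e
  simp only [Matrix.sum_apply, Matrix.smul_apply, Matrix.mul_apply, Fin.sum_univ_two, triMat_zero_zero,
    triMat_zero_one, triMat_one_zero, triMat_one_one, smul_eq_mul, mul_add, add_mul,
    Finset.sum_add_distrib, mul_zero, zero_mul, zero_add, add_zero, mul_ite, ite_mul] at e
  simp at e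
  rw [Finset.sum_eq_zero] at e
  · rw [show (if n = s then c i k j l m s' * (d i * d k * (d m)⁻¹) else 0) = 0 by simp [h0]] at e
    rw [zero_add, add_zero] at e
    convert e using 1
    · split_ifs <;> ring
    · rw [add_comm]
      congr 1 <;> split_ifs <;> ring
  · intro x _
    refine Finset.sum_eq_zero fun y _ => Finset.sum_eq_zero fun w _ => ?_
    by_cases hw : w = m
    · subst hw; simp [h0]
    · simp [hw]

end Vanishing

/-! ### Classification of the coinvariants -/

section Classification
variable {q : ℝ} [NeZero q] {c : Quad (Fin 3 → Fin 3 → ℂ)}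

/-- Vanishing of the coefficients with three given lower indices. -/
def ColZero (c : Quad (Fin 3 → Fin 3 → ℂ)) (j l m : Fin 3) : Prop := ∀ a b n, c a b j l m n = 0

namespace ColZero
variable {s s' : Fin 3} {d d' : Fin 3 → ℂ} {j l m : Fin 3}

theorem stepJ (h : ColZero c j l m) (hc : IsCoinv QKind.GL q c) (hr : IsTriRep (q : ℂ) s s' d d')
    (hj : j = s') (hl : l = s' → ColZero c j s m) (hm : m = s' → ColZero c j l s) :
    ColZero c s l m := fun i k n => by
  have e := hc.column hr h i k n
  have e1 : (if m = s' then -(d i * d k * (d s)⁻¹ * (d' s')⁻¹ * d' n) * c i k j l s n else 0) = 0 := by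
    split_ifs with H
    · rw [hm H, mul_zero]
    · rfl
  have e2 : (if l = s' then d j * c i k j s m n else 0) = 0 := by
    split_ifs with H
    · rw [hl H, mul_zero]
    · rfl
  rw [e1, e2, if_pos hj, add_zero] at e
  exact (mul_eq_zero.1 e.symm).resolve_left (hr.right_ne _)

theorem stepL (h : ColZero c j l m) (hc : IsCoinv QKind.GL q c) (hr : IsTriRep (q : ℂ) s s' d d')
    (hl : l = s') (hj : j = s' → ColZero c s l m) (hm : m = s' → ColZero c j l s) :
    ColZero c j s m := fun i k n => by
  have e := hc.column hr h i k n
  have e1 : (if m = s' then -(d i * d k * (d s)⁻¹ * (d' s')⁻¹ * d' n) * c i k j l s n else 0) = 0 := by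
    split_ifs with H
    · rw [hm H, mul_zero]
    · rfl
  have e2 : (if j = s' then d' l * c i k s l m n else 0) = 0 := by
    split_ifs with H
    · rw [hj H, mul_zero]
    · rfl
  rw [e1, e2, if_pos hl, zero_add] at e
  exact (mul_eq_zero.1 e.symm).resolve_left (hr.left_ne _)

theorem stepM (h : ColZero c j l m) (hc : IsCoinv QKind.GL q c) (hr : IsTriRep (q : ℂ) s s' d d')
    (hm : m = s') (hj : j = s' → ColZero c s l m) (hl : l = s' → ColZero c j s m) :
    ColZero c j l s := fun i k n => by
  have e := hc.column hr h i k n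
  have e1 : (if l = s' then d j * c i k j s m n else 0) = 0 := by
    split_ifs with H
    · rw [hl H, mul_zero]
    · rfl
  have e2 : (if j = s' then d' l * c i k s l m n else 0) = 0 := by
    split_ifs with H
    · rw [hj H, mul_zero]
    · rfl
  rw [e1, e2, if_pos hm, zero_add] at e
  refine (mul_eq_zero.1 e).resolve_left (neg_ne_zero.2 ?_)
  exact mul_ne_zero (mul_ne_zero (mul_ne_zero (mul_ne_zero (hr.left_ne _) (hr.left_ne _))
    (inv_ne_zero (hr.left_ne _))) (inv_ne_zero (hr.right_ne _))) (hr.right_ne _)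

end ColZero

theorem IsCoinv.colZero (hc : IsCoinv QKind.GL q c)
    (h1 : c 0 1 0 1 2 2 = 0) (h2 : c 0 2 0 1 2 1 = 0) (h3 : c 1 0 0 1 2 2 = 0)
    (h4 : c 1 2 0 1 2 0 = 0) (h5 : c 2 0 0 1 2 1 = 0) (h6 : c 2 1 0 1 2 0 = 0) :
    ColZero c 0 1 2 := fun a b n => by
  -- With distinct primes on the diagonal, the weight condition for the column (0,1,2) leaves only
  -- the entries where a, b, n are a permutation of 0, 1, 2. These are the six in the hypotheses.
  have h := hc.weight ![2, 3, 5] (fun i => by fin_cases i <;> simp) a b 0 1 2 n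
  fin_cases a <;> fin_cases b <;> fin_cases n <;> first
  | assumption
  | (refine (mul_eq_zero.1 h).resolve_left ?_; simp; norm_num; done)

/-- The column with three distinct indices generates the others under adjacent index changes. Each
step uses a relation of `IsCoinv.column` in which all columns but one are already known to vanish,
until all 27 are reached. -/
theorem IsCoinv.eq_zero (hc : IsCoinv QKind.GL q c) (h012 : ColZero c 0 1 2) : c = 0 := by
  have E0 := isTriRep_zero_one (QFun.q_ne q)
  have F0 := E0.transpose (QFun.q_ne q)
  have E1 := isTriRep_one_two (QFun.q_ne q)
  have F1 := E1.transpose (QFun.q_ne q)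
  have h002 : ColZero c 0 0 2 := h012.stepL hc E0 rfl (absurd · (by decide)) (absurd · (by decide))
  have h112 : ColZero c 1 1 2 := h012.stepJ hc F0 rfl (absurd · (by decide)) (absurd · (by decide))
  have h011 : ColZero c 0 1 1 := h012.stepM hc E1 rfl (absurd · (by decide)) (absurd · (by decide))
  have h022 : ColZero c 0 2 2 := h012.stepL hc F1 rfl (absurd · (by decide)) (absurd · (by decide))
  have h102 : ColZero c 1 0 2 := h002.stepJ hc F0 rfl (fun _ => h012) (absurd · (by decide))
  have h001 : ColZero c 0 0 1 := h002.stepM hc E1 rfl (absurd · (by decide)) (absurd · (by decide))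
  have h111 : ColZero c 1 1 1 := h112.stepM hc E1 rfl (absurd · (by decide)) (absurd · (by decide))
  have h010 : ColZero c 0 1 0 := h011.stepM hc E0 rfl (absurd · (by decide)) (fun _ => h001)
  have h021 : ColZero c 0 2 1 := h011.stepL hc F1 rfl (absurd · (by decide)) (fun _ => h012)
  have h122 : ColZero c 1 2 2 := h022.stepJ hc F0 rfl (absurd · (by decide)) (absurd · (by decide))
  have h212 : ColZero c 2 1 2 := h112.stepJ hc F1 rfl (fun _ => h122) (absurd · (by decide))
  have h101 : ColZero c 1 0 1 := h102.stepM hc E1 rfl (absurd · (by decide)) (absurd · (by decide))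
  have h202 : ColZero c 2 0 2 := h102.stepJ hc F1 rfl (absurd · (by decide)) (absurd · (by decide))
  have h000 : ColZero c 0 0 0 := h001.stepM hc E0 rfl (absurd · (by decide)) (absurd · (by decide))
  have h110 : ColZero c 1 1 0 := h111.stepM hc E0 rfl (fun _ => h011) (fun _ => h101)
  have h020 : ColZero c 0 2 0 := h010.stepL hc F1 rfl (absurd · (by decide)) (absurd · (by decide))
  have h121 : ColZero c 1 2 1 := h021.stepJ hc F0 rfl (absurd · (by decide)) (absurd · (by decide))
  have h211 : ColZero c 2 1 1 := h111.stepJ hc F1 rfl (fun _ => h121) (fun _ => h112)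
  have h222 : ColZero c 2 2 2 := h122.stepJ hc F1 rfl (absurd · (by decide)) (absurd · (by decide))
  have h100 : ColZero c 1 0 0 := h101.stepM hc E0 rfl (fun _ => h001) (absurd · (by decide))
  have h201 : ColZero c 2 0 1 := h101.stepJ hc F1 rfl (absurd · (by decide)) (fun _ => h102)
  have h120 : ColZero c 1 2 0 := h020.stepJ hc F0 rfl (absurd · (by decide)) (fun _ => h021)
  have h210 : ColZero c 2 1 0 := h110.stepJ hc F1 rfl (fun _ => h120) (absurd · (by decide))
  have h221 : ColZero c 2 2 1 := h121.stepJ hc F1 rfl (absurd · (by decide)) (fun _ => h122)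
  have h200 : ColZero c 2 0 0 := h100.stepJ hc F1 rfl (absurd · (by decide)) (absurd · (by decide))
  have h220 : ColZero c 2 2 0 := h120.stepJ hc F1 rfl (absurd · (by decide)) (absurd · (by decide))
  ext a b j l m n
  fin_cases j <;> fin_cases l <;> fin_cases m <;> exact (by assumption : ColZero c _ _ _) a b n

/-- The invariant combinations. -/
noncomputable def coinvForm {M : Type*} [AddCommGroup M] [Module ℂ M] (q u a b w g h : ℂ)
    (V W : Quad M) : Quad M :=
  u • V + a • swL .first q V + b • swR .first q V + w • swL .first q (swR .first q V) +
    g • W + h • swR .first q W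

theorem IsCoinv.exists_coinvForm (hc : IsCoinv QKind.GL q c) : ∃ u a b w g h : ℂ,
    c = coinvForm q u a b w g h tensorDz (tensorTr q) := by
  -- In the six entries of the column (0,1,2) allowed by weight, each of the six invariants equals 1
  -- in exactly one and 0 in the others; the trace weight of the last index is 1. So the
  -- coefficients are these entries of `c`, and the difference vanishes by `IsCoinv.eq_zero`.
  refine ⟨c 0 2 0 1 2 1, c 2 0 0 1 2 1, c 1 2 0 1 2 0, c 2 1 0 1 2 0, c 0 1 0 1 2 2,
    c 1 0 0 1 2 2, ?_⟩
  have hV := isCoinv_tensorDz (K := QKind.GL) (q := q)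
  have hW := isCoinv_tensorTr (K := QKind.GL) (q := q)
  have H : ∀ u a b w g h : ℂ, IsCoinv QKind.GL q
      (coinvForm q u a b w g h tensorDz (tensorTr q)) := fun u a b w g h =>
    ((((((hV.smul u).add ((hV.swL .first).smul a)).add ((hV.swR .first).smul b)).add
      (((hV.swR .first).swL .first).smul w)).add (hW.smul g)).add ((hW.swR .first).smul h))
  rw [← sub_eq_zero, sub_eq_add_neg, ← neg_one_smul ℂ (coinvForm _ _ _ _ _ _ _ _ _)]
  have hs := hc.add ((H (c 0 2 0 1 2 1) (c 2 0 0 1 2 1) (c 1 2 0 1 2 0) (c 2 1 0 1 2 0)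
    (c 0 1 0 1 2 2) (c 1 0 0 1 2 2)).smul (-1))
  refine hs.eq_zero (hs.colZero ?_ ?_ ?_ ?_ ?_ ?_) <;>
    simp [coinvForm, swL_apply, swR_apply, rd, rl, tensorDz, tensorTr, trWeight]

end Classification

/-! ### The Leibniz rule and associativity for the coefficients -/

namespace FODC
open MulOpposite
section RightAction
variable {K : QKind} {q : ℝ} [NeZero q] {Γ : FODC.{0, v} (QFun K q)}

theorem toForms_apply (f : Fin 3 → Fin 3 → ℂ) :
    Γ.toForms f = ∑ m, ∑ n, f m n • Γ.theta m n := rfl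

theorem toForms_tensorDz (a b j l : Fin 3) : Γ.toForms (tensorDz a b j l) = Γ.invDz a b j l := by
  by_cases h : a = j <;> simp [toForms_apply, tensorDz, invDz, h, ite_smul]

theorem toForms_tensorTr (a b j l : Fin 3) :
    Γ.toForms (tensorTr q a b j l) = Γ.invTr a b j l := by
  by_cases h : a = j <;> by_cases h' : b = l <;>
    simp [toForms_apply, tensorTr, invTr, h, h', ite_smul, trq, trWeight, Fin.sum_univ_three]

variable (hΓ : Γ.IsDzBasis)
include hΓ

theorem IsDzBasis.counitCoord_toForms (f : Fin 3 → Fin 3 → ℂ) (m n : Fin 3) :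
    hΓ.counitCoord m n (Γ.toForms f) = f m n := by
  simp [toForms_apply, hΓ.counitCoord_theta]

theorem IsDzBasis.toForms_injective : Function.Injective Γ.toForms := fun f g h => by
  ext m n
  rw [← hΓ.counitCoord_toForms f, h, hΓ.counitCoord_toForms]

theorem IsDzBasis.eq_of_expand_toForms {y y' : Quad (Fin 3 → Fin 3 → ℂ)}
    (h : Γ.expand (fun a b j l => Γ.toForms (y a b j l)) =
      Γ.expand fun a b j l => Γ.toForms (y' a b j l)) : y = y' := by
  have := Γ.expand_injective h
  ext a b j l : 4
  exact hΓ.toForms_injective (congrFun (congrFun (congrFun (congrFun this a) b) j) l)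

/-- The differentiated RTT relation, brought down from forms to coefficients by the injectivity of
the expansion. -/
theorem IsLeftCoaction.swL_coeff_add {ΔL : Γ.Form →ₗ[ℂ] QFun K q ⊗[ℂ] Γ.Form}
    (h : Γ.IsLeftCoaction ΔL) (ν : Family) :
    swL ν (q : ℂ) (hΓ.coeff + tensorDz) = swR ν (q : ℂ) (hΓ.coeff + tensorDz) := by
  apply hΓ.eq_of_expand_toForms
  have e := Γ.swL_dzMulZ_add ν
  have e1 : Γ.dzMulZ + Γ.zMulDz =
      Γ.expand fun a b j l => Γ.toForms ((hΓ.coeff + tensorDz) a b j l) := by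
    rw [hΓ.dzMulZ_eq_expand h, ← expand_invDz, ← expand_add]
    congr 1
    ext a b j l
    simp only [Pi.add_apply, map_add, toForms_tensorDz]
  rw [e1, swL_expand, swR_expand] at e
  simp only [map_swL_apply Γ.toForms, map_swR_apply Γ.toForms]
  exact e

/-- The matrices of right multiplication by the generators. -/
noncomputable def IsDzBasis.rightMat (b l : Fin 3) : Matrix (Fin 3 × Fin 3) (Fin 3 × Fin 3) ℂ :=
  fun A C => hΓ.coeff A.1 b A.2 l C.1 C.2

theorem IsDzBasis.op_z_smul_toForms {ΔL : Γ.Form →ₗ[ℂ] QFun K q ⊗[ℂ] Γ.Form}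
    (h : Γ.IsLeftCoaction ΔL) (f : Fin 3 × Fin 3 → ℂ) (k l : Fin 3) :
    op (QFun.z K q k l) • Γ.toForms (fun m n => f (m, n)) = ∑ b, QFun.z K q k b •
      Γ.toForms (fun m n => Matrix.vecMul f (hΓ.rightMat b l) (m, n)) := by
  have hY := hΓ.dzMulZ_eq_expand h
  have e1 : ∀ b, Γ.toForms (fun m n => Matrix.vecMul f (hΓ.rightMat b l) (m, n)) =
      ∑ a, ∑ j, f (a, j) • Γ.toForms (hΓ.coeff a b j l) := fun b => by
    simp only [← map_smul, ← map_sum]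
    congr 1
    ext m n
    simp [Matrix.vecMul, dotProduct, Fintype.sum_prod_type, rightMat]
  simp only [e1, Finset.smul_sum]
  rw [toForms_apply, Finset.smul_sum]
  rw [Finset.sum_comm]
  refine Finset.sum_congr rfl fun a _ => ?_
  rw [Finset.smul_sum, Finset.sum_comm]
  refine Finset.sum_congr rfl fun j _ => ?_
  rw [smul_comm, Γ.theta_mul_z hY, Finset.smul_sum]
  exact Finset.sum_congr rfl fun b _ => smul_comm _ _ _

/-- Right multiplication is an action, so two successive generators act on an invariant form through
ZZ and the product of the matrices. The RTT relation of Z then passes to the matrices, since the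
expansion is unique. -/
theorem IsDzBasis.isQMatrix_rightMat {ΔL : Γ.Form →ₗ[ℂ] QFun K q ⊗[ℂ] Γ.Form}
    (h : Γ.IsLeftCoaction ΔL) : IsQMatrix (q : ℂ) hΓ.rightMat := by
  refine IsQMatrix.of_swL_prodQuad (QFun.q_ne q) ?_
  have key : ∀ f : Fin 3 × Fin 3 → ℂ,
      (fun i k j l => op (prodQuad (QFun.z K q) i k j l) • Γ.toForms (fun m n => f (m, n))) =
      Γ.expand fun a b j l => Γ.toForms fun m n =>
        Matrix.vecMul f (prodQuad hΓ.rightMat a b j l) (m, n) := fun f => by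
    ext i k j l
    simp only [prodQuad, op_mul, mul_smul, expand_apply]
    rw [hΓ.op_z_smul_toForms h f, Finset.smul_sum]
    refine Finset.sum_congr rfl fun a _ => ?_
    rw [op_smul_comm, hΓ.op_z_smul_toForms h, Finset.smul_sum]
    refine Finset.sum_congr rfl fun b _ => ?_
    rw [Matrix.vecMul_vecMul]
  ext a b j l A C
  have e1 : swL .second (q : ℂ) (fun a b j l => fun m n =>
        Matrix.vecMul (Pi.single A 1) (prodQuad hΓ.rightMat a b j l) (m, n)) =
      swR .second (q : ℂ) (fun a b j l => fun m n =>
        Matrix.vecMul (Pi.single A 1) (prodQuad hΓ.rightMat a b j l) (m, n)) := by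
    apply hΓ.eq_of_expand_toForms
    simp only [map_swL_apply Γ.toForms, map_swR_apply Γ.toForms]
    rw [← swL_expand, ← swR_expand, ← key]
    ext i k j l
    have := congrFun (congrFun (congrFun (congrFun
      ((QFun.isQPoint K q).toIsQMatrix.swL_prodQuad (QFun.q_ne q) .second) i) k) j) l
    have := congrArg (fun a : QFun K q => op a • Γ.toForms (fun m n => (Pi.single A 1 : Fin 3 × Fin 3 → ℂ) (m, n))) this
    simpa only [swL_apply, swR_apply, op_add, op_smul, add_smul, smul_assoc] using this
  have e2 := congrFun (congrFun (congrFun (congrFun (congrFun (congrFun e1 a) b) j) l) C.1) C.2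
  simpa [swL_apply, swR_apply, Matrix.single_one_vecMul] using e2

end RightAction
end FODC

/-! ### Solving for the coefficients -/

section Solving
variable {q : ℂ} {c : Quad (Fin 3 → Fin 3 → ℂ)}

/-- The matrices with the given entries. -/
def quadMat (c : Quad (Fin 3 → Fin 3 → ℂ)) (b l : Fin 3) :
    Matrix (Fin 3 × Fin 3) (Fin 3 × Fin 3) ℂ := fun A C => c A.1 b A.2 l C.1 C.2

theorem quadMat_mul_apply (c : Quad (Fin 3 → Fin 3 → ℂ)) (b l b' l' a j m n : Fin 3) :
    (quadMat c b l * quadMat c b' l') (a, j) (m, n) =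
      ∑ x, ∑ y, c a b j l x y * c x b' y l' m n := by
  simp only [Matrix.mul_apply, Fintype.sum_prod_type, quadMat]

/-- Two entries of the Leibniz condition suffice. The parameters left are the common value of a and
b, and w, g, h. -/
theorem coinvForm_leibniz {u a b w g h : ℂ}
    (hc : swL .first q (coinvForm q u a b w g h tensorDz (tensorTr q) + tensorDz) =
      swR .first q (coinvForm q u a b w g h tensorDz (tensorTr q) + tensorDz)) :
    a = b ∧ u + 1 + a * (q⁻¹ - q) = w := by
  have e1 := congrFun (congrFun (congrFun (congrFun (congrFun (congrFun hc 0) 2) 0) 1) 2) 1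
  have e2 := congrFun (congrFun (congrFun (congrFun (congrFun (congrFun hc 2) 0) 0) 1) 2) 1
  simp [coinvForm, swL_apply, swR_apply, rd, rl, tensorDz, tensorTr, trWeight] at e1 e2
  exact ⟨e1, by linear_combination e2⟩

/-- A single entry of the commutation of the matrices of z⁰₁ and z¹₀. The two roots of the resulting
equation are the two families. -/
theorem coinvForm_quadratic (hq : q ≠ 0) {v w g h : ℂ}
    (hM : IsQMatrix q (quadMat
      (coinvForm q (w - 1 - v * (q⁻¹ - q)) v v w g h tensorDz (tensorTr q)))) :
    v * (v - (q - q⁻¹) * w) = 0 := by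
  have e := congrFun (congrFun (hM.anti 0 1 1 0 (by decide) (by decide)) (1, 2)) (1, 2)
  rw [quadMat_mul_apply, quadMat_mul_apply] at e
  simp [coinvForm, swL_apply, swR_apply, rd, rl, tensorDz, tensorTr, trWeight, Fin.sum_univ_three] at e
  rcases e with e | e
  · linear_combination v * e
  · rw [e, zero_mul]

theorem gform_linear (ν : FODC.Family) (hq : q ≠ 0) {t g h : ℂ}
    (hM : IsQMatrix q (quadMat (gform ν q t g h tensorDz (tensorTr q)))) :
    h * gden ν q t + t * (t - 1) * rmu ν q = 0 := by
  have e := congrFun (congrFun (hM.anti 0 1 1 0 (by decide) (by decide)) (1, 0)) (1, 0)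
  rw [quadMat_mul_apply, quadMat_mul_apply] at e
  cases ν
  · simp [gform, swL_apply, swR_apply, rd, rl, tensorDz, tensorTr, trWeight, Fin.sum_univ_three] at e
    simp only [gden, rmu]
    have hp := mul_inv_cancel₀ hq
    linear_combination e - (h * t * (q * q⁻¹ + 1 - q ^ 2) - 2 * h * t) * hp
  · simp [gform, swL_apply, swR_apply, rd, rl, tensorDz, tensorTr, trWeight, Fin.sum_univ_three] at e
    simp only [gden, rmu]
    have hp := mul_inv_cancel₀ hq
    linear_combination e + h * t * q ^ 4 * hp

theorem gform_const_first (hq : q ≠ 0) {t g h : ℂ}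
    (hM : IsQMatrix q (quadMat (gform .first q t g h tensorDz (tensorTr q)))) :
    g * gden .first q t + (t - 1) ^ 2 = 0 := by
  have e := congrFun (congrFun (hM.row 1 1 2 (by decide)) (0, 0)) (1, 2)
  rw [Matrix.smul_apply, quadMat_mul_apply, quadMat_mul_apply] at e
  simp [gform, swL_apply, swR_apply, rd, rl, tensorDz, tensorTr, trWeight, Fin.sum_univ_three] at e
  simp only [gden]
  have hp := mul_inv_cancel₀ hq
  linear_combination e + (g * t + t * (t - 1)) * hp

theorem gform_const_second (hq : q ≠ 0) {t g h : ℂ}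
    (hM : IsQMatrix q (quadMat (gform .second q t g h tensorDz (tensorTr q)))) :
    g * gden .second q t + (t - 1) ^ 2 = 0 := by
  have e := congrFun (congrFun (hM.row 0 0 1 (by decide)) (1, 1)) (0, 1)
  rw [Matrix.smul_apply, quadMat_mul_apply, quadMat_mul_apply] at e
  simp [gform, swL_apply, swR_apply, rd, rl, tensorDz, tensorTr, trWeight, Fin.sum_univ_three] at e
  simp only [gden]
  have hp := mul_inv_cancel₀ hq
  linear_combination e + (g * t * q ^ 4 + t * (t - 1)) * hp

/-- At the nonzero root, expressing R⁻¹ as R - (q - q⁻¹) collapses the four terms in V into those of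
the second family; the term in R_R W shifts g. -/
theorem coinvForm_eq_gform_second (w g h : ℂ) {M : Type*} [AddCommGroup M] [Module ℂ M]
    (V W : Quad M) :
    coinvForm q (w - 1 - (q - q⁻¹) * w * (q⁻¹ - q)) ((q - q⁻¹) * w) ((q - q⁻¹) * w) w g h V W =
      gform .second q w (g - (q - q⁻¹) * h) h V W := by
  simp only [coinvForm, gform, swL_first_eq, swR_first_eq, map_sub, map_smul]
  module

theorem gform_coefficients (ν : FODC.Family) (hq : q ≠ 0) (hρ : trRho ν q ≠ 0) {t g h : ℂ}
    (hM : IsQMatrix q (quadMat (gform ν q t g h tensorDz (tensorTr q)))) :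
    gden ν q t ≠ 0 ∧ g = gcoef ν q t ∧ h = hcoef ν q t := by
  have e1 := gform_linear ν hq hM
  have e2 : g * gden ν q t + (t - 1) ^ 2 = 0 := by
    cases ν
    · exact gform_const_first hq hM
    · exact gform_const_second hq hM
  -- If `gden` vanished, the equation for g would give t = 1. But at t = 1 the denominator is
  -- `trRho`, which is nonzero.
  have hd : gden ν q t ≠ 0 := fun h0 => by
    rw [h0, mul_zero, zero_add, sq_eq_zero_iff, sub_eq_zero] at e2
    apply hρ
    rw [gden_eq, e2] at h0
    simpa using h0
  refine ⟨hd, ?_, ?_⟩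
  · rw [gcoef, div_mul_eq_mul_div, eq_div_iff hd]
    linear_combination e2
  · rw [hcoef, div_mul_eq_mul_div, div_mul_eq_mul_div, ← neg_div, eq_div_iff hd]
    linear_combination e1

theorem exists_eq_gform (hq : q ≠ 0) (hρ : ∀ ν, trRho ν q ≠ 0) {u a b w g h : ℂ}
    (hc : c = coinvForm q u a b w g h tensorDz (tensorTr q))
    (hL : swL .first q (c + tensorDz) = swR .first q (c + tensorDz))
    (hM : IsQMatrix q (quadMat c)) : ∃ ν t, gden ν q t ≠ 0 ∧
      c = gform ν q t (gcoef ν q t) (hcoef ν q t) tensorDz (tensorTr q) := by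
  have key : ∀ (ν : FODC.Family) (t g h : ℂ), c = gform ν q t g h tensorDz (tensorTr q) →
      ∃ ν t, gden ν q t ≠ 0 ∧
        c = gform ν q t (gcoef ν q t) (hcoef ν q t) tensorDz (tensorTr q) := fun ν t g h e => by
    rw [e] at hM
    obtain ⟨h1, h2, h3⟩ := gform_coefficients ν hq (hρ ν) hM
    exact ⟨ν, t, h1, by rw [e, ← h2, ← h3]⟩
  rw [hc] at hL
  obtain ⟨rfl, e⟩ := coinvForm_leibniz hL
  obtain rfl : u = w - 1 - a * (q⁻¹ - q) := by linear_combination e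
  have h2 := hM
  rw [hc] at h2
  rcases mul_eq_zero.1 (coinvForm_quadratic hq h2) with h0 | h0
  · refine key .first w g h (hc.trans ?_)
    simp [coinvForm, gform, h0]
  · rw [sub_eq_zero] at h0
    rw [h0, coinvForm_eq_gform_second] at hc
    exact key _ _ _ _ hc

end Solving

/-! ### Reality of the parameter and the main theorem -/

namespace FODC
open MulOpposite
variable {q : ℝ} [NeZero q] {Γ : FODC.{0, v} (QFun QKind.GL q)}

/-- The involution is applied to the rule for θ z, and the factors S and z are cancelled on either
side. The result is again governed by the rule for θ z, with the index pairs exchanged. -/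
theorem IsStar.map_expand {Y : Quad Γ.Form} (hY : Γ.dzMulZ = Γ.expand Y) {s : Γ.Form → Γ.Form}
    (hs : Γ.IsStar s) (a c j l : Fin 3) : s (Y a c j l) = -Y j l a c := by
  have hsum : ∀ f : Fin 3 → Γ.Form, s (∑ b, f b) = ∑ b, s (f b) :=
    fun f => map_sum (AddMonoidHom.mk' s hs.add) f _
  have e1 : ∀ k, ∑ b, op (QFun.S QKind.GL q b k) • s (Y a b j l) =
      -(QFun.S QKind.GL q l k • Γ.theta j a) := fun k => by
    have e := congrArg s (Γ.theta_mul_z hY a j k l)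
    rw [hs.right, hs.theta, hsum] at e
    simp only [hs.left, star_z, smul_neg] at e
    exact e.symm
  have e2 : ∑ k, op (QFun.z QKind.GL q k c) • ∑ b, op (QFun.S QKind.GL q b k) • s (Y a b j l) =
      s (Y a c j l) := by
    simp only [Finset.smul_sum, smul_smul, ← op_mul]
    rw [Finset.sum_comm]
    simp only [← Finset.sum_smul, ← Finset.op_sum, sum_S_mul_z]
    simp [apply_ite op, ite_smul]
  rw [← e2, ← Γ.sum_S_smul_sum_z_smul (fun l => Y j l a c) l, ← Finset.sum_neg_distrib]
  refine Finset.sum_congr rfl fun k _ => ?_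
  rw [e1, smul_neg, op_smul_comm, Γ.theta_mul_z hY]

section
variable (hΓ : Γ.IsDzBasis)
include hΓ

theorem IsDzBasis.exists_braidRel (hq1 : q ≠ 1) (hq2 : q ≠ -1) (h : Γ.IsBicovariant) :
    ∃ ν t, gden ν (q : ℂ) t ≠ 0 ∧ Γ.BraidRel ν t := by
  obtain ⟨⟨ΔL, hL⟩, ΔR, hR⟩ := h
  have hL' : Γ.IsLeftCoaction ΔL := hL
  have hR' : Γ.IsRightCoaction ΔR := hR
  have hc : IsCoinv QKind.GL q hΓ.coeff :=
    (isCoinv_iff _).2 fun i k j l m n => hR'.coeff_eq hΓ hL' i k j l m n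
  obtain ⟨u, a, b, w, g, h, e⟩ := hc.exists_coinvForm
  obtain ⟨ν, t, h1, h2⟩ := exists_eq_gform (QFun.q_ne q) (trRho_ne_zero hq1 hq2) e
    (hL'.swL_coeff_add hΓ .first) (hΓ.isQMatrix_rightMat hL')
  refine ⟨ν, t, h1, (braidRel_iff_expand).2 ?_⟩
  rw [hΓ.dzMulZ_eq_expand hL', h2]
  congr 1
  ext a b j l
  simp only [gform, Pi.add_apply, Pi.smul_apply, map_add, map_smul, toForms_tensorDz,
    toForms_tensorTr, map_swL_apply Γ.toForms, map_swR_apply Γ.toForms]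

/-- For t = 0 every right product θ⁰₁ z would vanish, while ZS = 1 recovers θ⁰₁ from these products.
-/
theorem BraidRel.ne_zero {ν : Family} {t : ℂ} (h : Γ.BraidRel ν t) : t ≠ 0 := by
  rintro rfl
  have hY := braidRel_iff_expand.1 h
  have h0 : ∀ k l, op (QFun.z QKind.GL q k l) • Γ.theta 0 1 = 0 := fun k l => by
    rw [Γ.theta_mul_z hY]
    refine Finset.sum_eq_zero fun b _ => ?_
    simp [gform, hcoef, invDz, invTr]
  have h1 : op (∑ k, QFun.z QKind.GL q 0 k * QFun.S QKind.GL q k 0) • Γ.theta 0 1 = 0 := by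
    simp only [Finset.op_sum, Finset.sum_smul, op_mul, mul_smul, h0, smul_zero,
      Finset.sum_const_zero]
  rw [sum_z_mul_S, if_pos rfl, op_one, one_smul] at h1
  have h2 := hΓ.counitCoord_theta 0 1 0 1
  rw [h1] at h2
  simp at h2

/-- The entry (0,1;2,1) of the invariant forms is t θ⁰₂ and the exchanged entry is t θ²₀. The
involution is conjugate linear and maps θ⁰₂ to -θ²₀. -/
theorem BraidRel.conj_eq {ν : Family} {t : ℂ} (h : Γ.BraidRel ν t) {s : Γ.Form → Γ.Form}
    (hs : Γ.IsStar s) : (starRingEnd ℂ) t = t := by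
  have hY := braidRel_iff_expand.1 h
  have e := hs.map_expand hY 0 1 2 1
  have e1 : gform ν (q : ℂ) t (gcoef ν q t) (hcoef ν q t) Γ.invDz Γ.invTr 0 1 2 1 =
      t • Γ.theta 0 2 := by
    simp [gform, swL_apply, swR_apply, invDz, invTr, rd_of_ne]
  have e2 : gform ν (q : ℂ) t (gcoef ν q t) (hcoef ν q t) Γ.invDz Γ.invTr 2 1 0 1 =
      t • Γ.theta 2 0 := by
    simp [gform, swL_apply, swR_apply, invDz, invTr, rd_of_ne]
  have e0 : s (t • Γ.theta 0 2) = starRingEnd ℂ t • s (Γ.theta 0 2) :=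
    complex_smul_of_antilinear (φ := AddMonoidHom.mk' s hs.add) hs.left t _
  rw [e1, e2, e0, hs.theta] at e
  have e3 := congrArg (hΓ.counitCoord 2 0) e
  simpa [hΓ.counitCoord_theta] using e3

theorem IsDzBasis.exists_isGamma (hq1 : q ≠ 1) (hq2 : q ≠ -1) (h : Γ.IsBicovariantStar) :
    ∃ (ν : Family) (t : ℝ), Γ.IsGamma ν (t : ℂ) := by
  obtain ⟨ν, t, h1, h2⟩ := hΓ.exists_braidRel hq1 hq2 h.1
  obtain ⟨s, hs⟩ := h.2
  obtain ⟨r, rfl⟩ := Complex.conj_eq_iff_real.1 (h2.conj_eq hΓ hs)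
  exact ⟨ν, r, (Γ.isGamma_iff ν _).2 ⟨h2.ne_zero hΓ, h1, hΓ, h2⟩⟩

end

theorem IsGamma.equivalent_iff (hq1 : q ≠ 1) (hq2 : q ≠ -1) {K : QKind}
    {Γ : FODC.{0, v} (QFun K q)} {Γ' : FODC.{0, w} (QFun K q)} {ν ν' : Family} {t t' : ℂ}
    (h : Γ.IsGamma ν t) (h' : Γ'.IsGamma ν' t') : Γ.Equivalent Γ' ↔ ν = ν' ∧ t = t' := by
  obtain ⟨ht, -, hb, hr⟩ := (Γ.isGamma_iff ν t).1 h
  obtain ⟨-, -, hb', hr'⟩ := (Γ'.isGamma_iff ν' t').1 h'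
  constructor
  · intro e
    obtain ⟨φ, hφ⟩ := e.exists_isOver
    exact BraidRel.unique hq1 hq2 hb' (hφ.braidRel (fun _ _ => rfl) hr) hr' ht
  · rintro ⟨rfl, rfl⟩
    exact hr.equivalent hb hr' hb'

theorem Unimodular.eq {ν : Family} {t t' : ℝ} (h : Unimodular q ν t) (h' : Unimodular q ν t') :
    t = t' := by
  refine (Odd.strictMono_pow (by decide : Odd 3)).injective (?_ : t ^ 3 = t' ^ 3)
  cases ν <;> exact h.trans h'.symm

end FODC

theorem mainTheorem7 (q : ℝ) [NeZero q] (hq1 : q ≠ 1) (hq2 : q ≠ -1) :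
    -- the bicovariant `*`-calculi on `U_q(3)` are the `Γ_ν(t)` with real `t`
    (∀ Γ : FODC.{0, v} (QFun QKind.GL q), Γ.IsDzBasis →
      (Γ.IsBicovariantStar ↔ ∃ (ν : FODC.Family) (t : ℝ), Γ.IsGamma ν (t : ℂ))) ∧
    -- every `Γ_ν(t)` exists
    (∀ (ν : FODC.Family) (t : ℝ), FODC.Admissible (q : ℂ) ν (t : ℂ) →
      ∃ Γ : FODC.{0, 0} (QFun QKind.GL q), Γ.IsGamma ν (t : ℂ)) ∧
    -- it is determined by `ν` and `t`, which are determined by it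
    (∀ (ν ν' : FODC.Family) (t t' : ℂ) (Γ : FODC.{0, v} (QFun QKind.GL q))
      (Γ' : FODC.{0, w} (QFun QKind.GL q)), Γ.IsGamma ν t → Γ'.IsGamma ν' t' →
      (Γ.Equivalent Γ' ↔ ν = ν' ∧ t = t')) ∧
    -- the `*`-structure
    (∀ (ν : FODC.Family) (t : ℝ) (Γ : FODC.{0, v} (QFun QKind.GL q)), Γ.IsGamma ν (t : ℂ) →
      ∃! s : Γ.Form → Γ.Form, Γ.IsStar s ∧ ∀ i j : Fin 3, s (Γ.theta i j) = -Γ.theta j i) ∧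
    (∀ (Γ : FODC.{0, v} (QFun QKind.GL q)) (s : Γ.Form → Γ.Form), Γ.IsStar s →
      ∀ i j : Fin 3, s (Γ.theta i j) = -Γ.theta j i) ∧
    -- which of them induce calculi on `SU_q(3)`
    (∀ (ν : FODC.Family) (t : ℝ) (Γ : FODC.{0, v} (QFun QKind.GL q)), Γ.IsGamma ν (t : ℂ) →
      (FODC.Unimodular q ν t → ∃ Γ' : FODC.{0, 0} (QFun QKind.SL q), Γ.Induces Γ') ∧
      (∀ Γ' : FODC.{0, w} (QFun QKind.SL q), Γ.Induces Γ' →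
        FODC.Unimodular q ν t ∧ Γ'.IsGamma ν (t : ℂ) ∧ Γ'.IsBicovariantStar)) ∧
    -- exactly two calculi are induced on `SU_q(3)`, one by each family
    ∃ (t₁ t₂ : ℝ) (Γ₁ Γ₂ : FODC.{0, 0} (QFun QKind.SL q)),
      t₁ ^ 3 = q ^ 2 ∧ t₂ ^ 3 = (q ^ 2)⁻¹ ∧
      Γ₁.IsGamma FODC.Family.first (t₁ : ℂ) ∧ Γ₂.IsGamma FODC.Family.second (t₂ : ℂ) ∧
      Γ₁.IsBicovariantStar ∧ Γ₂.IsBicovariantStar ∧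
      (∃ Γ : FODC.{0, 0} (QFun QKind.GL q),
        Γ.IsDzBasis ∧ Γ.IsBicovariantStar ∧ Γ.Induces Γ₁) ∧
      (∃ Γ : FODC.{0, 0} (QFun QKind.GL q),
        Γ.IsDzBasis ∧ Γ.IsBicovariantStar ∧ Γ.Induces Γ₂) ∧
      ¬ Γ₁.Equivalent Γ₂ ∧
      ∀ (Γ : FODC.{0, v} (QFun QKind.GL q)) (Γ' : FODC.{0, w} (QFun QKind.SL q)),
        Γ.IsDzBasis → Γ.IsBicovariantStar → Γ.Induces Γ' →
        (Γ'.Equivalent Γ₁ ∨ Γ'.Equivalent Γ₂) := by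
  refine ⟨fun Γ hΓ => ⟨hΓ.exists_isGamma hq1 hq2, fun ⟨_, _, h⟩ => h.isBicovariantStar⟩,
    fun ν t h => FODC.exists_isGamma_GL hq1 hq2 h,
    fun ν ν' t t' Γ Γ' h h' => h.equivalent_iff hq1 hq2 h', fun ν t Γ h => ?_,
    fun Γ s hs => hs.theta, fun ν t Γ h => ⟨fun hu => ?_, fun Γ' hi => ?_⟩, ?_⟩
  · obtain ⟨s, hs⟩ := h.isBicovariantStar.2
    exact ⟨s, ⟨hs, hs.theta⟩, fun s' hs' => hs'.1.unique hs⟩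
  · obtain ⟨Γ', h'⟩ := FODC.exists_isGamma_SL hq1 hq2 h.1 hu
    exact ⟨Γ', h.induces h'⟩
  · exact ⟨hi.unimodular hq1 hq2 h, hi.isGamma h, (hi.isGamma h).isBicovariantStar⟩
  · obtain ⟨t₁, hu₁, ha₁⟩ := FODC.exists_unimodular hq1 hq2 .first
    obtain ⟨t₂, hu₂, ha₂⟩ := FODC.exists_unimodular hq1 hq2 .second
    obtain ⟨Γ₁, h₁⟩ := FODC.exists_isGamma_SL hq1 hq2 ha₁ hu₁
    obtain ⟨Γ₂, h₂⟩ := FODC.exists_isGamma_SL hq1 hq2 ha₂ hu₂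
    obtain ⟨Δ₁, g₁⟩ := FODC.exists_isGamma_GL hq1 hq2 ha₁
    obtain ⟨Δ₂, g₂⟩ := FODC.exists_isGamma_GL hq1 hq2 ha₂
    refine ⟨t₁, t₂, Γ₁, Γ₂, hu₁, hu₂, h₁, h₂, h₁.isBicovariantStar, h₂.isBicovariantStar,
      ⟨Δ₁, g₁.2.1, g₁.isBicovariantStar, g₁.induces h₁⟩,
      ⟨Δ₂, g₂.2.1, g₂.isBicovariantStar, g₂.induces h₂⟩, fun e => ?_, fun Γ Γ' hb hs hi => ?_⟩
    · exact nomatch ((h₁.equivalent_iff hq1 hq2 h₂).1 e).1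
    · obtain ⟨ν, t, h⟩ := hb.exists_isGamma hq1 hq2 hs
      -- An induced calculus is a Γ_ν(t) whose t has a prescribed cube. Real cube roots are unique,
      -- so it is one of the two calculi constructed above.
      have hu := hi.unimodular hq1 hq2 h
      have h' := hi.isGamma h
      cases ν
      · exact Or.inl ((h'.equivalent_iff hq1 hq2 h₁).2 ⟨rfl, congrArg _ (hu.eq hu₁)⟩)
      · exact Or.inr ((h'.equivalent_iff hq1 hq2 h₂).2 ⟨rfl, congrArg _ (hu.eq hu₂)⟩)
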